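/- **Setting.** Let $E$ be a real Banach space, $\ell\in\mathbb N$, $T>0$, $2\le p<\gamma<[p]+1$, where $[\cdot]$ and $\{\cdot\}$ denote integer and fractional parts. For real $g>0$, a map $W$ from $E$ to a normed space is *$g$-Lipschitz* if it is $C^{[g]}$ and $$\|W\|_g=\sum_{r=0}^{[g]}\sup_x|W^{(r)}(x)|+\|W^{([g])}\|_{\{g\}\text{-H\"older}}<\infty .$$ Let $T^{([p])}_\ell=\bigoplus_{r=0}^{[p]}(\mathbb R^\ell)^{\otimes r}$ be the truncated tensor algebra, with canonical basis $e_1,\dots,e_\ell$ of $\mathbb R^\ell$, let $\mathfrak g$ be its Lie subalgebra generated by $\mathbb R^\ell$, and $G=\exp(\mathfrak g)$. Let $\mathbf X$ be a Hölder weak geometric $p$-rough path on $[0,T]$, that is, a $G$-valued path such that the components of $\mathbf X_{ts}:=\mathbf X_s^{-1}\mathbf X_t$ satisfy $\sup_{0\le s<t\le T}|X^i_{ts}|/|t-s|^{i/p}<\infty$ for $1\le i\le[p]$. For a word $I=(i_1,\dots,i_r)$ in $\{1,\dots,\ell\}$ put $e_{[I]}=[e_{i_1},[e_{i_2},\dots[e_{i_{r-1}},e_{i_r}]]\dots]$,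 and for vector fields $V_1,\dots,V_\ell$ on $E$ put $V_{[I]}=[V_{i_1},[V_{i_2},\dots[V_{i_{r-1}},V_{i_r}]]\dots]$, with $[V,W]=DW\cdot V-DV\cdot W$. There are reals $\Lambda^I_{ts}$ ($0\le s\le t\le T$, $1\le|I|\le[p]$) with $$\exp\Big(\sum_{1\le|I|\le[p]}\Lambda^I_{ts}e_{[I]}\Big)=\mathbf X_{ts};$$ fix any choice of them. Given a vector field $V$ on $E$, consider the ordinary differential equation $$\dot y_u=(t-s)V(y_u)+\sum_{r=1}^{[p]}\ \sum_{I\in\{1,\dots,\ell\}^r}\Lambda^I_{ts}V_{[I]}(y_u),\qquad 0\le u\le1. \tag{$*$}$$ A *log-ODE family* is a family $(\mu_{ts})_{0\le s\le t\le T}$ of maps $E\to E$ such that, for every $s\le t$ and every $x\in E$, $\mu_{ts}(x)=y_1$ for some solution $y$ of $(*)$ with $y_0=x$. **Definitions.** A family $(\mu_{ts})_{0\le s\le t\le T}$ of maps $E\to E$ is an *approximate flow* with exponent $a>1$ if for some $c_1>0$ $$\|\mu_{tu}\circ\mu_{us}-\mu_{ts}\|_\infty\le c_1|t-s|^a\qquad\text{for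 all }0\le s\le u\le t\le T .$$ It is a *$C^1$-approximate flow* with exponent $a$ if moreover there are $\alpha,\rho'$ with $0<1-\rho'<\alpha<1$ such that each $\mu_{ts}-\mathrm{Id}$ is $(1+\rho')$-Lipschitz, $D_x\mu_{ts}=\mathrm{Id}+A^{ts}_x+B^{ts}_x$ with $A^{ts}:E\to L(E)$ $\rho'$-Lipschitz with $\|A^{ts}\|_{\rho'}\le c|t-s|^\alpha$ for a constant $c$, and $B^{ts}:E\to L(E)$ of class $C^1$ with $C^1$-norm at most $o_{t-s}(1)$ (a function of $t-s$ that tends to $0$ as $t-s\to0$), and, for some $c_3>0$, $$|D_x(\mu_{tu}\circ\mu_{us})-D_x\mu_{ts}|\le c_3|t-s|^a\qquad\text{for all }x\in E,\ 0\le s\le u\le t\le T .$$ **Proposition.** 1. Suppose that $V$ is bounded and Lipschitz continuous and that $V_1,\dots,V_\ell$ are $(\gamma-1)$-Lipschitz. If every $V_{[I]}$ with $1\le|I|\le[\gamma]$ maps each ball into a compact set (which is automatic if $\dim E<\infty$), then $(*)$ has a solution on $[0,1]$ from every starting point, for all $0\le s\le t\le T$. Every log-ODE family $(\mu_{ts})$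 is an approximate flow, for some exponent $a>1$. 2. Suppose that $V$ is $(1+\rho)$-Lipschitz for some $\rho>\frac{p-[p]}{p}$ and that $V_1,\dots,V_\ell$ are $\gamma$-Lipschitz. Then for all $0\le s\le t\le T$ and $x\in E$ the time-$1$ value of the solution of $(*)$ from $x$ exists and is unique, and the resulting family $(\mu_{ts})$ is a $C^1$-approximate flow with exponent $a=\min\left(1+\frac{\rho}{p},\frac{\gamma}{p}\right)$. -/

import Mathlib

open Set Filter Topology
open scoped ENNReal NNReal

noncomputable section

namespace RoughFlow

/-! ### Regularity classes -/

section Regularity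

variable {E F : Type*} [NormedAddCommGroup E] [NormedSpace ℝ E]
  [NormedAddCommGroup F] [NormedSpace ℝ F]

/-- The `C^k` norm: the sum over `r ≤ k` of the sup norms of the differentials of order `r`
(possibly `∞`; meaningful for `W` of class `C^k`). -/
def eCkNorm (k : ℕ) (W : E → F) : ℝ≥0∞ :=
  ∑ r ∈ Finset.range (k + 1), ⨆ x : E, ‖iteratedFDeriv ℝ r W x‖ₑ

/-- The `g`-Lipschitz norm: the `C^[g]` norm plus the `{g}`-Hölder seminorm of the differential
of order `[g]`, where `[g]` and `{g}` are the integer and fractional parts of `g`. -/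
def eLipNorm (g : ℝ) (W : E → F) : ℝ≥0∞ :=
  eCkNorm ⌊g⌋₊ W + eHolderNorm (Int.fract g).toNNReal (iteratedFDeriv ℝ ⌊g⌋₊ W)

/-- `W` is `g`-Lipschitz (in the sense of Stein): it is `C^[g]`, it is bounded together with its
derivatives up to order `[g]`, and the derivative of order `[g]` is `{g}`-Hölder. -/
def IsGLipschitz (g : ℝ) (W : E → F) : Prop :=
  ContDiff ℝ (⌊g⌋₊ : ℕ) W ∧ eLipNorm g W < ⊤

end Regularity

/-! ### Approximate flows

Throughout, `μ t s` stands for the map `μ_{ts}`; only times `0 ≤ s ≤ t ≤ T` matter. -/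

section Flows

variable {E : Type*} [NormedAddCommGroup E] [NormedSpace ℝ E]

/-- `‖μ_{tu} ∘ μ_{us} - μ_{ts}‖_∞ ≤ c₁ |t - s|^a` for all `0 ≤ s ≤ u ≤ t ≤ T`, with `a > 1`. -/
def IsApproxFlow (T a : ℝ) (μ : ℝ → ℝ → E → E) : Prop :=
  1 < a ∧ ∃ c₁ : ℝ, 0 < c₁ ∧ ∀ s u t : ℝ, 0 ≤ s → s ≤ u → u ≤ t → t ≤ T →
    ∀ x : E, ‖μ t u (μ u s x) - μ t s x‖ ≤ c₁ * (t - s) ^ a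

/-- A `C^1`-approximate flow with exponent `a`. The identity map being unbounded, it is
`μ_{ts} - Id` which is required to be `(1+ρ)`-Lipschitz. -/
def IsC1ApproxFlow (T a : ℝ) (μ : ℝ → ℝ → E → E) : Prop :=
  IsApproxFlow T a μ ∧
  ∃ α ρ : ℝ, 0 < 1 - ρ ∧ 1 - ρ < α ∧ α < 1 ∧
    (∀ s t : ℝ, 0 ≤ s → s ≤ t → t ≤ T → IsGLipschitz (1 + ρ) (fun x => μ t s x - x)) ∧
    (∃ A B : ℝ → ℝ → E → (E →L[ℝ] E), ∃ c : ℝ, ∃ o : ℝ → ℝ, Tendsto o (𝓝 0) (𝓝 0) ∧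
      ∀ s t : ℝ, 0 ≤ s → s ≤ t → t ≤ T →
        (∀ x : E, fderiv ℝ (μ t s) x = ContinuousLinearMap.id ℝ E + A t s x + B t s x) ∧
        IsGLipschitz ρ (A t s) ∧ eLipNorm ρ (A t s) ≤ ENNReal.ofReal (c * (t - s) ^ α) ∧
        ContDiff ℝ 1 (B t s) ∧ eCkNorm 1 (B t s) ≤ ENNReal.ofReal (o (t - s))) ∧
    ∃ c₃ : ℝ, 0 < c₃ ∧ ∀ s u t : ℝ, 0 ≤ s → s ≤ u → u ≤ t → t ≤ T →
      ∀ x : E, ‖fderiv ℝ (μ t u ∘ μ u s) x - fderiv ℝ (μ t s) x‖ ≤ c₃ * (t - s) ^ a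

end Flows

/-! ### The truncated tensor algebra and the free nilpotent group -/

/-- The truncated tensor algebra `⊕_{r ≤ N} (ℝ^ℓ)^{⊗ r}`, in coordinates with respect to its
canonical basis `e_{i_1} ⊗ ⋯ ⊗ e_{i_r}`, indexed by the words of length at most `N`. -/
def TruncTensor (ℓ N : ℕ) : Type := {w : List (Fin ℓ) // w.length ≤ N} → ℝ

namespace TruncTensor

variable {ℓ N : ℕ}

instance : AddCommGroup (TruncTensor ℓ N) :=
  inferInstanceAs (AddCommGroup ({w : List (Fin ℓ) // w.length ≤ N} → ℝ))

instance : Module ℝ (TruncTensor ℓ N) :=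
  inferInstanceAs (Module ℝ ({w : List (Fin ℓ) // w.length ≤ N} → ℝ))

/-- The word made of the first `k` letters. -/
def pre (k : ℕ) (w : {w : List (Fin ℓ) // w.length ≤ N}) : {w : List (Fin ℓ) // w.length ≤ N} :=
  ⟨w.1.take k, (List.length_take_le' k w.1).trans w.2⟩

/-- The word without its first `k` letters. -/
def suf (k : ℕ) (w : {w : List (Fin ℓ) // w.length ≤ N}) : {w : List (Fin ℓ) // w.length ≤ N} :=
  ⟨w.1.drop k, by rw [List.length_drop]; exact (Nat.sub_le _ _).trans w.2⟩

instance : One (TruncTensor ℓ N) := ⟨fun w => if w.1 = [] then 1 else 0⟩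

/-- The truncated tensor product `(ab)_r = ∑_{k ≤ r} a_k ⊗ b_{r-k}`. -/
instance : Mul (TruncTensor ℓ N) :=
  ⟨fun a b w => ∑ k ∈ Finset.range (w.1.length + 1), a (pre k w) * b (suf k w)⟩

theorem mul_apply (a b : TruncTensor ℓ N) (w : {w : List (Fin ℓ) // w.length ≤ N}) :
    (a * b) w = ∑ k ∈ Finset.range (w.1.length + 1), a (pre k w) * b (suf k w) := rfl

theorem one_apply (w : {w : List (Fin ℓ) // w.length ≤ N}) :
    (1 : TruncTensor ℓ N) w = if w.1 = [] then 1 else 0 := rfl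

theorem add_apply (a b : TruncTensor ℓ N) (w : {w : List (Fin ℓ) // w.length ≤ N}) :
    (a + b) w = a w + b w := rfl

theorem zero_apply (w : {w : List (Fin ℓ) // w.length ≤ N}) :
    (0 : TruncTensor ℓ N) w = 0 := rfl

theorem smul_apply (c : ℝ) (a : TruncTensor ℓ N) (w : {w : List (Fin ℓ) // w.length ≤ N}) :
    (c • a) w = c * a w := rfl

protected theorem mul_assoc (a b c : TruncTensor ℓ N) : a * b * c = a * (b * c) := by
  funext w
  have h1 : (a * b * c) w = ∑ m ∈ Finset.range (w.1.length + 1), ∑ k ∈ Finset.range (m + 1),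
      a (pre k w) * b (pre (m - k) (suf k w)) * c (suf m w) := by
    rw [mul_apply]
    refine Finset.sum_congr rfl fun m hm => ?_
    have hm' : m ≤ w.1.length := Nat.lt_succ_iff.mp (Finset.mem_range.mp hm)
    rw [mul_apply, Finset.sum_mul]
    have hl : (pre m w).1.length = m := by simp [pre, hm']
    rw [hl]
    refine Finset.sum_congr rfl fun k hk => ?_
    have hk' : k ≤ m := Nat.lt_succ_iff.mp (Finset.mem_range.mp hk)
    have e1 : pre k (pre m w) = pre k w := by
      apply Subtype.ext; simp [pre, List.take_take, hk']
    have e2 : suf k (pre m w) = pre (m - k) (suf k w) := by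
      apply Subtype.ext; simp [pre, suf, List.drop_take]
    rw [e1, e2]
  have h2 : (a * (b * c)) w = ∑ k ∈ Finset.range (w.1.length + 1),
      ∑ j ∈ Finset.range (w.1.length - k + 1),
        a (pre k w) * b (pre j (suf k w)) * c (suf (k + j) w) := by
    rw [mul_apply]
    refine Finset.sum_congr rfl fun k hk => ?_
    rw [mul_apply, Finset.mul_sum]
    have hl : (suf k w).1.length = w.1.length - k := by simp [suf]
    rw [hl]
    refine Finset.sum_congr rfl fun j hj => ?_
    have e : suf j (suf k w) = suf (k + j) w := by
      apply Subtype.ext; simp [suf, List.drop_drop]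
    rw [e, mul_assoc]
  rw [h1, h2, Finset.sum_sigma', Finset.sum_sigma']
  refine Finset.sum_bij' (fun x _ => ⟨x.2, x.1 - x.2⟩) (fun x _ => ⟨x.1 + x.2, x.1⟩) ?_ ?_ ?_ ?_ ?_
  · rintro ⟨m, k⟩ h
    simp only [Finset.mem_sigma, Finset.mem_range] at h ⊢
    omega
  · rintro ⟨k, j⟩ h
    simp only [Finset.mem_sigma, Finset.mem_range] at h ⊢
    omega
  · rintro ⟨m, k⟩ h
    simp only [Finset.mem_sigma, Finset.mem_range] at h
    have : k + (m - k) = m := by omega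
    simp [this]
  · rintro ⟨k, j⟩ h
    simp
  · rintro ⟨m, k⟩ h
    simp only [Finset.mem_sigma, Finset.mem_range] at h
    have : k + (m - k) = m := by omega
    simp only [this]

protected theorem one_mul (a : TruncTensor ℓ N) : 1 * a = a := by
  funext w
  rw [mul_apply, Finset.sum_eq_single 0]
  · simp [one_apply, pre, suf]
  · intro k hk hk0
    have hk' : k < w.1.length + 1 := Finset.mem_range.mp hk
    have : (pre k w).1 ≠ [] := by
      intro h
      have h' : min k w.1.length = 0 := by
        rw [← List.length_take]; exact congrArg List.length h
      omega
    simp [one_apply, this]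
  · simp

protected theorem mul_one (a : TruncTensor ℓ N) : a * 1 = a := by
  funext w
  rw [mul_apply, Finset.sum_eq_single w.1.length]
  · simp [one_apply, pre, suf]
  · intro k hk hk0
    have hk' : k < w.1.length + 1 := Finset.mem_range.mp hk
    have : (suf k w).1 ≠ [] := by
      intro h
      have h' : w.1.length - k = 0 := by
        rw [← List.length_drop]; exact congrArg List.length h
      omega
    simp [one_apply, this]
  · simp

instance : Ring (TruncTensor ℓ N) :=
  { (inferInstance : AddCommGroup (TruncTensor ℓ N)) with
    mul := (· * ·)
    one := 1
    mul_assoc := TruncTensor.mul_assoc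
    one_mul := TruncTensor.one_mul
    mul_one := TruncTensor.mul_one
    left_distrib := fun a b c => by
      funext w; simp only [mul_apply, add_apply, mul_add, Finset.sum_add_distrib]
    right_distrib := fun a b c => by
      funext w; simp only [mul_apply, add_apply, add_mul, Finset.sum_add_distrib]
    zero_mul := fun a => by
      funext w; simp only [mul_apply, zero_apply, zero_mul, Finset.sum_const_zero]
    mul_zero := fun a => by
      funext w; simp only [mul_apply, zero_apply, mul_zero, Finset.sum_const_zero] }

instance : Algebra ℝ (TruncTensor ℓ N) :=
  Algebra.ofModule
    (fun c a b => by
      funext w; simp only [mul_apply, smul_apply, Finset.mul_sum, mul_assoc])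
    (fun c a b => by
      funext w; simp only [mul_apply, smul_apply, Finset.mul_sum, mul_left_comm])

/-- The commutator bracket `[a,b] = ab - ba`. -/
instance : LieRing (TruncTensor ℓ N) := LieRing.ofAssociativeRing

instance : LieAlgebra ℝ (TruncTensor ℓ N) := LieAlgebra.ofAssociativeAlgebra

/-- The `i`-th vector `e_i` of the canonical basis of `ℝ^ℓ`. -/
def basisVec (i : Fin ℓ) : TruncTensor ℓ N := fun w => if w.1 = [i] then 1 else 0

/-- The exponential series, cut at order `N`; on elements with no scalar component the omitted
powers vanish and this is the exponential map. -/
def expo (a : TruncTensor ℓ N) : TruncTensor ℓ N :=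
  ∑ n ∈ Finset.range (N + 1), (n.factorial : ℝ)⁻¹ • a ^ n

variable (ℓ N) in
/-- The `N`-step free nilpotent Lie algebra: the Lie subalgebra (for the commutator bracket)
generated by `ℝ^ℓ`. -/
def nilLie : LieSubalgebra ℝ (TruncTensor ℓ N) :=
  LieSubalgebra.lieSpan ℝ (TruncTensor ℓ N) (range basisVec)

variable (ℓ N) in
/-- The `N`-step free nilpotent Lie group, as a subset of the truncated tensor algebra. -/
def nilGroup : Set (TruncTensor ℓ N) :=
  expo '' (nilLie ℓ N : Set (TruncTensor ℓ N))

/-- The iterated bracket `e_{[I]} = [e_{i_1}, [e_{i_2}, …, [e_{i_{r-1}}, e_{i_r}]]…]`. -/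
def brk : List (Fin ℓ) → TruncTensor ℓ N
  | [] => 0
  | [i] => basisVec i
  | i :: j :: w => ⁅(basisVec i : TruncTensor ℓ N), brk (j :: w)⁆

end TruncTensor

/-! ### Rough paths -/

section RoughPaths

variable {ℓ N : ℕ}

/-- The increment `𝐗_{ts} = 𝐗_s⁻¹ 𝐗_t`. -/
def incr (X : ℝ → TruncTensor ℓ N) (t s : ℝ) : TruncTensor ℓ N :=
  Ring.inverse (X s) * X t

/-- Hölder `p`-rough paths on `[0,T]`: the scalar component is `1`, and
`|X^i_{ts}| ≤ C |t - s|^{i/p}` for `1 ≤ i ≤ [p]` (stated on coordinates, as all norms on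
`(ℝ^ℓ)^{⊗ i}` are equivalent). -/
def IsHolderRoughPath (p T : ℝ) (X : ℝ → TruncTensor ℓ ⌊p⌋₊) : Prop :=
  (∀ t : ℝ, 0 ≤ t → t ≤ T → X t ⟨[], Nat.zero_le _⟩ = 1) ∧
  ∃ C : ℝ, ∀ s t : ℝ, 0 ≤ s → s < t → t ≤ T →
    ∀ w : {w : List (Fin ℓ) // w.length ≤ ⌊p⌋₊}, 1 ≤ w.1.length →
      |incr X t s w| ≤ C * (t - s) ^ ((w.1.length : ℝ) / p)

/-- Hölder weak geometric `p`-rough paths on `[0,T]`: rough paths with values in the group. -/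
def IsWeakGeometricRoughPath (p T : ℝ) (X : ℝ → TruncTensor ℓ ⌊p⌋₊) : Prop :=
  IsHolderRoughPath p T X ∧
  ∀ t : ℝ, 0 ≤ t → t ≤ T → X t ∈ TruncTensor.nilGroup ℓ ⌊p⌋₊

/-- `Λ t s I` are coordinates `Λ^I_{ts}` of the logarithm of `𝐗_{ts}` on the brackets `e_{[I]}`:
`exp (∑_{1 ≤ |I| ≤ N} Λ^I_{ts} e_{[I]}) = 𝐗_{ts}`. -/
def IsLogCoordinates (T : ℝ) (X : ℝ → TruncTensor ℓ N) (Λ : ℝ → ℝ → List (Fin ℓ) → ℝ) : Prop :=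
  ∀ s t : ℝ, 0 ≤ s → s ≤ t → t ≤ T →
    TruncTensor.expo (∑ r ∈ Finset.Icc 1 N, ∑ I : Fin r → Fin ℓ,
      Λ t s (List.ofFn I) • (TruncTensor.brk (List.ofFn I) : TruncTensor ℓ N)) = incr X t s

end RoughPaths

/-! ### The logarithmic ODE -/

section LogODE

variable {E : Type*} [NormedAddCommGroup E] [NormedSpace ℝ E] {ℓ : ℕ}

/-- The iterated bracket `V_{[I]} = [V_{i_1}, [V_{i_2}, …, [V_{i_{r-1}}, V_{i_r}]]…]`; here
`VectorField.lieBracket ℝ V W x = DW(x) V(x) - DV(x) W(x)`, the bracket of `V` and `W` seen as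
derivations. -/
def vbrk (Vs : Fin ℓ → E → E) : List (Fin ℓ) → E → E
  | [] => 0
  | [i] => Vs i
  | i :: j :: w => VectorField.lieBracket ℝ (Vs i) (vbrk Vs (j :: w))

/-- The vector field `(t - s) V + ∑_{r=1}^N ∑_{|I|=r} Λ^I_{ts} V_{[I]}`. -/
def logField (N : ℕ) (V : E → E) (Vs : Fin ℓ → E → E) (Λ : ℝ → ℝ → List (Fin ℓ) → ℝ)
    (t s : ℝ) (y : E) : E :=
  (t - s) • V y + ∑ r ∈ Finset.Icc 1 N, ∑ I : Fin r → Fin ℓ,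
    Λ t s (List.ofFn I) • vbrk Vs (List.ofFn I) y

/-- `z` is the time `1` value of some solution on `[0,1]` of `y' = W(y)` started from `x`. -/
def IsTimeOneValue (W : E → E) (x z : E) : Prop :=
  ∃ y : ℝ → E, y 0 = x ∧ (∀ u ∈ Icc (0 : ℝ) 1, HasDerivWithinAt y (W (y u)) (Icc 0 1) u) ∧ y 1 = z

/-- The compactness condition: the fields `V_{[I]}`, `1 ≤ |I| ≤ n` (in particular the `V_i`), map
every ball into a compact set. -/
def CompactnessCondition (n : ℕ) (Vs : Fin ℓ → E → E) : Prop :=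
  ∀ I : List (Fin ℓ), 1 ≤ I.length → I.length ≤ n → ∀ (y₀ : E) (R : ℝ),
    ∃ K : Set E, IsCompact K ∧ MapsTo (vbrk Vs I) (Metric.closedBall y₀ R) K

end LogODE

end RoughFlow

end

/-! Write N = [p], δ = t - s and τ = δ^{1/p}. The logarithm a of the increment is a combination of
brackets whose component of degree r is O(τ^r). Let F_w = V_{i_1}⋯V_{i_r} Id be the field attached
to a word w. A bracket of basis vectors, read as a combination of words of derivations, acts as the
first-order operator V_{[I]} (`ev_wordDeriv_brk`), so the field of the logarithmic equation is δV +
∑ a^w F_w. Along a solution y the derivative of F_w(y_u) is ∑_v a^v F_{vw}(y_u), up to the drift and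
to terms of total degree above N. This system is triangular in the length of words, and pairing with
exp(ua) solves it up to a controlled error (`word_expansion`). Hence y_1 = δV(x) + ∑ exp(a)^w F_w(x)
+ O(τ^γ + δτ^κ), where κ is a Hölder exponent of V (`exists_path_expansion`). Expanding a second
solution at the endpoint of the first, and then the first one at x, produces the pairing with
exp(a₁)exp(a₂). By Chen's relation this is exp(a₃), so the composition and the direct solution agree
up to the same error (`exists_composition_bound`). Since γ > p, the error is O((t-s)^a) with a > 1.
The argument compares arbitrary solutions, so it needs no uniqueness.

Differentials are handled by the same estimate on E × E. The pair (y, J h), with J the linearized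
flow, solves the equation driven by the tangent lifts of the fields, and these lifts still satisfy
the derivation property; the extra derivative of γ-Lipschitz fields pays for the lift. The splitting
Dμ = Id + A + B takes for B the pairing of exp(a) with the DF_w, 1 ≤ |w| < N, which are C^1. What
remains, A, has order τ^N = (t-s)^{[p]/p}, also in Hölder norm (`exists_remainder_bound`). The
condition ρ > (p-[p])/p says exactly that the Hölder exponent ρ exceeds 1 - [p]/p, which leaves room
for α.

Logarithmic coordinates exist because X_s⁻¹X_t = exp(-a)exp(b) is again the exponential of a Lie
element. No Baker–Campbell–Hausdorff formula is invoked: an element is called Lie-like if its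
adjoint action preserves Lie elements and its logarithmic derivative along the degree derivation is
a Lie element. Exponentials of Lie elements are Lie-like, products of Lie-like elements are
Lie-like, and the logarithm of a Lie-like element is reconstructed degree by degree
(`IsLieLike.exists_expo_eq`).

Existence of solutions in the Lipschitz case is a Peano theorem for a Lipschitz field plus a field
with compactness, proved with Euler polygons, Arzelà–Ascoli and Gronwall. In the smooth case it is
Picard–Lindelöf. -/

noncomputable section

namespace RoughFlow

/-! ### Grading, Lie elements and exponentials in the truncated tensor algebra -/

namespace TruncTensor

variable {ℓ N : ℕ}

/-- The degree derivation, multiplying a tensor of degree `r` by `r`. -/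
def degDer : TruncTensor ℓ N →ₗ[ℝ] TruncTensor ℓ N where
  toFun a := fun w => (w.1.length : ℝ) * a w
  map_add' a b := funext fun w => mul_add (w.1.length : ℝ) (a w) (b w)
  map_smul' c a := funext fun w => mul_left_comm (w.1.length : ℝ) c (a w)

theorem degDer_apply (a : TruncTensor ℓ N) (w) : degDer a w = (w.1.length : ℝ) * a w := rfl

theorem length_pre {w : {w : List (Fin ℓ) // w.length ≤ N}} {k : ℕ} (hk : k ≤ w.1.length) :
    (pre k w).1.length = k := by simp [pre, hk]

theorem length_suf (w : {w : List (Fin ℓ) // w.length ≤ N}) (k : ℕ) :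
    (suf k w).1.length = w.1.length - k := by simp [suf]

theorem degDer_mul (a b : TruncTensor ℓ N) : degDer (a * b) = degDer a * b + a * degDer b := by
  funext w
  simp only [degDer_apply, add_apply, mul_apply, Finset.mul_sum, ← Finset.sum_add_distrib]
  refine Finset.sum_congr rfl fun k hk => ?_
  have hk' : k ≤ w.1.length := Nat.lt_succ_iff.mp (Finset.mem_range.mp hk)
  rw [length_pre hk', length_suf, Nat.cast_sub hk']
  ring

theorem degDer_one : degDer (1 : TruncTensor ℓ N) = 0 := by
  funext w
  rw [degDer_apply, one_apply, zero_apply]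
  split_ifs with h <;> simp [h]

/-- The tensors without components of degree less than `k`. -/
def filt (ℓ N k : ℕ) : Submodule ℝ (TruncTensor ℓ N) where
  carrier := {a | ∀ w, w.1.length < k → a w = 0}
  add_mem' ha hb w hw := by rw [add_apply, ha w hw, hb w hw, add_zero]
  zero_mem' _ _ := rfl
  smul_mem' c a ha w hw := by rw [smul_apply, ha w hw, mul_zero]

theorem filt_mono {j k : ℕ} (h : j ≤ k) : filt ℓ N k ≤ filt ℓ N j :=
  fun _ ha w hw => ha w (hw.trans_le h)

theorem mul_mem_filt {j k : ℕ} {a b : TruncTensor ℓ N} (ha : a ∈ filt ℓ N j)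
    (hb : b ∈ filt ℓ N k) : a * b ∈ filt ℓ N (j + k) := by
  intro w hw
  rw [mul_apply]
  refine Finset.sum_eq_zero fun i hi => ?_
  have hi' : i ≤ w.1.length := Nat.lt_succ_iff.mp (Finset.mem_range.mp hi)
  rcases lt_or_ge i j with h | h
  · rw [ha _ (by rw [length_pre hi']; exact h), zero_mul]
  · rw [hb _ (by rw [length_suf]; omega), mul_zero]

theorem mem_filt_zero (a : TruncTensor ℓ N) : a ∈ filt ℓ N 0 := fun _ h => absurd h (by omega)

theorem pow_mem_filt {a : TruncTensor ℓ N} (ha : a ∈ filt ℓ N 1) (n : ℕ) :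
    a ^ n ∈ filt ℓ N n := by
  induction n with
  | zero => exact mem_filt_zero _
  | succ n ih => rw [pow_succ]; exact mul_mem_filt ih ha

theorem eq_zero_of_mem_filt {k : ℕ} (hk : N < k) {a : TruncTensor ℓ N} (ha : a ∈ filt ℓ N k) :
    a = 0 := by
  funext w
  exact ha w (lt_of_le_of_lt w.2 hk)

theorem pow_eq_zero_of_mem_filt {a : TruncTensor ℓ N} (ha : a ∈ filt ℓ N 1) :
    a ^ (N + 1) = 0 :=
  eq_zero_of_mem_filt (Nat.lt_succ_self N) (pow_mem_filt ha _)

theorem degDer_mem_filt {k : ℕ} {a : TruncTensor ℓ N} (ha : a ∈ filt ℓ N k) :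
    degDer a ∈ filt ℓ N k := fun w hw => by rw [degDer_apply, ha w hw, mul_zero]

/-- The homogeneous component of degree `k`. -/
def homPart (k : ℕ) : TruncTensor ℓ N →ₗ[ℝ] TruncTensor ℓ N where
  toFun a := fun w => if w.1.length = k then a w else 0
  map_add' a b := funext fun w => by
    change (if _ then a w + b w else 0) = (if _ then a w else 0) + (if _ then b w else 0)
    split_ifs <;> simp
  map_smul' c a := funext fun w => by
    change (if _ then c * a w else 0) = c * (if _ then a w else 0)
    split_ifs <;> simp

theorem homPart_apply (k : ℕ) (a : TruncTensor ℓ N) (w) :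
    homPart k a w = if w.1.length = k then a w else 0 := rfl

theorem homPart_eq_self {k : ℕ} {a : TruncTensor ℓ N} (h : ∀ w, w.1.length ≠ k → a w = 0) :
    homPart k a = a := by
  funext w
  rw [homPart_apply]
  split_ifs with h'
  · rfl
  · exact (h w h').symm

theorem homPart_eq_zero {k : ℕ} {a : TruncTensor ℓ N} (h : ∀ w, w.1.length = k → a w = 0) :
    homPart k a = 0 := by
  funext w
  rw [homPart_apply, zero_apply]
  split_ifs with h'
  · exact h w h'
  · rfl

theorem sub_homPart_mem_filt {k : ℕ} {a : TruncTensor ℓ N} (ha : a ∈ filt ℓ N k) :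
    a - homPart k a ∈ filt ℓ N (k + 1) := by
  intro w hw
  change a w - homPart k a w = 0
  rw [homPart_apply]
  split_ifs with h
  · exact sub_self _
  · rw [ha w (by omega), sub_zero]

theorem degDer_homPart (k : ℕ) (a : TruncTensor ℓ N) :
    homPart k (degDer a) = (k : ℝ) • homPart k a := by
  funext w
  rw [smul_apply, homPart_apply, homPart_apply, degDer_apply]
  split_ifs with h
  · rw [h]
  · rw [mul_zero]

theorem mul_apply_eq_zero_of_length_ne {j k : ℕ} {a b : TruncTensor ℓ N}
    (ha : ∀ w, w.1.length ≠ j → a w = 0) (hb : ∀ w, w.1.length ≠ k → b w = 0)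
    (w) (hw : w.1.length ≠ j + k) : (a * b) w = 0 := by
  rw [mul_apply]
  refine Finset.sum_eq_zero fun i hi => ?_
  have hi' : i ≤ w.1.length := Nat.lt_succ_iff.mp (Finset.mem_range.mp hi)
  by_cases h : i = j
  · rw [hb _ (by rw [length_suf]; omega), mul_zero]
  · rw [ha _ (by rw [length_pre hi']; exact h), zero_mul]

theorem basisVec_apply_eq_zero (i : Fin ℓ) (w : {w : List (Fin ℓ) // w.length ≤ N})
    (hw : w.1.length ≠ 1) : (basisVec i : TruncTensor ℓ N) w = 0 := by
  unfold basisVec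
  rw [if_neg]
  intro h
  exact hw (by rw [h]; rfl)

theorem brk_apply_eq_zero : ∀ (I : List (Fin ℓ)) (w : {w : List (Fin ℓ) // w.length ≤ N}),
    w.1.length ≠ I.length → (brk I : TruncTensor ℓ N) w = 0
  | [], _, _ => rfl
  | [i], w, hw => basisVec_apply_eq_zero i w hw
  | i :: j :: I, w, hw => by
    have ih := brk_apply_eq_zero (j :: I)
    have h1 := mul_apply_eq_zero_of_length_ne (basisVec_apply_eq_zero (N := N) i) ih w
      (by simp only [List.length_cons] at hw ⊢; omega)
    have h2 := mul_apply_eq_zero_of_length_ne ih (basisVec_apply_eq_zero (N := N) i) w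
      (by simp only [List.length_cons] at hw ⊢; omega)
    change (basisVec i * brk (j :: I) - brk (j :: I) * basisVec i : TruncTensor ℓ N) w = 0
    change (basisVec i * brk (j :: I) : TruncTensor ℓ N) w -
      (brk (j :: I) * basisVec i : TruncTensor ℓ N) w = 0
    rw [h1, h2, sub_zero]

theorem brk_nil_or_mem_filt (I : List (Fin ℓ)) : (brk I : TruncTensor ℓ N) ∈ filt ℓ N 1 := by
  intro w hw
  cases I with
  | nil => rfl
  | cons i I => exact brk_apply_eq_zero _ _ (by simp only [List.length_cons]; omega)

theorem brk_eq_zero_of_lt {I : List (Fin ℓ)} (hI : N < I.length) :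
    (brk I : TruncTensor ℓ N) = 0 := by
  funext w
  exact brk_apply_eq_zero _ _ (by have := w.2; omega)

/-- The span of the iterated brackets `e_{[I]}`. -/
def brkSpan (ℓ N : ℕ) : Submodule ℝ (TruncTensor ℓ N) := Submodule.span ℝ (range brk)

theorem brk_mem_brkSpan (I : List (Fin ℓ)) : (brk I : TruncTensor ℓ N) ∈ brkSpan ℓ N :=
  Submodule.subset_span ⟨I, rfl⟩

theorem lie_basisVec_mem_brkSpan (i : Fin ℓ) {a : TruncTensor ℓ N} (ha : a ∈ brkSpan ℓ N) :
    ⁅(basisVec i : TruncTensor ℓ N), a⁆ ∈ brkSpan ℓ N := by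
  induction ha using Submodule.span_induction with
  | mem x hx =>
    obtain ⟨I, rfl⟩ := hx
    cases I with
    | nil => change ⁅(basisVec i : TruncTensor ℓ N), (0 : TruncTensor ℓ N)⁆ ∈ _; simp
    | cons j I => exact brk_mem_brkSpan (i :: j :: I)
  | zero => simp
  | add x y _ _ hx hy => rw [lie_add]; exact add_mem hx hy
  | smul c x _ hx => rw [lie_smul]; exact Submodule.smul_mem _ _ hx

/-- Jacobi's identity [[e_i, b], a] = [e_i, [b, a]] - [b, [e_i, a]] reduces the length of I. This is
why the right-nested brackets alone span a Lie algebra, and hence span all of `nilLie`. -/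
theorem lie_brk_mem_brkSpan : ∀ (I : List (Fin ℓ)) {a : TruncTensor ℓ N}, a ∈ brkSpan ℓ N →
    ⁅(brk I : TruncTensor ℓ N), a⁆ ∈ brkSpan ℓ N
  | [], a, _ => by change ⁅(0 : TruncTensor ℓ N), a⁆ ∈ _; simp
  | [i], _, ha => lie_basisVec_mem_brkSpan i ha
  | i :: j :: I, a, ha => by
    change ⁅⁅(basisVec i : TruncTensor ℓ N), (brk (j :: I) : TruncTensor ℓ N)⁆, a⁆ ∈ _
    rw [lie_lie]
    exact sub_mem (lie_basisVec_mem_brkSpan i (lie_brk_mem_brkSpan (j :: I) ha))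
      (lie_brk_mem_brkSpan (j :: I) (lie_basisVec_mem_brkSpan i ha))

theorem lie_mem_brkSpan {a b : TruncTensor ℓ N} (ha : a ∈ brkSpan ℓ N) (hb : b ∈ brkSpan ℓ N) :
    ⁅a, b⁆ ∈ brkSpan ℓ N := by
  induction ha using Submodule.span_induction with
  | mem x hx =>
    obtain ⟨I, rfl⟩ := hx
    exact lie_brk_mem_brkSpan I hb
  | zero => simp
  | add x y _ _ hx hy => rw [add_lie]; exact add_mem hx hy
  | smul c x _ hx => rw [smul_lie]; exact Submodule.smul_mem _ _ hx

theorem mem_brkSpan_of_mem_nilLie {a : TruncTensor ℓ N} (ha : a ∈ nilLie ℓ N) :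
    a ∈ brkSpan ℓ N := by
  let K : LieSubalgebra ℝ (TruncTensor ℓ N) :=
    { brkSpan ℓ N with lie_mem' := fun ha hb => lie_mem_brkSpan ha hb }
  have h : nilLie ℓ N ≤ K := by
    refine LieSubalgebra.lieSpan_le.mpr ?_
    rintro _ ⟨i, rfl⟩
    exact brk_mem_brkSpan [i]
  exact h ha

theorem mem_filt_one_of_mem_brkSpan {a : TruncTensor ℓ N} (ha : a ∈ brkSpan ℓ N) :
    a ∈ filt ℓ N 1 := by
  have h : brkSpan ℓ N ≤ filt ℓ N 1 := by
    refine Submodule.span_le.mpr ?_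
    rintro _ ⟨I, rfl⟩
    exact brk_nil_or_mem_filt I
  exact h ha

theorem homPart_mem_brkSpan (k : ℕ) {a : TruncTensor ℓ N} (ha : a ∈ brkSpan ℓ N) :
    homPart k a ∈ brkSpan ℓ N := by
  have h : brkSpan ℓ N ≤ (brkSpan ℓ N).comap (homPart k) := by
    refine Submodule.span_le.mpr ?_
    rintro _ ⟨I, rfl⟩
    change homPart k (brk I) ∈ brkSpan ℓ N
    by_cases h : I.length = k
    · rw [homPart_eq_self (fun w hw => brk_apply_eq_zero I w (by omega))]
      exact brk_mem_brkSpan I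
    · rw [homPart_eq_zero (fun w hw => brk_apply_eq_zero I w (by omega))]
      exact zero_mem _
  exact h ha

theorem degDer_mem_brkSpan {a : TruncTensor ℓ N} (ha : a ∈ brkSpan ℓ N) :
    degDer a ∈ brkSpan ℓ N := by
  have h : brkSpan ℓ N ≤ (brkSpan ℓ N).comap degDer := by
    refine Submodule.span_le.mpr ?_
    rintro _ ⟨I, rfl⟩
    have : degDer (brk I : TruncTensor ℓ N) = (I.length : ℝ) • brk I := by
      funext w
      rw [degDer_apply, smul_apply]
      by_cases h : w.1.length = I.length
      · rw [h]
      · rw [brk_apply_eq_zero I w h, mul_zero, mul_zero]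
    change degDer (brk I) ∈ brkSpan ℓ N
    rw [this]
    exact Submodule.smul_mem _ _ (brk_mem_brkSpan I)
  exact h ha

/-- Conjugation by the exponential of a nilpotent element is the exponential of the adjoint. -/
theorem exp_conj {A : Type*} [Ring A] [Algebra ℝ A] {a : A} {n : ℕ} (ha : a ^ n = 0) (b : A) :
    (∑ i ∈ Finset.range n, (i.factorial : ℝ)⁻¹ • (-a) ^ i) * b *
      (∑ i ∈ Finset.range n, (i.factorial : ℝ)⁻¹ • a ^ i) =
    ∑ k ∈ Finset.range (2 * n), (k.factorial : ℝ)⁻¹ •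
      ((LinearMap.mulLeft ℝ (-a) + LinearMap.mulRight ℝ a) ^ k) b := by
  -- `IsNilpotent.exp` has rational coefficients; `eE` below rewrites it with real ones.
  let hE : Module ℚ (Module.End ℝ A) := Module.compHom _ (algebraMap ℚ ℝ)
  have hna : (-a) ^ n = 0 := by rw [neg_pow, ha, mul_zero]
  have eE : ∀ (x : Module.End ℝ A) (m : ℕ), x ^ m = 0 →
      IsNilpotent.exp x = ∑ i ∈ Finset.range m, (i.factorial : ℝ)⁻¹ • x ^ i := by
    intro x m hx
    rw [IsNilpotent.exp_eq_sum hx]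
    refine Finset.sum_congr rfl fun i _ => ?_
    have : (algebraMap ℚ ℝ) ((i.factorial : ℚ)⁻¹) = (i.factorial : ℝ)⁻¹ := by simp
    rw [← this]; rfl
  have hl : (LinearMap.mulLeft ℝ (-a)) ^ n = 0 := by
    rw [LinearMap.pow_mulLeft, hna]; exact LinearMap.mulLeft_zero_eq_zero ℝ A
  have hr : (LinearMap.mulRight ℝ a) ^ n = 0 := by
    rw [LinearMap.pow_mulRight, ha]; exact LinearMap.mulRight_zero_eq_zero ℝ A
  -- Left and right multiplications commute, so the exponential of their sum is the product of their
  -- exponentials.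
  have hc : Commute (LinearMap.mulLeft ℝ (-a)) (LinearMap.mulRight ℝ a) :=
    LinearMap.commute_mulLeft_right _ _
  have h2n : (LinearMap.mulLeft ℝ (-a) + LinearMap.mulRight ℝ a) ^ (2 * n) = 0 :=
    Commute.add_pow_eq_zero_of_add_le_succ_of_pow_eq_zero hc hl hr (by omega)
  have key := IsNilpotent.exp_add_of_commute hc ⟨n, hl⟩ ⟨n, hr⟩
  rw [eE _ _ h2n, eE _ _ hl, eE _ _ hr] at key
  have := congrArg (fun f : Module.End ℝ A => f b) key
  simp only [Module.End.mul_apply, LinearMap.sum_apply, LinearMap.smul_apply,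
    LinearMap.pow_mulLeft, LinearMap.pow_mulRight, LinearMap.mulLeft_apply,
    LinearMap.mulRight_apply] at this
  rw [this]
  simp only [mul_assoc, Finset.sum_mul, Finset.mul_sum, smul_mul_assoc, mul_smul_comm,
    Finset.smul_sum]
  rw [Finset.sum_comm]
  exact Finset.sum_congr rfl fun i _ => Finset.sum_congr rfl fun j _ => smul_comm _ _ _

/-- Conjugate 1 by exp(a): the adjoint action kills 1, so only the term of order zero survives. -/
theorem expo_neg_mul_expo {a : TruncTensor ℓ N} (ha : a ∈ filt ℓ N 1) :
    expo (-a) * expo a = 1 := by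
  have h := exp_conj (pow_eq_zero_of_mem_filt ha) 1
  rw [mul_one] at h
  change expo (-a) * expo a = _ at h
  rw [h, Finset.sum_eq_single 0]
  · simp
  · intro k _ hk
    obtain ⟨k, rfl⟩ := Nat.exists_eq_succ_of_ne_zero hk
    rw [Nat.succ_eq_add_one, pow_succ, Module.End.mul_apply]
    simp
  · simp

theorem expo_mul_expo_neg {a : TruncTensor ℓ N} (ha : a ∈ filt ℓ N 1) :
    expo a * expo (-a) = 1 := by
  have := expo_neg_mul_expo (neg_mem ha)
  rwa [neg_neg] at this

theorem expo_zero : expo (0 : TruncTensor ℓ N) = 1 := by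
  unfold expo
  rw [Finset.sum_eq_single 0] <;> simp +contextual

theorem conj_mem_brkSpan {a b : TruncTensor ℓ N} (ha : a ∈ brkSpan ℓ N) (hb : b ∈ brkSpan ℓ N) :
    expo (-a) * b * expo a ∈ brkSpan ℓ N := by
  have h := exp_conj (pow_eq_zero_of_mem_filt (mem_filt_one_of_mem_brkSpan ha)) b
  change expo (-a) * b * expo a = _ at h
  rw [h]
  refine sum_mem fun k hk => Submodule.smul_mem _ _ ?_
  clear hk
  induction k with
  | zero => simpa using hb
  | succ k ih =>
    rw [pow_succ', Module.End.mul_apply]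
    have := lie_mem_brkSpan (neg_mem ha) ih
    rw [LieRing.of_associative_ring_bracket] at this
    simpa using this

/-- Apply `exp_conj` among endomorphisms, conjugating the degree derivation D by left multiplication
by exp(a), and evaluate at 1. The first commutator of D with multiplication by a is multiplication
by Da, the next ones are multiplications by brackets with -a, and the term of order zero is D1 = 0.
-/
theorem logDeriv_expo_mem_brkSpan {a : TruncTensor ℓ N} (ha : a ∈ brkSpan ℓ N) :
    expo (-a) * degDer (expo a) ∈ brkSpan ℓ N := by
  let M : TruncTensor ℓ N →ₐ[ℝ] Module.End ℝ (TruncTensor ℓ N) := Algebra.lmul ℝ _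
  have hpow := pow_eq_zero_of_mem_filt (mem_filt_one_of_mem_brkSpan ha)
  have hM : (M a) ^ (N + 1) = 0 := by rw [← map_pow, hpow, map_zero]
  have h := congrArg (fun f : Module.End ℝ (TruncTensor ℓ N) => f 1) (exp_conj hM degDer)
  have e1 : ∑ i ∈ Finset.range (N + 1), (i.factorial : ℝ)⁻¹ • (-(M a)) ^ i = M (expo (-a)) := by
    unfold expo
    simp only [map_sum, map_smul, map_pow, map_neg]
  have e2 : ∑ i ∈ Finset.range (N + 1), (i.factorial : ℝ)⁻¹ • (M a) ^ i = M (expo a) := by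
    unfold expo
    simp only [map_sum, map_smul, map_pow]
  rw [e1, e2] at h
  have e3 : (M (expo (-a)) * degDer * M (expo a) : Module.End ℝ (TruncTensor ℓ N)) 1 = expo (-a) * degDer (expo a) := by
    change expo (-a) * degDer (expo a * 1) = _
    rw [mul_one]
  change (M (expo (-a)) * degDer * M (expo a) : Module.End ℝ (TruncTensor ℓ N)) 1 = _ at h
  rw [← e3, h]
  simp only [LinearMap.sum_apply, LinearMap.smul_apply]
  refine sum_mem fun k _ => Submodule.smul_mem _ _ ?_
  have hk : ∀ k : ℕ, ∃ c ∈ brkSpan ℓ N,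
      ((LinearMap.mulLeft ℝ (-(M a)) + LinearMap.mulRight ℝ (M a)) ^ (k + 1)) degDer = M c := by
    intro k
    induction k with
    | zero =>
      refine ⟨degDer a, degDer_mem_brkSpan ha, ?_⟩
      apply LinearMap.ext
      intro x
      change -(a * degDer x) + degDer (a * x) = degDer a * x
      rw [degDer_mul]; abel
    | succ k ih =>
      obtain ⟨c, hc, h⟩ := ih
      refine ⟨⁅-a, c⁆, lie_mem_brkSpan (neg_mem ha) hc, ?_⟩
      rw [pow_succ', Module.End.mul_apply, h]
      apply LinearMap.ext
      intro x
      change -(a * (c * x)) + c * (a * x) = (-a * c - c * -a) * x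
      noncomm_ring
  cases k with
  | zero =>
    change degDer 1 ∈ _
    rw [degDer_one]; exact zero_mem _
  | succ k =>
    obtain ⟨c, hc, h⟩ := hk k
    rw [h]
    change c * 1 ∈ _
    rwa [mul_one]

/-- The invertible elements `x` whose adjoint action preserves the span of the brackets and whose
logarithmic derivative with respect to the degree lies in it. -/
def IsLieLike (x : TruncTensor ℓ N) : Prop :=
  ∃ y, y * x = 1 ∧ x * y = 1 ∧ y * degDer x ∈ brkSpan ℓ N ∧
    ∀ b ∈ brkSpan ℓ N, y * b * x ∈ brkSpan ℓ N

theorem isLieLike_expo {a : TruncTensor ℓ N} (ha : a ∈ brkSpan ℓ N) : IsLieLike (expo a) :=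
  ⟨expo (-a), expo_neg_mul_expo (mem_filt_one_of_mem_brkSpan ha),
    expo_mul_expo_neg (mem_filt_one_of_mem_brkSpan ha), logDeriv_expo_mem_brkSpan ha,
    fun _ hb => conj_mem_brkSpan ha hb⟩

/-- The logarithmic derivative of xx' is x'⁻¹(x⁻¹Dx)x' + x'⁻¹Dx'; the invariance under the adjoint
action is part of the definition in order to control the first term. -/
theorem IsLieLike.mul {x x' : TruncTensor ℓ N} (h : IsLieLike x) (h' : IsLieLike x') :
    IsLieLike (x * x') := by
  obtain ⟨y, h1, h2, h3, h4⟩ := h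
  obtain ⟨y', h1', h2', h3', h4'⟩ := h'
  refine ⟨y' * y, ?_, ?_, ?_, fun b hb => ?_⟩
  · rw [mul_assoc, ← mul_assoc y, h1, one_mul, h1']
  · rw [mul_assoc, ← mul_assoc x', h2', one_mul, h2]
  · have : y' * y * degDer (x * x') = y' * (y * degDer x) * x' + y' * degDer x' := by
      rw [degDer_mul, mul_add]
      congr 1
      · noncomm_ring
      · rw [← mul_assoc, mul_assoc y' y x, h1, mul_one]
    rw [this]
    exact add_mem (h4' _ h3) h3'
  · have : y' * y * b * (x * x') = y' * (y * b * x) * x' := by noncomm_ring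
    rw [this]
    exact h4' _ (h4 _ hb)

theorem add_pow_sub_pow_mem_filt {z r : TruncTensor ℓ N} {n : ℕ} (hn : 1 ≤ n)
    (hz : z ∈ filt ℓ N 1) (hr : r ∈ filt ℓ N n) (k : ℕ) :
    (z + r) ^ (k + 1) - z ^ (k + 1) ∈ filt ℓ N (n + k) := by
  induction k with
  | zero => simpa using hr
  | succ k ih =>
    have : (z + r) ^ (k + 1 + 1) - z ^ (k + 1 + 1) =
        ((z + r) ^ (k + 1) - z ^ (k + 1)) * (z + r) + z ^ (k + 1) * r := by
      rw [pow_succ (z + r), pow_succ z (k + 1)]; noncomm_ring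
    rw [this]
    refine add_mem ?_ ?_
    · rw [← add_assoc]
      exact mul_mem_filt ih (add_mem hz (filt_mono hn hr))
    · exact filt_mono (by omega) (mul_mem_filt (pow_mem_filt hz (k + 1)) hr)

/-- To first order in r the exponential moves by r: in the powers of order at least two, each
occurrence of r comes with another factor of degree at least one. -/
theorem expo_add_sub_mem_filt {z r : TruncTensor ℓ N} {n : ℕ} (hn : 1 ≤ n) (hN : 1 ≤ N)
    (hz : z ∈ filt ℓ N 1) (hr : r ∈ filt ℓ N n) :
    expo (z + r) - expo z - r ∈ filt ℓ N (n + 1) := by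
  obtain ⟨N', rfl⟩ : ∃ N', N = N' + 1 := ⟨N - 1, by omega⟩
  have : expo (z + r) - expo z - r = ∑ k ∈ Finset.range N',
      ((k + 1 + 1).factorial : ℝ)⁻¹ • ((z + r) ^ (k + 1 + 1) - z ^ (k + 1 + 1)) := by
    unfold expo
    rw [Finset.sum_range_succ', Finset.sum_range_succ', Finset.sum_range_succ',
      Finset.sum_range_succ']
    simp only [smul_sub, Finset.sum_sub_distrib, zero_add, pow_one, pow_zero, Nat.factorial_one,
      Nat.factorial_zero, Nat.cast_one, inv_one, one_smul]
    abel
  rw [this]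
  refine sum_mem fun k _ => Submodule.smul_mem _ _ ?_
  exact filt_mono (by omega) (add_pow_sub_pow_mem_filt hn hz hr (k + 1))

theorem expo_sub_one_mem_filt {z : TruncTensor ℓ N} (hz : z ∈ filt ℓ N 1) :
    expo z - 1 ∈ filt ℓ N 1 := by
  have : expo z - 1 = ∑ k ∈ Finset.range N, ((k + 1).factorial : ℝ)⁻¹ • z ^ (k + 1) := by
    unfold expo
    rw [Finset.sum_range_succ']
    simp
  rw [this]
  exact sum_mem fun k _ => Submodule.smul_mem _ _ (filt_mono (by omega) (pow_mem_filt hz (k + 1)))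

/-- A Lie-like element with scalar component `1` is the exponential of a combination of
brackets. -/
theorem IsLieLike.exists_expo_eq (hN : 1 ≤ N) {x : TruncTensor ℓ N} (hx : IsLieLike x)
    (hx1 : x - 1 ∈ filt ℓ N 1) : ∃ z ∈ brkSpan ℓ N, expo z = x := by
  have key : ∀ n : ℕ, ∃ z ∈ brkSpan ℓ N, x - expo z ∈ filt ℓ N (n + 1) := by
    intro n
    induction n with
    | zero => exact ⟨0, zero_mem _, by rwa [expo_zero]⟩
    | succ n ih =>
      obtain ⟨z, hz, hxz⟩ := ih
      have hz1 := mem_filt_one_of_mem_brkSpan hz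
      obtain ⟨y, h1, h2, h3, -⟩ := (isLieLike_expo (neg_mem hz)).mul hx
      -- The quotient q is Lie-like and equal to 1 up to degree n; its first nontrivial component,
      -- in degree n + 1, is the correction to be added to z.
      set q := expo (-z) * x with hq
      have hr : q - 1 ∈ filt ℓ N (n + 1) := by
        have : q - 1 = expo (-z) * (x - expo z) := by
          rw [mul_sub, expo_neg_mul_expo hz1]
        rw [this]
        exact filt_mono (by omega) (mul_mem_filt (mem_filt_zero _) hxz)
      have hy : y - 1 ∈ filt ℓ N 1 := by
        have : y - 1 = -(y * (q - 1)) := by rw [mul_sub, h1]; noncomm_ring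
        rw [this]
        exact neg_mem (filt_mono (by omega) (mul_mem_filt (mem_filt_zero _) hr))
      have hdq : degDer q = degDer (q - 1) := by rw [map_sub, degDer_one, sub_zero]
      have hdiff : y * degDer q - degDer (q - 1) ∈ filt ℓ N (n + 2) := by
        have : y * degDer q - degDer (q - 1) = (y - 1) * degDer (q - 1) := by
          rw [hdq, sub_mul, one_mul]
        rw [this]
        exact filt_mono (by omega) (mul_mem_filt hy (degDer_mem_filt hr))
      -- In lowest degree the logarithmic derivative of q is D(q - 1), that is, n + 1 times the
      -- component of q - 1. Division by n + 1 shows that this component is a Lie element.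
      have hrn : homPart (n + 1) (q - 1) ∈ brkSpan ℓ N := by
        have e : homPart (n + 1) (y * degDer q) =
            ((n + 1 : ℕ) : ℝ) • homPart (n + 1) (q - 1) := by
          rw [← degDer_homPart, ← sub_eq_zero, ← map_sub]
          exact homPart_eq_zero fun w hw => hdiff w (by omega)
        have := homPart_mem_brkSpan (n + 1) h3
        rw [e] at this
        have h := Submodule.smul_mem _ (((n + 1 : ℕ) : ℝ)⁻¹) this
        rwa [smul_smul, inv_mul_cancel₀ (by positivity), one_smul] at h
      refine ⟨z + homPart (n + 1) (q - 1), add_mem hz hrn, ?_⟩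
      have hx' : x = expo z * q := by
        rw [hq, ← mul_assoc, expo_mul_expo_neg hz1, one_mul]
      -- Each of the three terms on the right has degree at least n + 2.
      have : x - expo (z + homPart (n + 1) (q - 1)) =
          (expo z - 1) * (q - 1) + ((q - 1) - homPart (n + 1) (q - 1)) -
          (expo (z + homPart (n + 1) (q - 1)) - expo z - homPart (n + 1) (q - 1)) := by
        rw [hx']; noncomm_ring
      rw [this]
      refine sub_mem (add_mem ?_ (sub_homPart_mem_filt hr)) ?_
      · exact filt_mono (by omega) (mul_mem_filt (expo_sub_one_mem_filt hz1) hr)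
      · refine expo_add_sub_mem_filt (by omega) hN hz1 ?_
        intro w hw
        rw [homPart_apply, if_neg (by omega)]
  obtain ⟨z, hz, h⟩ := key N
  exact ⟨z, hz, (sub_eq_zero.mp (eq_zero_of_mem_filt (Nat.lt_succ_self N) h)).symm⟩

/-- Elements of the span of the brackets have coordinates on the brackets of length between `1`
and `N`. -/
theorem exists_coordinates {a : TruncTensor ℓ N} (ha : a ∈ brkSpan ℓ N) :
    ∃ Λ : List (Fin ℓ) → ℝ, ∑ r ∈ Finset.Icc 1 N, ∑ I : Fin r → Fin ℓ,
      Λ (List.ofFn I) • (brk (List.ofFn I) : TruncTensor ℓ N) = a := by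
  induction ha using Submodule.span_induction with
  | mem x hx =>
    obtain ⟨J, rfl⟩ := hx
    by_cases hJ : 1 ≤ J.length ∧ J.length ≤ N
    · refine ⟨fun I => if I = J then 1 else 0, ?_⟩
      rw [Finset.sum_eq_single J.length]
      · rw [Finset.sum_eq_single J.get]
        · beta_reduce
          rw [if_pos (List.ofFn_get J), List.ofFn_get, one_smul]
        · intro I _ hI
          beta_reduce
          rw [if_neg, zero_smul]
          intro h
          apply hI
          apply List.ofFn_injective
          rw [h, List.ofFn_get]
        · simp
      · intro r _ hr
        refine Finset.sum_eq_zero fun I _ => ?_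
        beta_reduce
        rw [if_neg, zero_smul]
        intro h
        apply hr
        rw [← h, List.length_ofFn]
      · intro h
        exact absurd (Finset.mem_Icc.mpr hJ) h
    · refine ⟨fun _ => 0, ?_⟩
      have : (brk J : TruncTensor ℓ N) = 0 := by
        rcases Nat.lt_or_ge N J.length with h | h
        · exact brk_eq_zero_of_lt h
        · cases J with
          | nil => rfl
          | cons i J => exact absurd ⟨by simp, h⟩ hJ
      simp [this]
  | zero => exact ⟨fun _ => 0, by simp⟩
  | add x y _ _ hx hy =>
    obtain ⟨Λ, h⟩ := hx
    obtain ⟨Λ', h'⟩ := hy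
    refine ⟨fun I => Λ I + Λ' I, ?_⟩
    simp only [add_smul, Finset.sum_add_distrib, h, h']
  | smul c x _ hx =>
    obtain ⟨Λ, h⟩ := hx
    refine ⟨fun I => c * Λ I, ?_⟩
    simp only [mul_smul, ← Finset.smul_sum, h]

end TruncTensor

/-! ### Increments of weak geometric rough paths and their logarithms -/

section

variable {ℓ N : ℕ}

open TruncTensor

theorem incr_expo {X : ℝ → TruncTensor ℓ N} {s t : ℝ} {a b : TruncTensor ℓ N}
    (ha : a ∈ brkSpan ℓ N) (hs : expo a = X s) (ht : expo b = X t) :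
    incr X t s = expo (-a) * expo b := by
  have h1 := mem_filt_one_of_mem_brkSpan ha
  let u : (TruncTensor ℓ N)ˣ := ⟨expo a, expo (-a), expo_mul_expo_neg h1, expo_neg_mul_expo h1⟩
  have : Ring.inverse (X s) = expo (-a) := by
    rw [← hs]; exact Ring.inverse_unit u
  rw [incr, this, ht]

/-- The increment is exp(-a)exp(b) with Lie elements a and b, hence Lie-like with scalar component
1, hence the exponential of a combination of brackets. -/
theorem exists_isLogCoordinates (hN : 1 ≤ N) {T : ℝ} {X : ℝ → TruncTensor ℓ N}
    (hX : ∀ t : ℝ, 0 ≤ t → t ≤ T → X t ∈ nilGroup ℓ N) :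
    ∃ Λ : ℝ → ℝ → List (Fin ℓ) → ℝ, IsLogCoordinates T X Λ := by
  have h : ∀ t s : ℝ, ∃ Λ : List (Fin ℓ) → ℝ, 0 ≤ s → s ≤ t → t ≤ T →
      expo (∑ r ∈ Finset.Icc 1 N, ∑ I : Fin r → Fin ℓ,
        Λ (List.ofFn I) • (brk (List.ofFn I) : TruncTensor ℓ N)) = incr X t s := by
    intro t s
    by_cases hst : 0 ≤ s ∧ s ≤ t ∧ t ≤ T
    · obtain ⟨h0, h1, h2⟩ := hst
      obtain ⟨a, ha, has⟩ := hX s h0 (h1.trans h2)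
      obtain ⟨b, hb, hbt⟩ := hX t (h0.trans h1) h2
      have ha' := mem_brkSpan_of_mem_nilLie ha
      have hb' := mem_brkSpan_of_mem_nilLie hb
      have hi := incr_expo ha' has hbt
      have h1 : expo (-a) * expo b - 1 ∈ filt ℓ N 1 := by
        have : expo (-a) * expo b - 1 = (expo (-a) - 1) * expo b + (expo b - 1) := by
          noncomm_ring
        rw [this]
        exact add_mem (mul_mem_filt (expo_sub_one_mem_filt
          (neg_mem (mem_filt_one_of_mem_brkSpan ha'))) (mem_filt_zero _))
          (expo_sub_one_mem_filt (mem_filt_one_of_mem_brkSpan hb'))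
      obtain ⟨z, hz, hze⟩ := IsLieLike.exists_expo_eq hN
        ((isLieLike_expo (neg_mem ha')).mul (isLieLike_expo hb')) h1
      obtain ⟨Λ, hΛ⟩ := exists_coordinates hz
      exact ⟨Λ, fun _ _ _ => by rw [hΛ, hze, hi]⟩
    · exact ⟨fun _ => 0, fun h0 h1 h2 => absurd ⟨h0, h1, h2⟩ hst⟩
  choose Λ hΛ using h
  exact ⟨Λ, fun s t h0 h1 h2 => hΛ t s h0 h1 h2⟩

/-- Chen's relation `𝐗_{us} 𝐗_{tu} = 𝐗_{ts}`. -/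
theorem incr_mul_incr {T : ℝ} {X : ℝ → TruncTensor ℓ N}
    (hX : ∀ t : ℝ, 0 ≤ t → t ≤ T → X t ∈ nilGroup ℓ N) {u : ℝ} (hu : 0 ≤ u) (huT : u ≤ T)
    (s t : ℝ) : incr X u s * incr X t u = incr X t s := by
  obtain ⟨b, hb, hbu⟩ := hX u hu huT
  have h1 := mem_filt_one_of_mem_brkSpan (mem_brkSpan_of_mem_nilLie hb)
  have hunit : IsUnit (X u) := by
    rw [← hbu]
    exact ⟨⟨expo b, expo (-b), expo_mul_expo_neg h1, expo_neg_mul_expo h1⟩, rfl⟩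
  unfold incr
  rw [mul_assoc, ← mul_assoc (X u), Ring.mul_inverse_cancel _ hunit, one_mul]

theorem incr_self {T : ℝ} {X : ℝ → TruncTensor ℓ N}
    (hX : ∀ t : ℝ, 0 ≤ t → t ≤ T → X t ∈ nilGroup ℓ N) {u : ℝ} (hu : 0 ≤ u) (huT : u ≤ T) :
    incr X u u = 1 := by
  obtain ⟨b, hb, hbu⟩ := hX u hu huT
  have hb' := mem_brkSpan_of_mem_nilLie hb
  rw [incr_expo hb' hbu hbu, expo_neg_mul_expo (mem_filt_one_of_mem_brkSpan hb')]

end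

end RoughFlow

namespace RoughFlow

/-! ### Pairing tensors with families indexed by words -/

namespace TruncTensor

variable {ℓ N : ℕ} {M : Type*} [AddCommGroup M] [Module ℝ M]

instance instFintypeWords : Fintype {w : List (Fin ℓ) // w.length ≤ N} :=
  (List.finite_length_le (Fin ℓ) N).fintype

/-- Evaluation of a tensor against a family indexed by words. -/
def ev (c : List (Fin ℓ) → M) : TruncTensor ℓ N →ₗ[ℝ] M where
  toFun a := ∑ w, a w • c w.1
  map_add' a b := by simp only [add_apply, add_smul, Finset.sum_add_distrib]
  map_smul' r a := by
    simp only [smul_apply, mul_smul, Finset.smul_sum, RingHom.id_apply]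

theorem ev_apply (c : List (Fin ℓ) → M) (a : TruncTensor ℓ N) :
    ev c a = ∑ w, a w • c w.1 := rfl

theorem ev_congr {c c' : List (Fin ℓ) → M} {a : TruncTensor ℓ N}
    (h : ∀ w, a w ≠ 0 → c w.1 = c' w.1) : ev c a = ev c' a := by
  rw [ev_apply, ev_apply]
  refine Finset.sum_congr rfl fun w _ => ?_
  by_cases hw : a w = 0
  · rw [hw, zero_smul, zero_smul]
  · rw [h w hw]

theorem ev_comp {M' : Type*} [AddCommGroup M'] [Module ℝ M'] (φ : M →ₗ[ℝ] M')
    (c : List (Fin ℓ) → M) (a : TruncTensor ℓ N) : ev (fun w => φ (c w)) a = φ (ev c a) := by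
  rw [ev_apply, ev_apply, map_sum]
  simp only [map_smul]

theorem ev_add (c c' : List (Fin ℓ) → M) (a : TruncTensor ℓ N) :
    ev (fun w => c w + c' w) a = ev c a + ev c' a := by
  simp only [ev_apply, smul_add, Finset.sum_add_distrib]

theorem ev_sub (c c' : List (Fin ℓ) → M) (a : TruncTensor ℓ N) :
    ev (fun w => c w - c' w) a = ev c a - ev c' a := by
  simp only [ev_apply, smul_sub, Finset.sum_sub_distrib]

/-- The product runs over the cuts of a word into a prefix and a suffix; these correspond to the
pairs of words whose concatenation has length at most N. -/
theorem ev_mul (c : List (Fin ℓ) → M) (a b : TruncTensor ℓ N) :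
    ev c (a * b) =
      ev (fun v => ev (fun w => if v.length + w.length ≤ N then c (v ++ w) else 0) b) a := by
  simp only [ev_apply, mul_apply, Finset.sum_smul, Finset.smul_sum]
  rw [Finset.sum_sigma', ← Finset.sum_product', ← Finset.sum_filter_add_sum_filter_not
    (Finset.univ ×ˢ Finset.univ) (fun x : {w : List (Fin ℓ) // w.length ≤ N} ×
      {w : List (Fin ℓ) // w.length ≤ N} => x.1.1.length + x.2.1.length ≤ N)]
  have h0 : ∑ x ∈ (Finset.univ ×ˢ Finset.univ).filter (fun x : {w : List (Fin ℓ) //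
      w.length ≤ N} × {w : List (Fin ℓ) // w.length ≤ N} => ¬ x.1.1.length + x.2.1.length ≤ N),
      a x.1 • b x.2 • (if x.1.1.length + x.2.1.length ≤ N then c (x.1.1 ++ x.2.1) else 0) = 0 := by
    refine Finset.sum_eq_zero fun x hx => ?_
    rw [if_neg (Finset.mem_filter.mp hx).2, smul_zero, smul_zero]
  rw [h0, add_zero]
  refine Finset.sum_bij' (fun x _ => (pre x.2 x.1, suf x.2 x.1))
    (fun x hx => ⟨⟨x.1.1 ++ x.2.1, by
      rw [List.length_append]; exact (Finset.mem_filter.mp hx).2⟩, x.1.1.length⟩) ?_ ?_ ?_ ?_ ?_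
  · rintro ⟨w, k⟩ h
    simp only [Finset.mem_sigma, Finset.mem_range, Finset.mem_univ, true_and] at h
    simp only [Finset.mem_filter, Finset.mem_product, Finset.mem_univ, true_and]
    rw [length_pre (by omega), length_suf]
    have := w.2
    omega
  · rintro ⟨v, w⟩ h
    simp only [Finset.mem_sigma, Finset.mem_range, Finset.mem_univ, true_and, List.length_append]
    omega
  · rintro ⟨w, k⟩ h
    simp only [Finset.mem_sigma, Finset.mem_range, Finset.mem_univ, true_and] at h
    have h1 : (pre k w).1 ++ (suf k w).1 = w.1 := List.take_append_drop k w.1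
    have h2 : (pre k w).1.length = k := length_pre (by omega)
    simp only [h1, h2]
  · rintro ⟨v, w⟩ h
    simp [pre, suf]
  · rintro ⟨w, k⟩ h
    simp only [Finset.mem_sigma, Finset.mem_range, Finset.mem_univ, true_and] at h
    have h1 : (pre k w).1 ++ (suf k w).1 = w.1 := List.take_append_drop k w.1
    have h2 : (pre k w).1.length + (suf k w).1.length ≤ N := by
      rw [length_pre (by omega), length_suf]
      have := w.2
      omega
    rw [if_pos h2, h1, mul_smul]

theorem ev_basisVec (hN : 1 ≤ N) (c : List (Fin ℓ) → M) (i : Fin ℓ) :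
    ev c (basisVec i : TruncTensor ℓ N) = c [i] := by
  rw [ev_apply, Finset.sum_eq_single ⟨[i], by simpa using hN⟩]
  · simp [basisVec]
  · intro w _ hw
    have : w.1 ≠ [i] := fun h => hw (Subtype.ext h)
    simp [basisVec, this]
  · simp

theorem ev_one (c : List (Fin ℓ) → M) : ev c (1 : TruncTensor ℓ N) = c [] := by
  rw [ev_apply, Finset.sum_eq_single ⟨[], Nat.zero_le _⟩]
  · simp [one_apply]
  · intro w _ hw
    have : w.1 ≠ [] := fun h => hw (Subtype.ext h)
    rw [one_apply, if_neg this, zero_smul]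
  · simp

theorem ev_brk_cons_cons (c : List (Fin ℓ) → M) (i j : Fin ℓ) (I : List (Fin ℓ))
    (hI : (i :: j :: I).length ≤ N) :
    ev c (brk (i :: j :: I) : TruncTensor ℓ N) =
      ev (fun w => c (i :: w)) (brk (j :: I) : TruncTensor ℓ N) -
      ev (fun w => c (w ++ [i])) (brk (j :: I) : TruncTensor ℓ N) := by
  have hN : 1 ≤ N := le_trans (by simp) hI
  have hl : ∀ w, (brk (j :: I) : TruncTensor ℓ N) w ≠ 0 → w.1.length + 1 ≤ N := by
    intro w hw
    have : w.1.length = (j :: I).length := by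
      by_contra h
      exact hw (brk_apply_eq_zero _ _ h)
    rw [this]; simpa using hI
  change ev c (basisVec i * brk (j :: I) - brk (j :: I) * basisVec i : TruncTensor ℓ N) = _
  rw [map_sub, ev_mul, ev_mul, ev_basisVec hN]
  congr 1
  · refine ev_congr fun w hw => ?_
    have := hl w hw
    rw [if_pos (by simp only [List.length_singleton]; omega)]; rfl
  · refine ev_congr fun w hw => ?_
    have := hl w hw
    rw [ev_basisVec hN, if_pos (by simp only [List.length_singleton]; omega)]

/-! ### Scaled bounds -/

/-- The components of degree `r` are bounded by `K τ^r`. -/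
def ScaledBound (K τ : ℝ) (a : TruncTensor ℓ N) : Prop := ∀ w, |a w| ≤ K * τ ^ w.1.length

theorem ScaledBound.mono {K K' τ : ℝ} (hτ : 0 ≤ τ) {a : TruncTensor ℓ N}
    (ha : ScaledBound K τ a) (h : K ≤ K') : ScaledBound K' τ a :=
  fun w => (ha w).trans (mul_le_mul_of_nonneg_right h (pow_nonneg hτ _))

theorem ScaledBound.nonneg {K τ : ℝ} {a : TruncTensor ℓ N}
    (ha : ScaledBound K τ a) : 0 ≤ K := by
  have := (abs_nonneg _).trans (ha ⟨[], Nat.zero_le _⟩)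
  simpa using this

theorem ScaledBound.mul {K K' τ : ℝ} (hτ : 0 ≤ τ) {a b : TruncTensor ℓ N}
    (ha : ScaledBound K τ a) (hb : ScaledBound K' τ b) :
    ScaledBound ((N + 1) * (K * K')) τ (a * b) := by
  intro w
  rw [mul_apply]
  have hK := ha.nonneg
  have hK' := hb.nonneg
  calc |∑ k ∈ Finset.range (w.1.length + 1), a (pre k w) * b (suf k w)|
      ≤ ∑ k ∈ Finset.range (w.1.length + 1), |a (pre k w) * b (suf k w)| :=
        Finset.abs_sum_le_sum_abs _ _
    _ ≤ ∑ k ∈ Finset.range (w.1.length + 1), K * K' * τ ^ w.1.length := by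
        refine Finset.sum_le_sum fun k hk => ?_
        have hk' : k ≤ w.1.length := Nat.lt_succ_iff.mp (Finset.mem_range.mp hk)
        have h1 := ha (pre k w)
        have h2 := hb (suf k w)
        rw [length_pre hk'] at h1
        rw [length_suf] at h2
        rw [abs_mul]
        calc |a (pre k w)| * |b (suf k w)| ≤ (K * τ ^ k) * (K' * τ ^ (w.1.length - k)) :=
              mul_le_mul h1 h2 (abs_nonneg _) (by positivity)
          _ = K * K' * (τ ^ k * τ ^ (w.1.length - k)) := by ring
          _ = K * K' * τ ^ w.1.length := by rw [← pow_add, Nat.add_sub_cancel' hk']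
    _ = (w.1.length + 1) * (K * K') * τ ^ w.1.length := by
        rw [Finset.sum_const, Finset.card_range, nsmul_eq_mul]; push_cast; ring
    _ ≤ (N + 1) * (K * K') * τ ^ w.1.length := by
        have : (w.1.length : ℝ) ≤ N := by exact_mod_cast w.2
        gcongr

theorem ScaledBound.pow {K τ : ℝ} (hτ : 0 ≤ τ) {a : TruncTensor ℓ N}
    (ha : ScaledBound K τ a) (n : ℕ) : ScaledBound (((N + 1) * K) ^ n) τ (a ^ n) := by
  induction n with
  | zero =>
    intro w
    rw [pow_zero, pow_zero, one_apply, one_mul]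
    split_ifs with h
    · simp [h]
    · rw [abs_zero]; positivity
  | succ n ih =>
    rw [pow_succ, pow_succ]
    refine (ih.mul hτ ha).mono hτ (le_of_eq ?_)
    ring

theorem ScaledBound.expo {K τ : ℝ} (hτ : 0 ≤ τ) {a : TruncTensor ℓ N}
    (ha : ScaledBound K τ a) :
    ScaledBound (∑ n ∈ Finset.range (N + 1), (n.factorial : ℝ)⁻¹ * ((N + 1) * K) ^ n) τ
      (TruncTensor.expo a) := by
  intro w
  have h : TruncTensor.expo a w =
      ∑ n ∈ Finset.range (N + 1), (n.factorial : ℝ)⁻¹ * (a ^ n) w := by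
    unfold TruncTensor.expo
    exact Finset.sum_apply (M := fun _ => ℝ) w _ _
  rw [h, Finset.sum_mul]
  refine (Finset.abs_sum_le_sum_abs _ _).trans (Finset.sum_le_sum fun n _ => ?_)
  rw [abs_mul, abs_of_nonneg (by positivity : (0 : ℝ) ≤ (n.factorial : ℝ)⁻¹), mul_assoc]
  exact mul_le_mul_of_nonneg_left (ha.pow hτ n w) (by positivity)

/-- Bounds on the exponential give bounds on the logarithm. -/
theorem exists_scaledBound_log (hN : 1 ≤ N) (K : ℝ) : ∃ K' : ℝ, ∀ τ : ℝ, 0 ≤ τ →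
    ∀ a ∈ filt ℓ N 1, ScaledBound K τ (TruncTensor.expo a) → ScaledBound K' τ a := by
  have key : ∀ n : ℕ, ∃ K' : ℝ, 0 ≤ K' ∧ ∀ τ : ℝ, 0 ≤ τ → ∀ a ∈ filt ℓ N 1,
      ScaledBound K τ (TruncTensor.expo a) →
      ∀ w, w.1.length ≤ n → |a w| ≤ K' * τ ^ w.1.length := by
    intro n
    induction n with
    | zero =>
      refine ⟨0, le_rfl, fun τ _ a ha _ w hw => ?_⟩
      rw [ha w (by omega)]; simp
    | succ n ih =>
      obtain ⟨K₁, hK₁, ih⟩ := ih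
      set K₂ := ∑ n ∈ Finset.range (N + 1), (n.factorial : ℝ)⁻¹ * ((N + 1) * K₁) ^ n with hK₂
      have hK₂0 : 0 ≤ K₂ := Finset.sum_nonneg fun _ _ => by positivity
      refine ⟨|K| + K₂ + K₁, by positivity, fun τ hτ a ha hKa w hw => ?_⟩
      -- The truncation b is controlled by induction, and exp(a) - exp(b) agrees with a - b up to
      -- degree n + 1. This expresses the component of a in degree n + 1 through exp(a) and exp(b).
      set b : TruncTensor ℓ N := fun w => if w.1.length ≤ n then a w else 0 with hb
      have hbv : ∀ w, b w = if w.1.length ≤ n then a w else 0 := fun _ => rfl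
      have hb1 : b ∈ filt ℓ N 1 := by
        intro v hv
        rw [hbv, ha v hv, ite_self]
      have hbK : ScaledBound K₁ τ b := by
        intro v
        rw [hbv]
        split_ifs with h
        · exact ih τ hτ a ha hKa v h
        · rw [abs_zero]; positivity
      have hab : a - b ∈ filt ℓ N (n + 1) := by
        intro v hv
        change a v - b v = 0
        rw [hbv, if_pos (by omega), sub_self]
      have h := expo_add_sub_mem_filt (by omega) hN hb1 hab w (by omega)
      rw [add_sub_cancel] at h
      change TruncTensor.expo a w - TruncTensor.expo b w - (a w - b w) = 0 at h
      have haw : a w = TruncTensor.expo a w - TruncTensor.expo b w + b w := by linarith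
      rw [haw]
      have h1 := hKa w
      have h2 := hbK.expo hτ w
      have h3 := hbK w
      have hp : 0 ≤ τ ^ w.1.length := pow_nonneg hτ _
      have h4 : K * τ ^ w.1.length ≤ |K| * τ ^ w.1.length :=
        mul_le_mul_of_nonneg_right (le_abs_self K) hp
      calc |TruncTensor.expo a w - TruncTensor.expo b w + b w|
          ≤ |TruncTensor.expo a w| + |TruncTensor.expo b w| + |b w| :=
            (abs_add_le _ _).trans (add_le_add_left (abs_sub _ _) _)
        _ ≤ (|K| + K₂ + K₁) * τ ^ w.1.length := by rw [add_mul, add_mul]; linarith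
  obtain ⟨K', _, h⟩ := key N
  exact ⟨K', fun τ hτ a ha hKa w => h τ hτ a ha hKa w w.2⟩

theorem norm_ev_le {B : Type*} [NormedAddCommGroup B] [NormedSpace ℝ B] {K τ C : ℝ}
    {a : TruncTensor ℓ N} (ha : ScaledBound K τ a) {c : List (Fin ℓ) → B}
    (hc : ∀ w : {w : List (Fin ℓ) // w.length ≤ N}, a w ≠ 0 → τ ^ w.1.length * ‖c w.1‖ ≤ C)
    (hC : 0 ≤ C) :
    ‖ev c a‖ ≤ Fintype.card {w : List (Fin ℓ) // w.length ≤ N} * (K * C) := by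
  rw [ev_apply]
  refine (norm_sum_le _ _).trans ?_
  have : ∀ w ∈ (Finset.univ : Finset {w : List (Fin ℓ) // w.length ≤ N}),
      ‖a w • c w.1‖ ≤ K * C := by
    intro w _
    have hK := ha.nonneg
    by_cases hw : a w = 0
    · rw [hw, zero_smul, norm_zero]; positivity
    · rw [norm_smul, Real.norm_eq_abs]
      calc |a w| * ‖c w.1‖ ≤ (K * τ ^ w.1.length) * ‖c w.1‖ :=
            mul_le_mul_of_nonneg_right (ha w) (norm_nonneg _)
        _ = K * (τ ^ w.1.length * ‖c w.1‖) := by ring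
        _ ≤ K * C := mul_le_mul_of_nonneg_left (hc w hw) hK
  refine (Finset.sum_le_sum this).trans (le_of_eq ?_)
  rw [Finset.sum_const, Finset.card_univ, nsmul_eq_mul]

theorem expo_apply_nil {a : TruncTensor ℓ N} (ha : a ∈ filt ℓ N 1) (h) :
    TruncTensor.expo a ⟨[], h⟩ = 1 := by
  have := expo_sub_one_mem_filt ha ⟨[], h⟩ (by simp)
  change TruncTensor.expo a ⟨[], h⟩ - (1 : TruncTensor ℓ N) ⟨[], h⟩ = 0 at this
  rw [one_apply, if_pos rfl] at this
  linarith

/-- The truncated series still satisfies d/du exp(ua) = exp(ua)a, because the missing top term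
contains a^(N+1) = 0. -/
theorem hasDerivAt_ev_expo {B : Type*} [NormedAddCommGroup B] [NormedSpace ℝ B]
    {a : TruncTensor ℓ N} (ha : a ∈ filt ℓ N 1) (c : List (Fin ℓ) → B) (u : ℝ) :
    HasDerivAt (fun u : ℝ => ev c (TruncTensor.expo (u • a)))
      (ev c (TruncTensor.expo (u • a) * a)) u := by
  have h1 : ∀ u : ℝ, ev c (TruncTensor.expo (u • a)) =
      ∑ n ∈ Finset.range (N + 1), (u ^ n * (n.factorial : ℝ)⁻¹) • ev c (a ^ n) := by
    intro u
    unfold TruncTensor.expo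
    rw [map_sum]
    refine Finset.sum_congr rfl fun n _ => ?_
    rw [smul_pow, map_smul, map_smul, smul_smul, mul_comm]
  have h2 : ev c (TruncTensor.expo (u • a) * a) =
      ∑ n ∈ Finset.range N, (u ^ n * (n.factorial : ℝ)⁻¹) • ev c (a ^ (n + 1)) := by
    unfold TruncTensor.expo
    rw [Finset.sum_mul, map_sum, Finset.sum_range_succ]
    rw [smul_pow, smul_mul_assoc, smul_mul_assoc, ← pow_succ, pow_eq_zero_of_mem_filt ha,
      smul_zero, smul_zero, map_zero, add_zero]
    refine Finset.sum_congr rfl fun n _ => ?_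
    rw [smul_pow, smul_mul_assoc, smul_mul_assoc, ← pow_succ, map_smul, map_smul, smul_smul,
      mul_comm]
  simp only [h1]
  rw [h2]
  have h3 : ∀ n ∈ Finset.range (N + 1), HasDerivAt
      (fun u : ℝ => (u ^ n * (n.factorial : ℝ)⁻¹) • ev c (a ^ n))
      (((n : ℝ) * u ^ (n - 1) * (n.factorial : ℝ)⁻¹) • ev c (a ^ n)) u := fun n _ =>
    ((hasDerivAt_pow n u).mul_const _).smul_const _
  refine (HasDerivAt.fun_sum h3).congr_deriv ?_
  rw [Finset.sum_range_succ']
  simp only [Nat.cast_zero, zero_mul, zero_smul, add_zero, Nat.add_sub_cancel]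
  refine Finset.sum_congr rfl fun n _ => ?_
  congr 1
  rw [Nat.factorial_succ, Nat.cast_mul, mul_inv]
  have : ((n + 1 : ℕ) : ℝ) ≠ 0 := by positivity
  field_simp

/-! ### Expansion along words -/

/-- Taylor expansion with remainder of a family indexed by words whose time derivatives are given,
up to an error, by the action of a Lie element. -/
theorem word_expansion {B : Type*} [NormedAddCommGroup B] [NormedSpace ℝ B] {m : ℕ} (hm : m ≤ N)
    {K τ η : ℝ} (hτ : 0 ≤ τ) (hη : 0 ≤ η) {a : TruncTensor ℓ N} (ha : a ∈ filt ℓ N 1)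
    (haK : ScaledBound K τ a) (c r : List (Fin ℓ) → ℝ → B)
    (htop : ∀ w : List (Fin ℓ), w.length = m → ∀ u ∈ Icc (0 : ℝ) 1,
      τ ^ w.length * ‖c w u - c w 0‖ ≤ η)
    (hderiv : ∀ w : List (Fin ℓ), w.length < m → ∀ u ∈ Icc (0 : ℝ) 1,
      HasDerivWithinAt (c w) (ev (fun v => if v.length + w.length ≤ m then c (v ++ w) u else 0) a +
        r w u) (Icc 0 1) u)
    (hr : ∀ w : List (Fin ℓ), w.length < m → ∀ u ∈ Icc (0 : ℝ) 1,
      τ ^ w.length * ‖r w u‖ ≤ η) :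
    ∀ w : List (Fin ℓ), w.length ≤ m → ∀ u ∈ Icc (0 : ℝ) 1,
      τ ^ w.length * ‖c w u - ev (fun v => if v.length + w.length ≤ m then c (v ++ w) 0 else 0)
        (TruncTensor.expo (u • a))‖ ≤
      (Fintype.card {w : List (Fin ℓ) // w.length ≤ N} * K + 1) ^ (m - w.length) * η := by
  -- Each unit of degree costs one factor W in the error: the number of words times K for the longer
  -- words, and 1 for the error term.
  set W : ℝ := Fintype.card {w : List (Fin ℓ) // w.length ≤ N} * K + 1 with hW
  have hK := haK.nonneg
  have hW1 : 1 ≤ W := by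
    rw [hW]; have : (0 : ℝ) ≤ Fintype.card {w : List (Fin ℓ) // w.length ≤ N} * K := by positivity
    linarith
  set g : List (Fin ℓ) → List (Fin ℓ) → B :=
    fun w v => if v.length + w.length ≤ m then c (v ++ w) 0 else 0 with hg
  set D : List (Fin ℓ) → ℝ → B := fun w u => c w u - ev (g w) (TruncTensor.expo (u • a)) with hD
  -- Induction on the remaining degree j = m - |w|. As a has no scalar component, the derivative of
  -- the error D_w involves only the errors of strictly longer words.
  have main : ∀ j : ℕ, ∀ w : List (Fin ℓ), w.length + j = m → ∀ u ∈ Icc (0 : ℝ) 1,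
      τ ^ w.length * ‖D w u‖ ≤ W ^ j * η := by
    intro j
    induction j using Nat.strong_induction_on with
    | _ j ih =>
    intro w hwj u hu
    rcases Nat.eq_zero_or_pos j with rfl | hj
    · have : ev (g w) (TruncTensor.expo (u • a)) = c w 0 := by
        rw [ev_apply, Finset.sum_eq_single ⟨[], Nat.zero_le _⟩]
        · rw [expo_apply_nil (Submodule.smul_mem _ _ ha), one_smul, hg]
          simp only [List.length_nil, List.nil_append]
          rw [if_pos (by omega)]
        · intro v _ hv
          have : v.1 ≠ [] := fun h => hv (Subtype.ext h)
          have := List.length_pos_iff.mpr this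
          rw [hg]
          simp only
          rw [if_neg (by omega), smul_zero]
        · simp
      rw [hD]
      simp only
      rw [this, pow_zero, one_mul]
      exact htop w (by omega) u hu
    · have hder : ∀ u ∈ Icc (0 : ℝ) 1, HasDerivWithinAt (D w)
          (ev (fun v => if v.length + w.length ≤ m then D (v ++ w) u else 0) a + r w u)
          (Icc 0 1) u := by
        intro u hu
        have h1 := (hderiv w (by omega) u hu).sub
          (hasDerivAt_ev_expo ha (g w) u).hasDerivWithinAt
        refine h1.congr_deriv ?_
        -- The expansion satisfies the system without error term: the letters contributed by the
        -- last factor a are moved onto w.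
        have h2 : ev (g w) (TruncTensor.expo (u • a) * a) =
            ev (fun v => if v.length + w.length ≤ m then
              ev (g (v ++ w)) (TruncTensor.expo (u • a)) else 0) a := by
          rw [ev_mul]
          simp only [ev_apply, Finset.smul_sum]
          rw [Finset.sum_comm]
          refine Finset.sum_congr rfl fun v _ => ?_
          by_cases hv : v.1.length + w.length ≤ m
          · rw [if_pos hv, Finset.smul_sum]
            refine Finset.sum_congr rfl fun v' _ => ?_
            rw [smul_comm]
            congr 2
            rw [hg]
            simp only [List.length_append, List.append_assoc]
            by_cases h : v'.1.length + (v.1.length + w.length) ≤ m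
            · rw [if_pos (by omega), if_pos (by omega), if_pos h]
            · rw [if_neg h]
              split_ifs
              · omega
              · rfl
              · rfl
          · rw [if_neg hv, smul_zero]
            refine Finset.sum_eq_zero fun v' _ => ?_
            rw [hg]
            simp only [List.length_append]
            rw [if_neg (c := v'.1.length + v.1.length + w.length ≤ m) (by omega), ite_self,
              smul_zero, smul_zero]
        rw [h2, add_sub_right_comm, ← ev_sub]
        congr 1
        refine congrArg (fun c => ev c a) (funext fun v => ?_)
        split_ifs
        · rfl
        · exact sub_zero _
      have hbd : ∀ u ∈ Icc (0 : ℝ) 1, ‖τ ^ w.length •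
          (ev (fun v => if v.length + w.length ≤ m then D (v ++ w) u else 0) a + r w u)‖ ≤
          W ^ j * η := by
        intro u hu
        rw [smul_add]
        refine (norm_add_le _ _).trans ?_
        have e1 : ‖τ ^ w.length • r w u‖ ≤ η := by
          rw [norm_smul, Real.norm_of_nonneg (pow_nonneg hτ _)]
          exact hr w (by omega) u hu
        have e2 : ‖τ ^ w.length •
            ev (fun v => if v.length + w.length ≤ m then D (v ++ w) u else 0) a‖ ≤
            Fintype.card {w : List (Fin ℓ) // w.length ≤ N} * (K * (W ^ (j - 1) * η)) := by
          have e5 : ∀ c : List (Fin ℓ) → B, τ ^ w.length • ev c a =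
              ev (fun v => τ ^ w.length • c v) a := fun c =>
            (ev_comp (LinearMap.lsmul ℝ B (τ ^ w.length)) c a).symm
          rw [e5]
          refine norm_ev_le haK (fun v hv => ?_) (by positivity)
          have hv0 : v.1.length ≠ 0 := fun h => hv (ha v (by omega))
          by_cases hvm : v.1.length + w.length ≤ m
          · rw [if_pos hvm, norm_smul, Real.norm_of_nonneg (pow_nonneg hτ _), ← mul_assoc,
              ← pow_add]
            have := ih (j - v.1.length) (by omega) (v.1 ++ w)
              (by rw [List.length_append]; omega) u hu
            rw [List.length_append] at this
            refine this.trans (mul_le_mul_of_nonneg_right ?_ hη)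
            exact pow_le_pow_right₀ hW1 (by omega)
          · rw [if_neg hvm, smul_zero, norm_zero, mul_zero]; positivity
        have e3 : η ≤ W ^ (j - 1) * η := by
          have := one_le_pow₀ hW1 (n := j - 1)
          nlinarith
        have e4 : W ^ j = W ^ (j - 1) * W := by
          rw [← pow_succ, Nat.sub_add_cancel hj]
        rw [e4, hW] at *
        nlinarith
      have h0 : D w 0 = 0 := by
        rw [hD]
        simp only [zero_smul, expo_zero, ev_one]
        rw [hg]
        simp only [List.length_nil, List.nil_append]
        rw [if_pos (by omega), sub_self]
      have h1 := norm_image_sub_le_of_norm_deriv_le_segment'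
        (f := fun u => τ ^ w.length • D w u) (a := 0) (b := 1) (C := W ^ j * η)
        (fun u hu => (hder u hu).const_smul (τ ^ w.length))
        (fun u hu => hbd u (Ico_subset_Icc_self hu)) u hu
      rw [h0, smul_zero, sub_zero, sub_zero, norm_smul,
        Real.norm_of_nonneg (pow_nonneg hτ _)] at h1
      refine h1.trans ?_
      have : 0 ≤ W ^ j * η := by positivity
      nlinarith [hu.2]
  intro w hw u hu
  exact main (m - w.length) w (by omega) u hu

end TruncTensor

end RoughFlow

namespace RoughFlow

open TruncTensor

/-! ### Iterated derivatives along vector fields and the derivation property -/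

section Words

variable {ℓ N : ℕ} {E F : Type*} [NormedAddCommGroup E] [NormedSpace ℝ E]
  [NormedAddCommGroup F] [NormedSpace ℝ F]

/-- The iterated derivative `V_{i_1} ⋯ V_{i_r} f` of `f` along vector fields. -/
def wordDeriv (Vs : Fin ℓ → E → E) : List (Fin ℓ) → (E → F) → E → F
  | [], f => f
  | i :: w, f => fun x => fderiv ℝ (wordDeriv Vs w f) x (Vs i x)

theorem wordDeriv_append (Vs : Fin ℓ → E → E) (f : E → F) (w : List (Fin ℓ)) :
    ∀ v : List (Fin ℓ), wordDeriv Vs (v ++ w) f = wordDeriv Vs v (wordDeriv Vs w f)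
  | [] => rfl
  | i :: v => by
    change (fun x => fderiv ℝ (wordDeriv Vs (v ++ w) f) x (Vs i x)) = _
    rw [wordDeriv_append Vs f w v]; rfl

theorem contDiff_wordDeriv {Vs : Fin ℓ → E → E} {m : ℕ} (hV : ∀ i, ContDiff ℝ m (Vs i))
    {n : ℕ} {f : E → F} (hf : ContDiff ℝ n f) : ∀ (w : List (Fin ℓ)) (k : ℕ),
    k + w.length ≤ n → k + w.length ≤ m + 1 → ContDiff ℝ k (wordDeriv Vs w f)
  | [], k, h, _ => hf.of_le (by exact_mod_cast h)
  | i :: w, k, h, h' => by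
    simp only [List.length_cons] at h h'
    have ih := contDiff_wordDeriv hV hf w (k + 1) (by omega) (by omega)
    have h1 : ContDiff ℝ k (fderiv ℝ (wordDeriv Vs w f)) :=
      ih.fderiv_right (by norm_cast)
    exact h1.clm_apply ((hV i).of_le (by exact_mod_cast (by omega : k ≤ m)))

theorem contDiff_vbrk {Vs : Fin ℓ → E → E} {m : ℕ} (hV : ∀ i, ContDiff ℝ m (Vs i)) :
    ∀ (I : List (Fin ℓ)) (k : ℕ), k + I.length ≤ m + 1 → ContDiff ℝ k (vbrk Vs I)
  | [], _, _ => contDiff_const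
  | [i], k, h => (hV i).of_le (by
      simp only [List.length_singleton] at h; exact_mod_cast (by omega : k ≤ m))
  | i :: j :: I, k, h => by
    simp only [List.length_cons] at h
    have ih := contDiff_vbrk hV (j :: I) (k + 1) (by simp only [List.length_cons]; omega)
    have hi : ContDiff ℝ (k + 1 : ℕ) (Vs i) :=
      (hV i).of_le (by exact_mod_cast (by omega : k + 1 ≤ m))
    have h1 : ContDiff ℝ k (fderiv ℝ (vbrk Vs (j :: I))) := ih.fderiv_right (by norm_cast)
    have h2 : ContDiff ℝ k (fderiv ℝ (Vs i)) := hi.fderiv_right (by norm_cast)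
    exact (h1.clm_apply (hi.of_le (by exact_mod_cast Nat.le_succ k))).sub
      (h2.clm_apply (ih.of_le (by exact_mod_cast Nat.le_succ k)))

/-- Iterated brackets act on functions as first-order operators. -/
theorem ev_wordDeriv_brk {Vs : Fin ℓ → E → E} {m : ℕ} (hV : ∀ i, ContDiff ℝ m (Vs i)) :
    ∀ (J : List (Fin ℓ)), J ≠ [] → J.length ≤ N → J.length ≤ m + 1 →
    ∀ f : E → F, ContDiff ℝ J.length f → ∀ x : E,
      ev (fun v => wordDeriv Vs v f x) (brk J : TruncTensor ℓ N) = fderiv ℝ f x (vbrk Vs J x)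
  | [], h, _, _, _, _, _ => absurd rfl h
  | [i], _, hN, _, f, _, x => ev_basisVec (by simpa using hN) _ i
  | i :: j :: J, _, hN, hm, f, hf, x => by
    set J' := j :: J with hJ'
    simp only [List.length_cons] at hm hf
    have hl : J'.length = J.length + 1 := by rw [hJ', List.length_cons]
    have hN' : J'.length + 1 ≤ N := hN
    have ih : ∀ g : E → F, ContDiff ℝ J'.length g → ∀ x : E,
        ev (fun v => wordDeriv Vs v g x) (brk J' : TruncTensor ℓ N) =
          fderiv ℝ g x (vbrk Vs J' x) := fun g hg x =>
      ev_wordDeriv_brk hV J' (by simp [hJ']) (by omega) (by omega) g hg x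
    rw [ev_brk_cons_cons _ _ _ _ hN, ← hJ']
    have hf1 : ContDiff ℝ J'.length f := hf.of_le (by rw [hl]; exact_mod_cast Nat.le_succ _)
    -- Words starting with i give V_i applied to the function V_{[J']} f.
    have e1 : ev (fun w => wordDeriv Vs (i :: w) f x) (brk J' : TruncTensor ℓ N) =
        fderiv ℝ (fun y => fderiv ℝ f y (vbrk Vs J' y)) x (Vs i x) := by
      have h1 : (fun y => fderiv ℝ f y (vbrk Vs J' y)) =
          fun y => ∑ w, (brk J' : TruncTensor ℓ N) w • wordDeriv Vs w.1 f y := by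
        funext y
        rw [← ih f hf1 y, ev_apply]
      have hd : ∀ w : {w : List (Fin ℓ) // w.length ≤ N}, (brk J' : TruncTensor ℓ N) w ≠ 0 →
          DifferentiableAt ℝ (wordDeriv Vs w.1 f) x := by
        intro w hw
        have hw' : w.1.length = J'.length := by
          by_contra h
          exact hw (brk_apply_eq_zero _ _ h)
        refine (contDiff_wordDeriv hV hf w.1 1 (by omega) (by omega)).differentiable
          (by norm_num) x
      rw [h1]
      have h2 : HasFDerivAt (fun y => ∑ w, (brk J' : TruncTensor ℓ N) w • wordDeriv Vs w.1 f y)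
          (∑ w : {w : List (Fin ℓ) // w.length ≤ N},
            (brk J' : TruncTensor ℓ N) w • fderiv ℝ (wordDeriv Vs w.1 f) x) x := by
        refine HasFDerivAt.fun_sum fun w _ => ?_
        by_cases hw : (brk J' : TruncTensor ℓ N) w = 0
        · simp only [hw, zero_smul]
          exact hasFDerivAt_const _ _
        · exact (hd w hw).hasFDerivAt.const_smul _
      rw [h2.fderiv, ev_apply, _root_.sum_apply]
      rfl
    have hV1 : ContDiff ℝ J'.length (Vs i) :=
      (hV i).of_le (by rw [hl]; exact_mod_cast (by omega : J.length + 1 ≤ m))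
    have hDf : ContDiff ℝ J'.length (fderiv ℝ f) :=
      hf.fderiv_right (by rw [hl]; norm_cast)
    -- Words ending with i give V_{[J']} applied to the function V_i f.
    have e2 : ev (fun w => wordDeriv Vs (w ++ [i]) f x) (brk J' : TruncTensor ℓ N) =
        fderiv ℝ (fun y => fderiv ℝ f y (Vs i y)) x (vbrk Vs J' x) := by
      rw [← ih _ (hDf.clm_apply hV1)]
      refine ev_congr fun w _ => ?_
      rw [wordDeriv_append]; rfl
    rw [e1, e2]
    have hne : (J'.length : WithTop ℕ∞) ≠ 0 := by rw [hl]; simp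
    have dDf : DifferentiableAt ℝ (fderiv ℝ f) x := hDf.differentiable hne x
    have dV : DifferentiableAt ℝ (Vs i) x := hV1.differentiable hne x
    have dB : DifferentiableAt ℝ (vbrk Vs J') x :=
      (contDiff_vbrk hV J' 1 (by omega)).differentiable (by norm_num) x
    rw [fderiv_clm_apply dDf dB, fderiv_clm_apply dDf dV]
    -- The second-order terms of the commutator cancel by symmetry of D²f, leaving Df applied to the
    -- bracket.
    have hsym : fderiv ℝ (fderiv ℝ f) x (Vs i x) (vbrk Vs J' x) =
        fderiv ℝ (fderiv ℝ f) x (vbrk Vs J' x) (Vs i x) := by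
      have : IsSymmSndFDerivAt ℝ f x := by
        refine (hf.contDiffAt).isSymmSndFDerivAt ?_
        rw [minSmoothness_of_isRCLikeNormedField]
        exact_mod_cast (by omega : 2 ≤ J.length + 1 + 1)
      exact this _ _
    simp only [_root_.add_apply, ContinuousLinearMap.comp_apply,
      ContinuousLinearMap.flip_apply]
    change _ = fderiv ℝ f x (VectorField.lieBracket ℝ (Vs i) (vbrk Vs J') x)
    rw [VectorField.lieBracket, map_sub, hsym]
    abel

/-- By linearity from single brackets, which are homogeneous. Working degree by degree asks of f
only as many derivatives as the degree considered. -/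
theorem ev_wordDeriv_homPart {Vs : Fin ℓ → E → E} {m : ℕ} (hV : ∀ i, ContDiff ℝ m (Vs i))
    {k : ℕ} (hk : 1 ≤ k) (hkN : k ≤ N) (hkm : k ≤ m + 1) {f : E → F} (hf : ContDiff ℝ k f)
    {a : TruncTensor ℓ N} (ha : a ∈ brkSpan ℓ N) (x : E) :
    ev (fun v => wordDeriv Vs v f x) (homPart k a) =
      fderiv ℝ f x (ev (fun v => wordDeriv Vs v (id : E → E) x) (homPart k a)) := by
  induction ha using Submodule.span_induction with
  | mem a ha =>
    obtain ⟨J, rfl⟩ := ha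
    by_cases h : J.length = k
    · have hJ : J ≠ [] := by rintro rfl; simp at h; omega
      rw [homPart_eq_self (fun w hw => brk_apply_eq_zero J w (by omega)),
        ev_wordDeriv_brk hV J hJ (by omega) (by omega) f (by rw [h]; exact hf),
        ev_wordDeriv_brk hV J hJ (by omega) (by omega) id contDiff_id, fderiv_id]
      rfl
    · rw [homPart_eq_zero (fun w hw => brk_apply_eq_zero J w (by omega))]
      simp
  | zero => simp
  | add a b _ _ ha hb => simp only [map_add, ha, hb]
  | smul c a _ ha => simp only [map_smul, ha]

theorem sum_homPart_eq {a : TruncTensor ℓ N} (ha : a ∈ filt ℓ N 1) (q : ℕ)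
    (c : List (Fin ℓ) → F) :
    ev (fun v => if v.length ≤ q then c v else 0) a =
      ∑ k ∈ Finset.Icc 1 q, ev c (homPart k a) := by
  simp only [ev_apply, homPart_apply]
  rw [Finset.sum_comm]
  refine Finset.sum_congr rfl fun w _ => ?_
  by_cases hw : w.1.length ∈ Finset.Icc 1 q
  · rw [Finset.sum_eq_single w.1.length]
    · rw [if_pos rfl, if_pos (Finset.mem_Icc.mp hw).2]
    · intro k _ hk
      rw [if_neg (Ne.symm hk), zero_smul]
    · exact fun h => absurd hw h
  · have h1 : ∀ k ∈ Finset.Icc 1 q, (if w.1.length = k then a w else 0) • c w.1 = 0 := by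
      intro k hk
      rw [if_neg, zero_smul]
      rintro rfl
      exact hw hk
    rw [Finset.sum_eq_zero h1]
    rw [Finset.mem_Icc, not_and_or] at hw
    rcases hw with hw | hw
    · rw [ha w (by omega), zero_smul]
    · rw [if_neg hw, smul_zero]

/-- The derivation property of Lie elements, cut at total degree `m`. -/
theorem ev_wordDeriv_eq {Vs : Fin ℓ → E → E} {n : ℕ} (hV : ∀ i, ContDiff ℝ n (Vs i))
    {m : ℕ} (hmN : m ≤ N) (hmn : m ≤ n + 1) {a : TruncTensor ℓ N} (ha : a ∈ brkSpan ℓ N)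
    (w : List (Fin ℓ)) (x : E) :
    ev (fun v => if v.length + w.length ≤ m then wordDeriv Vs (v ++ w) (id : E → E) x else 0) a =
      fderiv ℝ (wordDeriv Vs w (id : E → E)) x
        (ev (fun v => if v.length + w.length ≤ m then wordDeriv Vs v (id : E → E) x else 0) a) := by
  have ha1 := mem_filt_one_of_mem_brkSpan ha
  by_cases hw : w.length ≤ m
  -- The cut at total degree m keeps those components of a which the remaining regularity of F_w can
  -- absorb.
  · have hc : ∀ v : List (Fin ℓ), v.length + w.length ≤ m ↔ v.length ≤ m - w.length := by
      intro v; omega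
    simp only [hc, wordDeriv_append]
    rw [sum_homPart_eq ha1, sum_homPart_eq ha1, map_sum]
    refine Finset.sum_congr rfl fun k hk => ?_
    rw [Finset.mem_Icc] at hk
    exact ev_wordDeriv_homPart hV hk.1 (by omega) (by omega)
      (contDiff_wordDeriv hV contDiff_id (n := m) w k (by omega) (by omega)) ha x
  · have hc : ∀ v : List (Fin ℓ), ¬ v.length + w.length ≤ m := by
      intro v; omega
    simp only [hc, if_false]
    simp [ev_apply]

/-- The logarithmic vector field in terms of the coordinates of the logarithm on words. -/
theorem logField_eq {Vs : Fin ℓ → E → E} {n : ℕ} (hV : ∀ i, ContDiff ℝ n (Vs i))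
    (hN : N ≤ n + 1) (V : E → E) (Λ : ℝ → ℝ → List (Fin ℓ) → ℝ) (t s : ℝ) (y : E) :
    logField N V Vs Λ t s y = (t - s) • V y +
      ev (fun v => wordDeriv Vs v (id : E → E) y) (∑ r ∈ Finset.Icc 1 N, ∑ I : Fin r → Fin ℓ,
        Λ t s (List.ofFn I) • (brk (List.ofFn I) : TruncTensor ℓ N)) := by
  unfold logField
  congr 1
  simp only [map_sum, map_smul]
  refine Finset.sum_congr rfl fun r hr => Finset.sum_congr rfl fun I _ => ?_
  rw [Finset.mem_Icc] at hr
  rw [ev_wordDeriv_brk hV _ _ _ _ id contDiff_id, fderiv_id]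
  · rfl
  · intro h
    have := congrArg List.length h
    simp at this; omega
  · simpa using hr.2
  · simpa using hr.2.trans hN

end Words

/-! ### Bounded functions with bounded derivatives and Hölder top derivative -/

section Regular

universe u
variable {E : Type u} [NormedAddCommGroup E] [NormedSpace ℝ E]

/-- `f` is bounded and `m` times differentiable with bounded derivatives, the last one being
`θ`-Hölder. -/
def Regular (θ : ℝ) : ℕ → ∀ {F : Type u} [NormedAddCommGroup F] [NormedSpace ℝ F],
    (E → F) → Prop
  | 0, _, _, _, f => ∃ M : ℝ, (∀ x, ‖f x‖ ≤ M) ∧ ∀ x y, ‖f x - f y‖ ≤ M * ‖x - y‖ ^ θ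
  | m + 1, _, _, _, f => (∃ M : ℝ, ∀ x, ‖f x‖ ≤ M) ∧ Differentiable ℝ f ∧
      Regular θ m (fderiv ℝ f)

variable {F G H : Type u} [NormedAddCommGroup F] [NormedSpace ℝ F]
  [NormedAddCommGroup G] [NormedSpace ℝ G] [NormedAddCommGroup H] [NormedSpace ℝ H]

theorem Regular.exists_bound {θ : ℝ} {m : ℕ} {f : E → F} (hf : Regular θ m f) :
    ∃ M : ℝ, 0 ≤ M ∧ ∀ x, ‖f x‖ ≤ M := by
  cases m with
  | zero => obtain ⟨M, h, -⟩ := hf; exact ⟨M, (norm_nonneg _).trans (h 0), h⟩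
  | succ m => obtain ⟨⟨M, h⟩, -⟩ := hf; exact ⟨M, (norm_nonneg _).trans (h 0), h⟩

/-- A bounded Lipschitz function is Hölder. -/
theorem holder_of_lipschitz {E F : Type*} [NormedAddCommGroup E] [NormedAddCommGroup F] {θ : ℝ}
    (hθ : 0 ≤ θ) (hθ1 : θ ≤ 1) {f : E → F} {M K : ℝ} (hM : ∀ x, ‖f x‖ ≤ M)
    (hK : ∀ x y, ‖f x - f y‖ ≤ K * ‖x - y‖) (x y : E) :
    ‖f x - f y‖ ≤ (2 * M + |K|) * ‖x - y‖ ^ θ := by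
  have hM0 : 0 ≤ M := (norm_nonneg _).trans (hM x)
  rcases le_total ‖x - y‖ 1 with h | h
  · have h1 : ‖x - y‖ ≤ ‖x - y‖ ^ θ := by
      rcases (norm_nonneg (x - y)).eq_or_lt with h0 | h0
      · rw [← h0]; exact Real.rpow_nonneg le_rfl _
      · calc ‖x - y‖ = ‖x - y‖ ^ (1 : ℝ) := (Real.rpow_one _).symm
          _ ≤ ‖x - y‖ ^ θ := Real.rpow_le_rpow_of_exponent_ge h0 h hθ1
    have h2 : 0 ≤ ‖x - y‖ ^ θ := Real.rpow_nonneg (norm_nonneg _) _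
    calc ‖f x - f y‖ ≤ K * ‖x - y‖ := hK x y
      _ ≤ |K| * ‖x - y‖ := mul_le_mul_of_nonneg_right (le_abs_self K) (norm_nonneg _)
      _ ≤ |K| * ‖x - y‖ ^ θ := mul_le_mul_of_nonneg_left h1 (abs_nonneg _)
      _ ≤ (2 * M + |K|) * ‖x - y‖ ^ θ := by nlinarith
  · have h1 : 1 ≤ ‖x - y‖ ^ θ := Real.one_le_rpow h hθ
    calc ‖f x - f y‖ ≤ ‖f x‖ + ‖f y‖ := norm_sub_le _ _
      _ ≤ 2 * M + |K| := by linarith [hM x, hM y, abs_nonneg K]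
      _ ≤ (2 * M + |K|) * ‖x - y‖ ^ θ := le_mul_of_one_le_right (by positivity) h1

theorem Regular.zero_of_succ {θ θ' : ℝ} (hθ : 0 ≤ θ) (hθ1 : θ ≤ 1) {m : ℕ} {f : E → F}
    (hf : Regular θ' (m + 1) f) : Regular θ 0 f := by
  obtain ⟨⟨M, hM⟩, hd, h⟩ := hf
  obtain ⟨K, hK, hK'⟩ := h.exists_bound
  have hM0 : 0 ≤ M := (norm_nonneg _).trans (hM 0)
  have hlip : ∀ x y, ‖f x - f y‖ ≤ K * ‖x - y‖ := fun x y =>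
    Convex.norm_image_sub_le_of_norm_fderiv_le (fun z _ => hd z) (fun z _ => hK' z)
      convex_univ (mem_univ y) (mem_univ x)
  exact ⟨2 * M + |K|, fun x => (hM x).trans (by linarith [abs_nonneg K]),
    holder_of_lipschitz hθ hθ1 hM hlip⟩

theorem Regular.of_succ {θ θ' : ℝ} (hθ : 0 ≤ θ) (hθ1 : θ ≤ 1) {m : ℕ} {f : E → F}
    (hf : Regular θ' (m + 1) f) : Regular θ m f := by
  induction m generalizing F with
  | zero => exact hf.zero_of_succ hθ hθ1
  | succ m ih => exact ⟨hf.1, hf.2.1, ih hf.2.2⟩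

theorem Regular.of_le {θ : ℝ} (hθ : 0 ≤ θ) (hθ1 : θ ≤ 1) {m n : ℕ} (h : m ≤ n) {f : E → F}
    (hf : Regular θ n f) : Regular θ m f := by
  induction n, h using Nat.le_induction with
  | base => exact hf
  | succ n _ ih => exact ih (hf.of_succ hθ hθ1)

theorem Regular.add {θ : ℝ} {m : ℕ} {f g : E → F} (hf : Regular θ m f) (hg : Regular θ m g) :
    Regular θ m (fun x => f x + g x) := by
  induction m generalizing F with
  | zero =>
    obtain ⟨M, h1, h2⟩ := hf
    obtain ⟨M', h1', h2'⟩ := hg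
    refine ⟨M + M', fun x => (norm_add_le _ _).trans (add_le_add (h1 x) (h1' x)), fun x y => ?_⟩
    have : f x + g x - (f y + g y) = (f x - f y) + (g x - g y) := by abel
    rw [this, add_mul]
    exact (norm_add_le _ _).trans (add_le_add (h2 x y) (h2' x y))
  | succ m ih =>
    obtain ⟨⟨M, h1⟩, h2, h3⟩ := hf
    obtain ⟨⟨M', h1'⟩, h2', h3'⟩ := hg
    refine ⟨⟨M + M', fun x => (norm_add_le _ _).trans (add_le_add (h1 x) (h1' x))⟩,
      h2.add h2', ?_⟩
    have : fderiv ℝ (fun x => f x + g x) = fun x => fderiv ℝ f x + fderiv ℝ g x := by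
      funext x
      exact fderiv_fun_add (h2 x) (h2' x)
    rw [this]
    exact ih h3 h3'

theorem Regular.bilin {θ : ℝ} (hθ : 0 ≤ θ) (hθ1 : θ ≤ 1) {m : ℕ} {f : E → F} {g : E → G}
    (B : F →L[ℝ] G →L[ℝ] H) (hf : Regular θ m f) (hg : Regular θ m g) :
    Regular θ m (fun x => B (f x) (g x)) := by
  have bd : ∀ {M M' : ℝ} (_ : ∀ x, ‖f x‖ ≤ M) (_ : ∀ x, ‖g x‖ ≤ M') (x : E),
      ‖B (f x) (g x)‖ ≤ ‖B‖ * M * M' := by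
    intro M M' h1 h1' x
    have hM : 0 ≤ M := (norm_nonneg _).trans (h1 x)
    calc ‖B (f x) (g x)‖ ≤ ‖B‖ * ‖f x‖ * ‖g x‖ := B.le_opNorm₂ _ _
      _ ≤ ‖B‖ * M * M' := by
        have := h1 x
        have := h1' x
        gcongr
  induction m generalizing F G H with
  | zero =>
    obtain ⟨M, h1, h2⟩ := hf
    obtain ⟨M', h1', h2'⟩ := hg
    have hM : 0 ≤ M := (norm_nonneg _).trans (h1 0)
    have hM' : 0 ≤ M' := (norm_nonneg _).trans (h1' 0)
    refine ⟨2 * (‖B‖ * M * M'), fun x => (bd h1 h1' x).trans ?_, fun x y => ?_⟩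
    · have : 0 ≤ ‖B‖ * M * M' := by positivity
      linarith
    have : B (f x) (g x) - B (f y) (g y) = B (f x - f y) (g x) + B (f y) (g x - g y) := by
      simp only [map_sub, _root_.sub_apply]; abel
    rw [this]
    have h0 : 0 ≤ ‖x - y‖ ^ θ := Real.rpow_nonneg (norm_nonneg _) _
    calc ‖B (f x - f y) (g x) + B (f y) (g x - g y)‖
        ≤ ‖B‖ * ‖f x - f y‖ * ‖g x‖ + ‖B‖ * ‖f y‖ * ‖g x - g y‖ :=
          (norm_add_le _ _).trans (add_le_add (B.le_opNorm₂ _ _) (B.le_opNorm₂ _ _))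
      _ ≤ ‖B‖ * (M * ‖x - y‖ ^ θ) * M' + ‖B‖ * M * (M' * ‖x - y‖ ^ θ) := by
        have := h1 y
        have := h1' x
        have := h2 x y
        have := h2' x y
        gcongr
      _ = 2 * (‖B‖ * M * M') * ‖x - y‖ ^ θ := by ring
  | succ m ih =>
    have hf' := hf.of_succ hθ hθ1
    have hg' := hg.of_succ hθ hθ1
    obtain ⟨⟨M, h1⟩, h2, h3⟩ := hf
    obtain ⟨⟨M', h1'⟩, h2', h3'⟩ := hg
    refine ⟨⟨_, bd h1 h1'⟩, fun x => ?_, ?_⟩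
    · exact (B.hasFDerivAt_of_bilinear (h2 x).hasFDerivAt (h2' x).hasFDerivAt).differentiableAt
    · have : fderiv ℝ (fun x => B (f x) (g x)) = fun x =>
          B.precompR E (f x) (fderiv ℝ g x) + B.precompL E (fderiv ℝ f x) (g x) := by
        funext x
        exact (B.hasFDerivAt_of_bilinear (h2 x).hasFDerivAt (h2' x).hasFDerivAt).fderiv
      rw [this]
      -- Each term of the product rule is again a bilinear pairing, of one factor with the
      -- derivative of the other, so the induction runs over all bilinear maps at once.
      refine Regular.add (ih _ hf' h3' ?_) (ih _ h3 hg' ?_)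
      · intro M M' k1 k2 x
        have hM : 0 ≤ M := (norm_nonneg _).trans (k1 x)
        refine (ContinuousLinearMap.le_opNorm₂ _ _ _).trans ?_
        have := k1 x
        have := k2 x
        gcongr
      · intro M M' k1 k2 x
        have hM : 0 ≤ M := (norm_nonneg _).trans (k1 x)
        refine (ContinuousLinearMap.le_opNorm₂ _ _ _).trans ?_
        have := k1 x
        have := k2 x
        gcongr

theorem Regular.clm_apply {θ : ℝ} (hθ : 0 ≤ θ) (hθ1 : θ ≤ 1) {m : ℕ} {f : E → F →L[ℝ] G}
    {g : E → F} (hf : Regular θ m f) (hg : Regular θ m g) : Regular θ m (fun x => f x (g x)) :=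
  Regular.bilin hθ hθ1 (ContinuousLinearMap.id ℝ (F →L[ℝ] G)) hf hg

end Regular

end RoughFlow

namespace RoughFlow

open TruncTensor

/-! ### Translation between the g-Lipschitz norms and explicit bounds -/

section Regular

universe u
variable {E F : Type u} [NormedAddCommGroup E] [NormedSpace ℝ E]
  [NormedAddCommGroup F] [NormedSpace ℝ F]

theorem norm_iteratedFDeriv_succ_sub (n : ℕ) (f : E → F) (x y : E) :
    ‖iteratedFDeriv ℝ (n + 1) f x - iteratedFDeriv ℝ (n + 1) f y‖ =
      ‖iteratedFDeriv ℝ n (fderiv ℝ f) x - iteratedFDeriv ℝ n (fderiv ℝ f) y‖ := by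
  rw [iteratedFDeriv_succ_eq_comp_right (x := x), iteratedFDeriv_succ_eq_comp_right (x := y),
    ← dist_eq_norm, ← dist_eq_norm]
  exact LinearIsometryEquiv.dist_map (continuousMultilinearCurryRightEquiv' ℝ n E F).symm _ _

theorem norm_iteratedFDeriv_zero_sub (f : E → F) (x y : E) :
    ‖iteratedFDeriv ℝ 0 f x - iteratedFDeriv ℝ 0 f y‖ = ‖f x - f y‖ := by
  rw [iteratedFDeriv_zero_eq_comp]
  simp only [Function.comp_apply]
  rw [← map_sub, LinearIsometryEquiv.norm_map]

theorem regular_of_bounds {θ : ℝ} {m : ℕ} {f : E → F} (hf : ContDiff ℝ m f)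
    (hb : ∀ r ≤ m, ∃ M : ℝ, ∀ x, ‖iteratedFDeriv ℝ r f x‖ ≤ M)
    (hh : ∃ C : ℝ, ∀ x y, ‖iteratedFDeriv ℝ m f x - iteratedFDeriv ℝ m f y‖ ≤ C * ‖x - y‖ ^ θ) :
    Regular θ m f := by
  induction m generalizing F with
  | zero =>
    obtain ⟨M, hM⟩ := hb 0 le_rfl
    obtain ⟨C, hC⟩ := hh
    refine ⟨|M| + |C|, fun x => ?_, fun x y => ?_⟩
    · have := hM x
      rw [norm_iteratedFDeriv_zero] at this
      linarith [le_abs_self M, abs_nonneg C]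
    · have := hC x y
      rw [norm_iteratedFDeriv_zero_sub] at this
      refine this.trans (mul_le_mul_of_nonneg_right ?_ (Real.rpow_nonneg (norm_nonneg _) _))
      linarith [le_abs_self C, abs_nonneg M]
  | succ m ih =>
    refine ⟨?_, hf.differentiable (by simp), ih ?_ ?_ ?_⟩
    · obtain ⟨M, hM⟩ := hb 0 (Nat.zero_le _)
      exact ⟨M, fun x => by simpa using hM x⟩
    · exact hf.fderiv_right (by norm_cast)
    · intro r hr
      obtain ⟨M, hM⟩ := hb (r + 1) (by omega)
      exact ⟨M, fun x => by rw [norm_iteratedFDeriv_fderiv]; exact hM x⟩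
    · obtain ⟨C, hC⟩ := hh
      exact ⟨C, fun x y => by rw [← norm_iteratedFDeriv_succ_sub]; exact hC x y⟩

theorem IsGLipschitz.regular {g : ℝ} {f : E → F} (hf : IsGLipschitz g f) :
    Regular (Int.fract g) ⌊g⌋₊ f := by
  obtain ⟨hc, hn⟩ := hf
  rw [eLipNorm, ENNReal.add_lt_top] at hn
  obtain ⟨h1, h2⟩ := hn
  refine regular_of_bounds hc (fun r hr => ?_) ?_
  · rw [eCkNorm, ENNReal.sum_lt_top] at h1
    have h := h1 r (Finset.mem_range.mpr (by omega))
    refine ⟨(⨆ x : E, ‖iteratedFDeriv ℝ r f x‖ₑ).toReal, fun x => ?_⟩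
    have hx : ‖iteratedFDeriv ℝ r f x‖ₑ ≤ ⨆ x : E, ‖iteratedFDeriv ℝ r f x‖ₑ :=
      le_iSup (fun x => ‖iteratedFDeriv ℝ r f x‖ₑ) x
    rw [← toReal_enorm]
    exact ENNReal.toReal_mono h.ne hx
  · rw [eHolderNorm_lt_top] at h2
    obtain ⟨C, hC⟩ := h2
    refine ⟨C, fun x y => ?_⟩
    have := hC.dist_le x y
    rwa [dist_eq_norm, dist_eq_norm, Real.coe_toNNReal _ (Int.fract_nonneg g)] at this

/-- A bounded Hölder function is Hölder for smaller exponents. -/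
theorem holder_of_exponent_le {E F : Type*} [NormedAddCommGroup E] [NormedAddCommGroup F]
    {θ θ' : ℝ} (hθ' : 0 ≤ θ') (h : θ' ≤ θ) {f : E → F} {M K : ℝ} (hM : ∀ x, ‖f x‖ ≤ M)
    (hK : ∀ x y, ‖f x - f y‖ ≤ K * ‖x - y‖ ^ θ) (x y : E) :
    ‖f x - f y‖ ≤ (2 * M + |K|) * ‖x - y‖ ^ θ' := by
  have hM0 : 0 ≤ M := (norm_nonneg _).trans (hM x)
  rcases (norm_nonneg (x - y)).eq_or_lt with h0 | h0
  · have : f x - f y = 0 := by rw [sub_eq_zero.mp (norm_eq_zero.mp h0.symm), sub_self]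
    rw [this, norm_zero]
    have := Real.rpow_nonneg (norm_nonneg (x - y)) θ'
    positivity
  rcases le_total ‖x - y‖ 1 with h1 | h1
  · have h2 : ‖x - y‖ ^ θ ≤ ‖x - y‖ ^ θ' := Real.rpow_le_rpow_of_exponent_ge h0 h1 h
    have h3 : 0 ≤ ‖x - y‖ ^ θ := Real.rpow_nonneg (norm_nonneg _) _
    calc ‖f x - f y‖ ≤ K * ‖x - y‖ ^ θ := hK x y
      _ ≤ |K| * ‖x - y‖ ^ θ := mul_le_mul_of_nonneg_right (le_abs_self K) h3
      _ ≤ |K| * ‖x - y‖ ^ θ' := mul_le_mul_of_nonneg_left h2 (abs_nonneg _)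
      _ ≤ (2 * M + |K|) * ‖x - y‖ ^ θ' := by nlinarith [h3.trans h2]
  · have h2 : 1 ≤ ‖x - y‖ ^ θ' := Real.one_le_rpow h1 hθ'
    calc ‖f x - f y‖ ≤ ‖f x‖ + ‖f y‖ := norm_sub_le _ _
      _ ≤ 2 * M + |K| := by linarith [hM x, hM y, abs_nonneg K]
      _ ≤ (2 * M + |K|) * ‖x - y‖ ^ θ' := le_mul_of_one_le_right (by positivity) h2

theorem Regular.of_exponent_le {θ θ' : ℝ} (hθ' : 0 ≤ θ') (h : θ' ≤ θ) {m : ℕ} {f : E → F}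
    (hf : Regular θ m f) : Regular θ' m f := by
  induction m generalizing F with
  | zero =>
    obtain ⟨M, h1, h2⟩ := hf
    have hM0 : 0 ≤ M := (norm_nonneg _).trans (h1 0)
    exact ⟨2 * M + |M|, fun x => (h1 x).trans (by linarith [abs_nonneg M]),
      holder_of_exponent_le hθ' h h1 h2⟩
  | succ m ih => exact ⟨hf.1, hf.2.1, ih hf.2.2⟩

/-- The first letter costs nothing, since V_i Id = V_i; every further letter costs one derivative. A
word of length m + 1 is still bounded and θ-Hölder. -/
theorem regular_wordDeriv {ℓ : ℕ} {θ : ℝ} (hθ : 0 ≤ θ) (hθ1 : θ ≤ 1) {Vs : Fin ℓ → E → E} {m : ℕ}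
    (hV : ∀ i, Regular θ m (Vs i)) : ∀ (w : List (Fin ℓ)) (k : ℕ), w ≠ [] →
    k + w.length = m + 1 → Regular θ k (wordDeriv Vs w (id : E → E))
  | [], _, h, _ => absurd rfl h
  | [i], k, _, h => by
    obtain rfl : k = m := by simpa using h
    have : wordDeriv Vs [i] (id : E → E) = Vs i := by
      funext x
      change fderiv ℝ id x (Vs i x) = Vs i x
      rw [fderiv_id]; rfl
    rw [this]
    exact hV i
  | i :: j :: w, k, _, h => by
    have ih := regular_wordDeriv hθ hθ1 hV (j :: w) (k + 1) (by simp)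
      (by simp only [List.length_cons] at h ⊢; omega)
    have hk : k ≤ m := by simp only [List.length_cons] at h; omega
    exact ih.2.2.clm_apply hθ hθ1 ((hV i).of_le hθ hθ1 hk)

theorem IsGLipschitz.regular_one {ρ : ℝ} (hρ : 0 < ρ) {f : E → F}
    (hf : IsGLipschitz (1 + ρ) f) : Regular (min ρ 1) 1 f := by
  have h := hf.regular
  rcases lt_or_ge ρ 1 with h1 | h1
  · have hfl : ⌊1 + ρ⌋₊ = 1 := by
      rw [Nat.floor_eq_iff (by linarith)]; constructor <;> push_cast <;> linarith
    have hfr : Int.fract (1 + ρ) = ρ := by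
      rw [Int.fract_eq_iff]; exact ⟨hρ.le, h1, 1, by push_cast; ring⟩
    rw [hfl, hfr] at h
    rwa [min_eq_left h1.le]
  · rw [min_eq_right h1]
    -- For ρ ≥ 1 the second derivative is bounded, so the first one is Lipschitz and the exponent
    -- saturates at 1.
    have hfl : 2 ≤ ⌊1 + ρ⌋₊ := Nat.le_floor (by push_cast; linarith)
    obtain ⟨m, hm⟩ : ∃ m, ⌊1 + ρ⌋₊ = m + 1 + 1 := ⟨⌊1 + ρ⌋₊ - 2, by omega⟩
    rw [hm] at h
    exact (h.of_succ zero_le_one le_rfl).of_le zero_le_one le_rfl (by omega)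

theorem eHolderNorm_le_of_bound {E F : Type*} [NormedAddCommGroup E] [NormedAddCommGroup F]
    {ρ K : ℝ} (hρ : 0 ≤ ρ) (hK : 0 ≤ K) {f : E → F}
    (hf : ∀ x y, ‖f x - f y‖ ≤ K * ‖x - y‖ ^ ρ) :
    eHolderNorm ρ.toNNReal f ≤ ENNReal.ofReal K := by
  have : HolderWith K.toNNReal ρ.toNNReal f := by
    intro x y
    rw [edist_eq_enorm_sub, edist_eq_enorm_sub, Real.coe_toNNReal _ hρ, ← ofReal_norm,
      ← ofReal_norm, ENNReal.ofReal_rpow_of_nonneg (norm_nonneg _) hρ]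
    change _ ≤ ENNReal.ofReal K * _
    rw [← ENNReal.ofReal_mul hK]
    exact ENNReal.ofReal_le_ofReal (hf x y)
  exact this.eHolderNorm_le

theorem iSup_enorm_le {E F : Type*} [NormedAddCommGroup F] {K : ℝ} {f : E → F}
    (hf : ∀ x, ‖f x‖ ≤ K) : ⨆ x, ‖f x‖ₑ ≤ ENNReal.ofReal K :=
  iSup_le fun x => by rw [← ofReal_norm]; exact ENNReal.ofReal_le_ofReal (hf x)

theorem continuous_of_holder {E F : Type*} [NormedAddCommGroup E] [NormedAddCommGroup F]
    {ρ K : ℝ} (hρ : 0 < ρ) {f : E → F} (hf : ∀ x y, ‖f x - f y‖ ≤ K * ‖x - y‖ ^ ρ) :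
    Continuous f := by
  rw [continuous_iff_continuousAt]
  intro x
  rw [ContinuousAt, tendsto_iff_norm_sub_tendsto_zero]
  have h : Tendsto (fun y => K * ‖y - x‖ ^ ρ) (𝓝 x) (𝓝 0) := by
    have h1 : Tendsto (fun y => ‖y - x‖) (𝓝 x) (𝓝 0) :=
      tendsto_iff_norm_sub_tendsto_zero.mp tendsto_id
    have h2 := (h1.rpow_const (Or.inr hρ.le)).const_mul K
    rwa [Real.zero_rpow hρ.ne', mul_zero] at h2
  exact squeeze_zero (fun _ => norm_nonneg _) (fun y => hf y x) h

theorem isGLipschitz_of_bounds {ρ K : ℝ} (hρ : 0 < ρ) (hρ1 : ρ < 1) {f : E → F}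
    (hb : ∀ x, ‖f x‖ ≤ K) (hf : ∀ x y, ‖f x - f y‖ ≤ K * ‖x - y‖ ^ ρ) :
    IsGLipschitz ρ f ∧ eLipNorm ρ f ≤ ENNReal.ofReal (2 * K) := by
  have hK : 0 ≤ K := (norm_nonneg _).trans (hb 0)
  have hfl : ⌊ρ⌋₊ = 0 := Nat.floor_eq_zero.mpr hρ1
  have hfr : Int.fract ρ = ρ := Int.fract_eq_self.mpr ⟨hρ.le, hρ1⟩
  have h : eLipNorm ρ f ≤ ENNReal.ofReal (2 * K) := by
    rw [eLipNorm, hfl, hfr, two_mul, ENNReal.ofReal_add hK hK, eCkNorm]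
    refine add_le_add ?_ (eHolderNorm_le_of_bound hρ.le hK fun x y => ?_)
    · rw [zero_add, Finset.sum_range_one]
      exact iSup_enorm_le fun x => by rw [norm_iteratedFDeriv_zero]; exact hb x
    · rw [norm_iteratedFDeriv_zero_sub]; exact hf x y
  refine ⟨⟨?_, h.trans_lt ENNReal.ofReal_lt_top⟩, h⟩
  rw [hfl]
  exact contDiff_zero.mpr (continuous_of_holder hρ hf)

theorem isGLipschitz_one_add_of_bounds {ρ K : ℝ} (hρ : 0 < ρ) (hρ1 : ρ < 1) {f : E → F}
    (hd : Differentiable ℝ f) (hb : ∀ x, ‖f x‖ ≤ K) (hb' : ∀ x, ‖fderiv ℝ f x‖ ≤ K)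
    (hf : ∀ x y, ‖fderiv ℝ f x - fderiv ℝ f y‖ ≤ K * ‖x - y‖ ^ ρ) :
    IsGLipschitz (1 + ρ) f := by
  have hK : 0 ≤ K := (norm_nonneg _).trans (hb 0)
  have hfl : ⌊1 + ρ⌋₊ = 1 := by
    rw [Nat.floor_eq_iff (by linarith)]; constructor <;> push_cast <;> linarith
  have hfr : Int.fract (1 + ρ) = ρ := by
    rw [Int.fract_eq_iff]; exact ⟨hρ.le, hρ1, 1, by push_cast; ring⟩
  rw [IsGLipschitz, eLipNorm, hfl, hfr]
  refine ⟨?_, ENNReal.add_lt_top.mpr ⟨?_, ?_⟩⟩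
  · exact_mod_cast contDiff_one_iff_fderiv.mpr ⟨hd, continuous_of_holder hρ hf⟩
  · rw [eCkNorm, ENNReal.sum_lt_top]
    intro r hr
    have hr' : r = 0 ∨ r = 1 := by have := Finset.mem_range.mp hr; omega
    refine lt_of_le_of_lt (iSup_enorm_le (K := K) fun x => ?_) ENNReal.ofReal_lt_top
    rcases hr' with rfl | rfl
    · rw [norm_iteratedFDeriv_zero]; exact hb x
    · rw [norm_iteratedFDeriv_one]; exact hb' x
  · refine (eHolderNorm_le_of_bound hρ.le hK fun x y => ?_).trans_lt ENNReal.ofReal_lt_top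
    rw [norm_iteratedFDeriv_succ_sub, norm_iteratedFDeriv_zero_sub]
    exact hf x y

theorem eCkNorm_one_le {K : ℝ} {f : E → F} (hb : ∀ x, ‖f x‖ ≤ K)
    (hb' : ∀ x, ‖fderiv ℝ f x‖ ≤ K) : eCkNorm 1 f ≤ ENNReal.ofReal (2 * K) := by
  have hK : 0 ≤ K := (norm_nonneg _).trans (hb 0)
  rw [eCkNorm, Finset.sum_range_succ, Finset.sum_range_one, two_mul, ENNReal.ofReal_add hK hK]
  refine add_le_add (iSup_enorm_le fun x => ?_) (iSup_enorm_le fun x => ?_)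
  · rw [norm_iteratedFDeriv_zero]; exact hb x
  · rw [norm_iteratedFDeriv_one]; exact hb' x

end Regular

end RoughFlow

namespace RoughFlow

open TruncTensor

/-! ### Expansion of solutions and the composition estimate -/

theorem TruncTensor.ev_mul_swap {ℓ N : ℕ} {M : Type*} [AddCommGroup M] [Module ℝ M]
    (c : List (Fin ℓ) → M) (a b : TruncTensor ℓ N) :
    ev c (a * b) =
      ev (fun w => ev (fun v => if v.length + w.length ≤ N then c (v ++ w) else 0) a) b := by
  rw [ev_mul]
  simp only [ev_apply, Finset.smul_sum]
  rw [Finset.sum_comm]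
  exact Finset.sum_congr rfl fun w _ => Finset.sum_congr rfl fun v _ => smul_comm _ _ _

/-- Surplus powers of τ are traded for powers of R, so that error terms of various orders can be
compared although τ may exceed 1. -/
theorem rpow_le_pow_mul_rpow {τ R q q' : ℝ} {j : ℕ} (hτ : 0 ≤ τ) (hτR : τ ≤ R) (hR : 1 ≤ R)
    (hq : 0 ≤ q) (hqq : q ≤ q') (hj : q' - q ≤ j) : τ ^ q' ≤ R ^ j * τ ^ q := by
  have h1 : τ ^ q' = τ ^ (q' - q) * τ ^ q := by
    rw [← Real.rpow_add_of_nonneg hτ (by linarith) hq, sub_add_cancel]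
  rw [h1]
  refine mul_le_mul_of_nonneg_right ?_ (Real.rpow_nonneg hτ _)
  calc τ ^ (q' - q) ≤ R ^ (q' - q) := Real.rpow_le_rpow hτ hτR (by linarith)
    _ ≤ R ^ (j : ℝ) := Real.rpow_le_rpow_of_exponent_le hR hj
    _ = R ^ j := Real.rpow_natCast _ _

theorem pow_le_pow_mul_rpow {τ R q : ℝ} {k j : ℕ} (hτ : 0 ≤ τ) (hτR : τ ≤ R) (hR : 1 ≤ R)
    (hq : 0 ≤ q) (hqk : q ≤ k) (hj : k - q ≤ j) : τ ^ k ≤ R ^ j * τ ^ q := by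
  rw [← Real.rpow_natCast τ k]
  exact rpow_le_pow_mul_rpow hτ hτR hR hq hqk hj

/-- A family `F w` of fields indexed by words with its derivatives, and a drift `V`, with uniform
bounds on a set `S`. -/
structure IsWordSystem {ℓ : ℕ} {E : Type*} [NormedAddCommGroup E] [NormedSpace ℝ E] (N : ℕ)
    (M θ κ : ℝ) (S : Set E) (F : List (Fin ℓ) → E → E) (DF : List (Fin ℓ) → E → E →L[ℝ] E)
    (V : E → E) : Prop where
  nil : ∀ x, F [] x = x
  hasFDerivAt : ∀ w, w ≠ [] → w.length < N → ∀ x ∈ S, HasFDerivAt (F w) (DF w x) x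
  norm_le : ∀ w, w ≠ [] → w.length ≤ N → ∀ x ∈ S, ‖F w x‖ ≤ M
  norm_deriv_le : ∀ w, w ≠ [] → w.length < N → ∀ x ∈ S, ‖DF w x‖ ≤ M
  holder : ∀ w, w.length = N → ∀ x ∈ S, ∀ y ∈ S, ‖F w x - F w y‖ ≤ M * ‖x - y‖ ^ θ
  drift_norm_le : ∀ x ∈ S, ‖V x‖ ≤ M
  drift_holder : ∀ x ∈ S, ∀ y ∈ S, ‖V x - V y‖ ≤ M * ‖x - y‖ ^ κ

/-- The tensor `a` acts on the fields `F w` as a first-order operator, along the set `S`. -/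
def ActsAsDerivation {ℓ N : ℕ} {E : Type*} [NormedAddCommGroup E] [NormedSpace ℝ E] (m : ℕ)
    (S : Set E) (F : List (Fin ℓ) → E → E) (DF : List (Fin ℓ) → E → E →L[ℝ] E)
    (a : TruncTensor ℓ N) : Prop :=
  ∀ w : List (Fin ℓ), w ≠ [] → w.length < m → ∀ x ∈ S,
    ev (fun v => if v.length + w.length ≤ m then F (v ++ w) x else 0) a =
      DF w x (ev (fun v => if v.length + w.length ≤ m then F v x else 0) a)

/-- `y` is a solution on `[0,1]`, in `S`, of `y' = δ V(y) + ∑ a^w F_w(y)`. -/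
def IsPath {ℓ N : ℕ} {E : Type*} [NormedAddCommGroup E] [NormedSpace ℝ E]
    (S : Set E) (F : List (Fin ℓ) → E → E) (V : E → E) (δ : ℝ) (a : TruncTensor ℓ N)
    (y : ℝ → E) : Prop :=
  ∀ u ∈ Icc (0 : ℝ) 1, y u ∈ S ∧
    HasDerivWithinAt y (δ • V (y u) + ev (fun v => F v (y u)) a) (Icc 0 1) u

section

variable {ℓ N : ℕ} {E : Type*} [NormedAddCommGroup E] [NormedSpace ℝ E]
  {M θ κ K R τ δ δ' : ℝ} {S : Set E} {F : List (Fin ℓ) → E → E}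
  {DF : List (Fin ℓ) → E → E →L[ℝ] E} {V : E → E} {a : TruncTensor ℓ N} {y : ℝ → E}

theorem IsWordSystem.norm_field_le (h : IsWordSystem N M θ κ S F DF V) (hM : 0 ≤ M)
    (hτ : 0 ≤ τ) (hτR : τ ≤ R) (hR : 1 ≤ R)
    (ha : a ∈ filt ℓ N 1) (haK : ScaledBound K τ a) {x : E} (hx : x ∈ S) :
    ‖ev (fun v => F v x) a‖ ≤
      Fintype.card {w : List (Fin ℓ) // w.length ≤ N} * (K * (R ^ N * M * τ)) := by
  refine norm_ev_le haK (fun w hw => ?_) (by positivity)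
  have hw0 : w.1.length ≠ 0 := fun h => hw (ha w (by omega))
  have hwn : w.1 ≠ [] := fun h => hw0 (by rw [h]; rfl)
  have h1 := h.norm_le w.1 hwn w.2 x hx
  have h2 : τ ^ w.1.length ≤ R ^ N * τ := by
    have := pow_le_pow_mul_rpow (q := 1) (k := w.1.length) (j := N) hτ hτR hR zero_le_one
      (by exact_mod_cast Nat.one_le_iff_ne_zero.mpr hw0) (by
        have : (w.1.length : ℝ) ≤ N := by exact_mod_cast w.2
        linarith)
    rwa [Real.rpow_one] at this
  calc τ ^ w.1.length * ‖F w.1 x‖ ≤ (R ^ N * τ) * M :=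
        mul_le_mul h2 h1 (norm_nonneg _) (by positivity)
    _ = R ^ N * M * τ := by ring

/-- The tensor starts in degree one and δ ≤ Rτ, so the speed is O(τ). This displacement bound is
what turns Hölder continuity in space into powers of τ. -/
theorem IsPath.norm_sub_le (h : IsWordSystem N M θ κ S F DF V) (hM : 0 ≤ M)
    (hτ : 0 ≤ τ) (hτR : τ ≤ R) (hR : 1 ≤ R) (hδ : 0 ≤ δ) (hδτ : δ ≤ R * τ)
    (ha : a ∈ filt ℓ N 1) (haK : ScaledBound K τ a) (hy : IsPath S F V δ a y) :
    ∀ u ∈ Icc (0 : ℝ) 1, ‖y u - y 0‖ ≤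
      (R * M + Fintype.card {w : List (Fin ℓ) // w.length ≤ N} * (K * (R ^ N * M))) * τ := by
  intro u hu
  set C := (R * M + Fintype.card {w : List (Fin ℓ) // w.length ≤ N} * (K * (R ^ N * M))) * τ
    with hC
  have hK := haK.nonneg
  have hC0 : 0 ≤ C := by positivity
  have h1 := norm_image_sub_le_of_norm_deriv_le_segment' (f := y) (a := 0) (b := 1) (C := C)
    (fun u hu => (hy u hu).2) (fun u hu => by
      have hyS := (hy u (Ico_subset_Icc_self hu)).1
      refine (norm_add_le _ _).trans ?_
      have e1 := h.norm_field_le hM hτ hτR hR ha haK hyS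
      have e2 : ‖δ • V (y u)‖ ≤ R * τ * M := by
        rw [norm_smul, Real.norm_of_nonneg hδ]
        exact mul_le_mul hδτ (h.drift_norm_le _ hyS) (norm_nonneg _) (by positivity)
      rw [hC]
      linarith) u hu
  refine h1.trans ?_
  rw [sub_zero]
  exact mul_le_of_le_one_right hC0 hu.2

end

/-- Expansion of the time-one value of a path and of the fields along it. -/
theorem exists_path_expansion (ℓ N : ℕ) {M θ κ K R : ℝ} (hN : 1 ≤ N) (hM : 0 ≤ M)
    (hθ : 0 ≤ θ) (hθ1 : θ ≤ 1) (hκ : 0 ≤ κ) (hκ1 : κ ≤ 1) (hK : 0 ≤ K) (hR : 1 ≤ R) :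
    ∃ C : ℝ, 0 ≤ C ∧ ∀ {E : Type*} [NormedAddCommGroup E] [NormedSpace ℝ E]
      {S : Set E} {F : List (Fin ℓ) → E → E} {DF : List (Fin ℓ) → E → E →L[ℝ] E} {V : E → E}
      (_ : IsWordSystem N M θ κ S F DF V) {τ δ δ' : ℝ} (_ : 0 ≤ τ) (_ : τ ≤ R) (_ : 0 ≤ δ)
      (_ : δ ≤ δ') (_ : δ' ≤ R * τ) {a : TruncTensor ℓ N} (_ : a ∈ filt ℓ N 1)
      (_ : ScaledBound K τ a) (_ : ActsAsDerivation N S F DF a) {y : ℝ → E}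
      (_ : IsPath S F V δ a y),
      ‖y 1 - δ • V (y 0) - ev (fun v => F v (y 0)) (expo a)‖ ≤
          C * (τ ^ ((N : ℝ) + θ) + δ' * τ ^ κ) ∧
        ‖V (y 1) - V (y 0)‖ ≤ C * τ ^ κ ∧
        ∀ w : List (Fin ℓ), w ≠ [] → w.length ≤ N → τ ^ w.length * ‖F w (y 1) -
          ev (fun v => if v.length + w.length ≤ N then F (v ++ w) (y 0) else 0) (expo a)‖ ≤
          C * (τ ^ ((N : ℝ) + θ) + δ' * τ ^ κ) := by
  set W : ℝ := ((Fintype.card {w : List (Fin ℓ) // w.length ≤ N} : ℕ) : ℝ) with hW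
  have hW0 : 0 ≤ W := by rw [hW]; positivity
  set c₀ : ℝ := R * M + W * (K * (R ^ N * M)) with hc₀
  have hc₀0 : 0 ≤ c₀ := by positivity
  -- In this order: oscillation of the words of length N, oscillation of the drift, drift acting on
  -- nonempty words, and terms of total degree above N.
  set C₁ : ℝ := M * c₀ ^ θ + M * c₀ ^ κ + R ^ N * M * M + W * (K * (R ^ (N + 1) * M * M))
    with hC₁
  have hc₁ : 0 ≤ M * c₀ ^ θ := mul_nonneg hM (Real.rpow_nonneg hc₀0 _)
  have hc₂ : 0 ≤ M * c₀ ^ κ := mul_nonneg hM (Real.rpow_nonneg hc₀0 _)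
  have hc₃ : 0 ≤ R ^ N * M * M := by positivity
  have hc₄ : 0 ≤ W * (K * (R ^ (N + 1) * M * M)) := by positivity
  have hC₁0 : 0 ≤ C₁ := by positivity
  have hX1 : 1 ≤ (W * K + 1) ^ N := one_le_pow₀ (by nlinarith [mul_nonneg hW0 hK])
  refine ⟨(W * K + 1) ^ N * C₁, by positivity, ?_⟩
  intro E _ _ S F DF V h τ δ δ' hτ hτR hδ hδδ hδτ a ha haK hact y hy
  set x := y 0 with hx
  have hxS : x ∈ S := (hy 0 (by simp)).1
  set e₁ : ℝ := τ ^ ((N : ℝ) + θ) with he₁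
  set e₂ : ℝ := τ ^ κ with he₂
  have he₁0 : 0 ≤ e₁ := Real.rpow_nonneg hτ _
  have he₂0 : 0 ≤ e₂ := Real.rpow_nonneg hτ _
  have hδ'0 : 0 ≤ δ' := hδ.trans hδδ
  have hprod : 0 ≤ δ' * e₂ := mul_nonneg hδ'0 he₂0
  set η : ℝ := C₁ * (e₁ + δ' * e₂) with hη
  have hη0 : 0 ≤ η := by positivity
  have hdisp : ∀ u ∈ Icc (0 : ℝ) 1, ‖y u - x‖ ≤ c₀ * τ :=
    hy.norm_sub_le h hM hτ hτR hR hδ (hδδ.trans hδτ) ha haK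
  have hVd : ∀ u ∈ Icc (0 : ℝ) 1, ‖V (y u) - V x‖ ≤ M * c₀ ^ κ * e₂ := by
    intro u hu
    refine (h.drift_holder _ (hy u hu).1 _ hxS).trans ?_
    rw [mul_assoc, he₂, ← Real.mul_rpow hc₀0 hτ]
    exact mul_le_mul_of_nonneg_left (Real.rpow_le_rpow (norm_nonneg _) (hdisp u hu) hκ) hM
  -- The frozen drift is subtracted from the empty word, so that its equation only sees V(y_u) -
  -- V(x), of size τ^κ.
  set c : List (Fin ℓ) → ℝ → E :=
    fun w u => if w = [] then y u - (u * δ) • V x else F w (y u) with hc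
  set r : List (Fin ℓ) → ℝ → E := fun w u => if w = [] then δ • (V (y u) - V x) else
    δ • DF w (y u) (V (y u)) +
      DF w (y u) (ev (fun v => if v.length + w.length ≤ N then 0 else F v (y u)) a) with hr
  have hcne : ∀ w u, w ≠ [] → c w u = F w (y u) := fun w u hw => if_neg hw
  have key := word_expansion le_rfl hτ hη0 ha haK c r ?_ ?_ ?_
  · have hle : ∀ w : List (Fin ℓ), (W * K + 1) ^ (N - w.length) * η ≤
        (W * K + 1) ^ N * C₁ * (e₁ + δ' * e₂) := by
      intro w
      rw [hη, ← mul_assoc]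
      have : (W * K + 1) ^ (N - w.length) ≤ (W * K + 1) ^ N :=
        pow_le_pow_right₀ (by nlinarith [mul_nonneg hW0 hK]) (Nat.sub_le _ _)
      gcongr
    have hc0 : ∀ v : List (Fin ℓ), c v 0 = F v x := by
      intro v
      by_cases hv : v = []
      · rw [hc]; simp only [hv, if_true, zero_mul, zero_smul, sub_zero, h.nil]; exact hx.symm
      · exact hcne v 0 hv
    refine ⟨?_, ?_, fun w hw hwN => ?_⟩
    · have h1 := (key [] (Nat.zero_le _) 1 (by simp)).trans (hle [])
      simp only [List.length_nil, pow_zero, one_mul, add_zero, List.append_nil, one_smul,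
        hc0] at h1
      have e : c [] 1 = y 1 - δ • V x := by rw [hc]; simp
      rw [e] at h1
      refine le_trans (le_of_eq ?_) h1
      congr 2
      refine ev_congr fun v _ => ?_
      rw [if_pos v.2]
    · refine (hVd 1 (by simp)).trans (mul_le_mul_of_nonneg_right ?_ he₂0)
      have : M * c₀ ^ κ ≤ C₁ := by rw [hC₁]; linarith
      nlinarith
    · have h1 := (key w hwN 1 (by simp)).trans (hle w)
      simp only [hc0, one_smul] at h1
      rwa [hcne w 1 hw] at h1
  · intro w hw u hu
    have hwn : w ≠ [] := by rintro rfl; simp at hw; omega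
    rw [hcne w u hwn, hcne w 0 hwn, hw]
    have h1 : ‖F w (y u) - F w x‖ ≤ M * c₀ ^ θ * τ ^ θ := by
      refine (h.holder w hw _ (hy u hu).1 _ hxS).trans ?_
      rw [mul_assoc, ← Real.mul_rpow hc₀0 hτ]
      exact mul_le_mul_of_nonneg_left (Real.rpow_le_rpow (norm_nonneg _) (hdisp u hu) hθ) hM
    have h2 : e₁ = τ ^ N * τ ^ θ := by
      rw [he₁, Real.rpow_add_of_nonneg hτ (by positivity) hθ, Real.rpow_natCast]
    calc τ ^ N * ‖F w (y u) - F w x‖ ≤ τ ^ N * (M * c₀ ^ θ * τ ^ θ) :=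
          mul_le_mul_of_nonneg_left h1 (pow_nonneg hτ _)
      _ = M * c₀ ^ θ * e₁ := by rw [h2]; ring
      _ ≤ C₁ * e₁ := mul_le_mul_of_nonneg_right (by rw [hC₁]; linarith) he₁0
      _ ≤ η := by rw [hη]; exact mul_le_mul_of_nonneg_left (by linarith) hC₁0
  · intro w hw u hu
    obtain ⟨hyS, hyd⟩ := hy u hu
    by_cases hwn : w = []
    · subst hwn
      have h1 : HasDerivWithinAt (c []) (δ • V (y u) + ev (fun v => F v (y u)) a - δ • V x)
          (Icc 0 1) u := by
        have h2 : HasDerivWithinAt (fun u : ℝ => (u * δ) • V x) (δ • V x) (Icc 0 1) u := by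
          have h3 : HasDerivWithinAt (fun u : ℝ => u * δ) δ (Icc 0 1) u := by
            simpa using ((hasDerivAt_id u).mul_const δ).hasDerivWithinAt
          exact h3.smul_const (V x)
        exact hyd.sub h2
      refine h1.congr_deriv ?_
      have h4 : ev (fun v => if v.length + ([] : List (Fin ℓ)).length ≤ N then c (v ++ []) u else 0) a =
          ev (fun v => F v (y u)) a := by
        refine ev_congr fun v hv => ?_
        have hv0 : v.1.length ≠ 0 := fun h => hv (ha v (by omega))
        have hvn : v.1 ≠ [] := fun h => hv0 (by rw [h]; rfl)
        rw [List.append_nil, hcne _ _ hvn, if_pos]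
        exact v.2
      rw [h4, hr]
      simp only [if_true, smul_sub]
      abel
    · have h1 : HasDerivWithinAt (c w) (DF w (y u) (δ • V (y u) + ev (fun v => F v (y u)) a))
          (Icc 0 1) u := by
        have h2 := (h.hasFDerivAt w hwn hw _ hyS).comp_hasDerivWithinAt u hyd
        refine h2.congr_of_mem (fun u' _ => hcne w u' hwn) hu
      refine h1.congr_deriv ?_
      have h4 : ev (fun v => if v.length + w.length ≤ N then c (v ++ w) u else 0) a =
          ev (fun v => if v.length + w.length ≤ N then F (v ++ w) (y u) else 0) a := by
        refine ev_congr fun v _ => ?_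
        rw [hcne]
        simp [hwn]
      rw [h4, hact w hwn hw _ hyS, hr]
      simp only [if_neg hwn]
      rw [add_left_comm, ← map_add, ← ev_add, map_add, map_smul]
      congr 2
      refine ev_congr fun v _ => ?_
      split_ifs <;> simp
  · intro w hw u hu
    obtain ⟨hyS, -⟩ := hy u hu
    by_cases hwn : w = []
    · subst hwn
      rw [hr]
      simp only [if_true, List.length_nil, pow_zero, one_mul]
      rw [norm_smul, Real.norm_of_nonneg hδ]
      calc δ * ‖V (y u) - V x‖ ≤ δ' * (M * c₀ ^ κ * e₂) :=
            mul_le_mul hδδ (hVd u hu) (norm_nonneg _) hδ'0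
        _ = M * c₀ ^ κ * (δ' * e₂) := by ring
        _ ≤ C₁ * (δ' * e₂) := mul_le_mul_of_nonneg_right (by rw [hC₁]; linarith) hprod
        _ ≤ η := by rw [hη]; exact mul_le_mul_of_nonneg_left (by linarith) hC₁0
    · have hw1 : 1 ≤ w.length := List.length_pos_iff.mpr hwn
      have hwN : (w.length : ℝ) ≤ N := by exact_mod_cast hw.le
      rw [hr]
      simp only [if_neg hwn]
      have hD := h.norm_deriv_le w hwn hw _ hyS
      have h1 : ‖δ • DF w (y u) (V (y u))‖ ≤ δ' * (M * M) := by
        rw [norm_smul, Real.norm_of_nonneg hδ]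
        refine mul_le_mul hδδ ?_ (norm_nonneg _) hδ'0
        exact ((DF w (y u)).le_opNorm _).trans
          (mul_le_mul hD (h.drift_norm_le _ hyS) (norm_nonneg _) hM)
      -- For a nonempty word the weight τ^|w| already supplies the factor τ^κ, as κ ≤ 1 ≤ |w|; no
      -- oscillation of V is needed here.
      have h2 : τ ^ w.length ≤ R ^ N * e₂ :=
        pow_le_pow_mul_rpow hτ hτR hR hκ
          (hκ1.trans (by exact_mod_cast hw1)) (by linarith)
      have h3 : τ ^ w.length * ‖ev (fun v => if v.length + w.length ≤ N then 0 else F v (y u)) a‖ ≤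
          W * (K * (R ^ (N + 1) * M * e₁)) := by
        have e5 : τ ^ w.length * ‖ev (fun v => if v.length + w.length ≤ N then 0
            else F v (y u)) a‖ = ‖ev (fun v => τ ^ w.length •
              (if v.length + w.length ≤ N then 0 else F v (y u))) a‖ := by
          have := ev_comp (LinearMap.lsmul ℝ E (τ ^ w.length))
            (fun v => if v.length + w.length ≤ N then 0 else F v (y u)) a
          simp only [LinearMap.lsmul_apply] at this
          rw [this, norm_smul, Real.norm_of_nonneg (pow_nonneg hτ _)]
        rw [e5]
        refine norm_ev_le haK (fun v hv => ?_) (by positivity)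
        by_cases hvw : v.1.length + w.length ≤ N
        · rw [if_pos hvw, smul_zero, norm_zero, mul_zero]; positivity
        · rw [if_neg hvw, norm_smul, Real.norm_of_nonneg (pow_nonneg hτ _), ← mul_assoc,
            ← pow_add]
          have hvn : v.1 ≠ [] := by
            intro h; rw [h] at hvw; simp at hvw; omega
          -- The discarded terms have total degree at least N + 1 ≥ N + θ.
          have h5 : τ ^ (v.1.length + w.length) ≤ R ^ (N + 1) * e₁ := by
            have hv2 := v.2
            have k1 : ((N + 1 : ℕ) : ℝ) ≤ ((v.1.length + w.length : ℕ) : ℝ) := by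
              exact_mod_cast (by omega : N + 1 ≤ v.1.length + w.length)
            have k2 : ((v.1.length + w.length : ℕ) : ℝ) ≤ ((N + N : ℕ) : ℝ) := by
              exact_mod_cast (by omega : v.1.length + w.length ≤ N + N)
            push_cast at k1 k2
            refine pow_le_pow_mul_rpow hτ hτR hR (by positivity) ?_ ?_
            · push_cast; linarith
            · push_cast; linarith
          calc τ ^ (v.1.length + w.length) * ‖F v.1 (y u)‖ ≤ (R ^ (N + 1) * e₁) * M :=
                mul_le_mul h5 (h.norm_le _ hvn v.2 _ hyS) (norm_nonneg _) (by positivity)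
            _ = R ^ (N + 1) * M * e₁ := by ring
      have h4 : τ ^ w.length * ‖DF w (y u) (ev (fun v => if v.length + w.length ≤ N then 0
          else F v (y u)) a)‖ ≤ W * (K * (R ^ (N + 1) * M * M)) * e₁ := by
        calc τ ^ w.length * ‖DF w (y u) (ev (fun v => if v.length + w.length ≤ N then 0
              else F v (y u)) a)‖
            ≤ τ ^ w.length * (M * ‖ev (fun v => if v.length + w.length ≤ N then 0
              else F v (y u)) a‖) := by
              refine mul_le_mul_of_nonneg_left ?_ (pow_nonneg hτ _)
              exact ((DF w (y u)).le_opNorm _).trans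
                (mul_le_mul_of_nonneg_right hD (norm_nonneg _))
          _ = M * (τ ^ w.length * ‖ev (fun v => if v.length + w.length ≤ N then 0
              else F v (y u)) a‖) := by ring
          _ ≤ M * (W * (K * (R ^ (N + 1) * M * e₁))) := mul_le_mul_of_nonneg_left h3 hM
          _ = W * (K * (R ^ (N + 1) * M * M)) * e₁ := by ring
      have h6 : τ ^ w.length * ‖δ • DF w (y u) (V (y u))‖ ≤ R ^ N * M * M * (δ' * e₂) := by
        calc τ ^ w.length * ‖δ • DF w (y u) (V (y u))‖ ≤ (R ^ N * e₂) * (δ' * (M * M)) :=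
              mul_le_mul h2 h1 (norm_nonneg _) (by positivity)
          _ = R ^ N * M * M * (δ' * e₂) := by ring
      calc _ ≤ τ ^ w.length * (‖δ • DF w (y u) (V (y u))‖ +
            ‖DF w (y u) (ev (fun v => if v.length + w.length ≤ N then 0 else F v (y u)) a)‖) :=
            mul_le_mul_of_nonneg_left (norm_add_le _ _) (pow_nonneg hτ _)
        _ ≤ R ^ N * M * M * (δ' * e₂) + W * (K * (R ^ (N + 1) * M * M)) * e₁ := by
            rw [mul_add]; exact add_le_add h6 h4
        _ ≤ C₁ * (δ' * e₂) + C₁ * e₁ :=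
            add_le_add (mul_le_mul_of_nonneg_right (by rw [hC₁]; linarith) hprod)
              (mul_le_mul_of_nonneg_right (by rw [hC₁]; linarith) he₁0)
        _ = η := by rw [hη]; ring

/-- The composition of the solutions for `a₁` and `a₂` is close to the solution for `a₃` when
`exp a₁ exp a₂ = exp a₃`. -/
theorem exists_composition_bound (ℓ N : ℕ) {M θ κ K R : ℝ} (hN : 1 ≤ N) (hM : 0 ≤ M)
    (hθ : 0 ≤ θ) (hθ1 : θ ≤ 1) (hκ : 0 ≤ κ) (hκ1 : κ ≤ 1) (hK : 0 ≤ K) (hR : 1 ≤ R) :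
    ∃ C : ℝ, 0 ≤ C ∧ ∀ {E : Type*} [NormedAddCommGroup E] [NormedSpace ℝ E]
      {S : Set E} {F : List (Fin ℓ) → E → E} {DF : List (Fin ℓ) → E → E →L[ℝ] E} {V : E → E}
      (_ : IsWordSystem N M θ κ S F DF V) {τ δ₁ δ₂ : ℝ} (_ : 0 ≤ τ) (_ : τ ≤ R) (_ : 0 ≤ δ₁)
      (_ : 0 ≤ δ₂) (_ : δ₁ + δ₂ ≤ R * τ) {a₁ a₂ a₃ : TruncTensor ℓ N}
      (_ : a₁ ∈ filt ℓ N 1) (_ : a₂ ∈ filt ℓ N 1) (_ : a₃ ∈ filt ℓ N 1)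
      (_ : ScaledBound K τ a₁) (_ : ScaledBound K τ a₂) (_ : ScaledBound K τ a₃)
      (_ : ActsAsDerivation N S F DF a₁) (_ : ActsAsDerivation N S F DF a₂)
      (_ : ActsAsDerivation N S F DF a₃) (_ : expo a₁ * expo a₂ = expo a₃)
      {y z y' : ℝ → E} (_ : IsPath S F V δ₁ a₁ y) (_ : IsPath S F V δ₂ a₂ z)
      (_ : IsPath S F V (δ₁ + δ₂) a₃ y') (_ : z 0 = y 1) (_ : y' 0 = y 0),
      ‖z 1 - y' 1‖ ≤ C * (τ ^ ((N : ℝ) + θ) + (δ₁ + δ₂) * τ ^ κ) := by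
  obtain ⟨C, hC, hexp⟩ := exists_path_expansion ℓ N hN hM hθ hθ1 hκ hκ1 hK hR
  set W : ℝ := ((Fintype.card {w : List (Fin ℓ) // w.length ≤ N} : ℕ) : ℝ) with hW
  have hW0 : 0 ≤ W := by rw [hW]; positivity
  set K' : ℝ := ∑ n ∈ Finset.range (N + 1), (n.factorial : ℝ)⁻¹ * ((N + 1) * K) ^ n with hK'
  have hK'0 : 0 ≤ K' := Finset.sum_nonneg fun _ _ => by positivity
  refine ⟨C + C + C + W * (K' * C), by positivity, ?_⟩
  intro E _ _ S F DF V h τ δ₁ δ₂ hτ hτR hδ₁ hδ₂ hδ a₁ a₂ a₃ h1 h2 h3 hK1 hK2 hK3 hA1 hA2 hA3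
    hmul y z y' hy hz hy' hz0 hy0
  obtain ⟨p1, p2, p3⟩ := hexp h hτ hτR hδ₁ (by linarith : δ₁ ≤ δ₁ + δ₂) hδ h1 hK1 hA1 hy
  obtain ⟨q1, -, -⟩ := hexp h hτ hτR hδ₂ (by linarith : δ₂ ≤ δ₁ + δ₂) hδ h2 hK2 hA2 hz
  obtain ⟨r1, -, -⟩ := hexp h hτ hτR (by linarith) le_rfl hδ h3 hK3 hA3 hy'
  rw [hz0] at q1
  rw [hy0] at r1
  set x := y 0 with hx
  set η : ℝ := τ ^ ((N : ℝ) + θ) + (δ₁ + δ₂) * τ ^ κ with hη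
  have he₁ : 0 ≤ τ ^ ((N : ℝ) + θ) := Real.rpow_nonneg hτ _
  have he₂ : 0 ≤ τ ^ κ := Real.rpow_nonneg hτ _
  have he₃ : 0 ≤ (δ₁ + δ₂) * τ ^ κ := mul_nonneg (by linarith) he₂
  have hη0 : 0 ≤ η := by positivity
  -- `g w` is the expansion at x of F_w(y_1), and `d` records the drift of the first solution, which
  -- sits on the empty word only.
  set g : List (Fin ℓ) → E :=
    fun w => ev (fun v => if v.length + w.length ≤ N then F (v ++ w) x else 0) (expo a₁) with hg
  set d : List (Fin ℓ) → E := fun w => if w = [] then δ₁ • V x else 0 with hd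
  -- Chen's relation: expanding at x inside the expansion at y_1 pairs the fields at x with
  -- exp(a₁)exp(a₂).
  have hprod : ev (fun v => F v x) (expo a₃) = ev g (expo a₂) := by
    rw [← hmul, ev_mul_swap]
  have hdd : ev d (expo a₂) = δ₁ • V x := by
    rw [ev_apply, Finset.sum_eq_single ⟨[], Nat.zero_le _⟩]
    · rw [expo_apply_nil h2, one_smul, hd]; simp
    · intro v _ hv
      have : v.1 ≠ [] := fun h => hv (Subtype.ext h)
      rw [hd]; simp only [if_neg this, smul_zero]
    · simp
  have hmain : ‖ev (fun v => F v (y 1) - g v - d v) (expo a₂)‖ ≤ W * (K' * (C * η)) := by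
    refine norm_ev_le (hK2.expo hτ) (fun w _ => ?_) (by positivity)
    by_cases hw : w.1 = []
    · have e : F w.1 (y 1) - g w.1 - d w.1 =
          y 1 - δ₁ • V x - ev (fun v => F v x) (expo a₁) := by
        rw [hw, h.nil, hg, hd]
        simp only [if_true, List.length_nil, add_zero, List.append_nil]
        have : ev (fun v : List (Fin ℓ) => if v.length ≤ N then F v x else 0) (expo a₁) =
            ev (fun v => F v x) (expo a₁) := ev_congr fun v _ => if_pos v.2
        rw [this]; abel
      rw [e, hw, List.length_nil, pow_zero, one_mul]
      exact p1
    · have e : d w.1 = 0 := by rw [hd]; simp only [if_neg hw]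
      rw [e, sub_zero]
      exact p3 w.1 hw w.2
  rw [ev_sub, ev_sub, hdd, ← hprod] at hmain
  have hV : ‖δ₂ • (V (y 1) - V x)‖ ≤ C * η := by
    rw [norm_smul, Real.norm_of_nonneg hδ₂]
    calc δ₂ * ‖V (y 1) - V x‖ ≤ (δ₁ + δ₂) * (C * τ ^ κ) :=
          mul_le_mul (by linarith) p2 (norm_nonneg _) (by linarith)
      _ = C * ((δ₁ + δ₂) * τ ^ κ) := by ring
      _ ≤ C * η := mul_le_mul_of_nonneg_left (by rw [hη]; linarith) hC
  -- Errors of the expansions of z and y', variation of the drift between x and y_1, and error of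
  -- the expansions of the fields along y.
  have hsplit : z 1 - y' 1 = (z 1 - δ₂ • V (y 1) - ev (fun v => F v (y 1)) (expo a₂)) -
      (y' 1 - (δ₁ + δ₂) • V x - ev (fun v => F v x) (expo a₃)) + δ₂ • (V (y 1) - V x) +
      (ev (fun v => F v (y 1)) (expo a₂) - ev (fun v => F v x) (expo a₃) - δ₁ • V x) := by
    module
  rw [hsplit]
  calc _ ≤ ‖z 1 - δ₂ • V (y 1) - ev (fun v => F v (y 1)) (expo a₂)‖ +
        ‖y' 1 - (δ₁ + δ₂) • V x - ev (fun v => F v x) (expo a₃)‖ + ‖δ₂ • (V (y 1) - V x)‖ +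
        ‖ev (fun v => F v (y 1)) (expo a₂) - ev (fun v => F v x) (expo a₃) - δ₁ • V x‖ :=
        (norm_add_le _ _).trans (add_le_add_left ((norm_add_le _ _).trans
          (add_le_add_left (norm_sub_le _ _) _)) _)
    _ ≤ C * η + C * η + C * η + W * (K' * (C * η)) := by linarith
    _ = (C + C + C + W * (K' * C)) * η := by ring

end RoughFlow

namespace RoughFlow

/-! ### Existence theorems for ordinary differential equations on [0,1] -/

section ODE

variable {E : Type*} [NormedAddCommGroup E] [NormedSpace ℝ E]

/-- Global Picard–Lindelöf theorem on `[0,1]` for bounded Lipschitz time-dependent fields. -/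
theorem exists_solution_of_bounded_lipschitz [CompleteSpace E] {f : ℝ → E → E} {K M : ℝ≥0}
    (hK : ∀ t, LipschitzWith K (f t)) (hc : ∀ x, ContinuousOn (fun t => f t x) (Icc 0 1))
    (hM : ∀ t x, ‖f t x‖ ≤ M) (x : E) :
    ∃ y : ℝ → E, y 0 = x ∧ ∀ u ∈ Icc (0 : ℝ) 1, HasDerivWithinAt y (f u (y u)) (Icc 0 1) u := by
  -- In unit time a field bounded by M cannot leave the ball of radius M, so the local theorem on
  -- that ball covers the whole interval.
  have h : IsPicardLindelof f (tmin := 0) (tmax := 1) ⟨0, by simp⟩ x M 0 M K :=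
    { lipschitzOnWith := fun t _ => (hK t).lipschitzOnWith
      continuousOn := fun x _ => hc x
      norm_le := fun t _ x _ => hM t x
      mul_max_le := by simp }
  exact h.exists_eq_forall_mem_Icc_hasDerivWithinAt₀

theorem continuousOn_of_hasDerivWithinAt_Icc {y y' : ℝ → E}
    (h : ∀ u ∈ Icc (0 : ℝ) 1, HasDerivWithinAt y (y' u) (Icc 0 1) u) :
    ContinuousOn y (Icc 0 1) := fun u hu => (h u hu).continuousWithinAt

theorem hasDerivWithinAt_Ici_of_Icc {y : ℝ → E} {y' : E} {u : ℝ} (hu : u ∈ Ico (0 : ℝ) 1)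
    (h : HasDerivWithinAt y y' (Icc 0 1) u) : HasDerivWithinAt y y' (Ici u) u :=
  h.mono_of_mem_nhdsWithin (Icc_mem_nhdsGE_of_mem hu)

/-! ### Step functions -/

section Step

variable {M : ℝ} (n : ℕ) (w : ℕ → E)

theorem stronglyMeasurable_step {E : Type*} [NormedAddCommGroup E] (n : ℕ) (w : ℕ → E) :
    MeasureTheory.StronglyMeasurable (fun r : ℝ => w ⌊(n : ℝ) * r⌋₊) := by
  have h1 : MeasureTheory.StronglyMeasurable w := MeasureTheory.StronglyMeasurable.of_discrete
  exact h1.comp_measurable (Nat.measurable_floor.comp (measurable_const_mul _))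

variable {w}

theorem intervalIntegrable_step {E : Type*} [NormedAddCommGroup E] {M : ℝ} (n : ℕ) {w : ℕ → E}
    (hw : ∀ k, ‖w k‖ ≤ M) (a b : ℝ) :
    IntervalIntegrable (fun r : ℝ => w ⌊(n : ℝ) * r⌋₊) MeasureTheory.volume a b := by
  rw [intervalIntegrable_iff]
  refine MeasureTheory.IntegrableOn.of_bound (by simp)
    (stronglyMeasurable_step n w).aestronglyMeasurable M (MeasureTheory.ae_of_all _ fun r => hw _)

theorem norm_integral_step_sub_le (hw : ∀ k, ‖w k‖ ≤ M) (a b : ℝ) :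
    ‖(∫ r in (0 : ℝ)..b, w ⌊(n : ℝ) * r⌋₊) - ∫ r in (0 : ℝ)..a, w ⌊(n : ℝ) * r⌋₊‖ ≤
      M * |b - a| := by
  rw [intervalIntegral.integral_interval_sub_left (intervalIntegrable_step n hw _ _)
    (intervalIntegrable_step n hw _ _)]
  exact intervalIntegral.norm_integral_le_of_norm_le_const fun r _ => hw _

/-- The floor is right-continuous, hence so is the step function; right derivatives are all that
Gronwall's inequality requires. -/
theorem hasDerivWithinAt_integral_step [CompleteSpace E] (hw : ∀ k, ‖w k‖ ≤ M) {u : ℝ}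
    (hu : 0 ≤ u) :
    HasDerivWithinAt (fun b => ∫ r in (0 : ℝ)..b, w ⌊(n : ℝ) * r⌋₊) (w ⌊(n : ℝ) * u⌋₊)
      (Ici u) u := by
  have hcont : ContinuousWithinAt (fun r : ℝ => w ⌊(n : ℝ) * r⌋₊) (Ici u) u := by
    have h1 : ∀ᶠ r in 𝓝[≥] u, w ⌊(n : ℝ) * r⌋₊ = w ⌊(n : ℝ) * u⌋₊ := by
      have h2 : ∀ᶠ r in 𝓝[≥] u, (n : ℝ) * r < ⌊(n : ℝ) * u⌋₊ + 1 := by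
        have : Tendsto (fun r : ℝ => (n : ℝ) * r) (𝓝[≥] u) (𝓝 (n * u)) :=
          ((continuous_const.mul continuous_id).tendsto u).mono_left nhdsWithin_le_nhds
        exact this.eventually (gt_mem_nhds (Nat.lt_floor_add_one _))
      filter_upwards [h2, self_mem_nhdsWithin] with r hr hur
      congr 1
      rw [Nat.floor_eq_iff (mul_nonneg (Nat.cast_nonneg n) (hu.trans hur))]
      exact ⟨(Nat.floor_le (mul_nonneg (Nat.cast_nonneg n) hu)).trans
        (mul_le_mul_of_nonneg_left hur (Nat.cast_nonneg n)), hr⟩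
    exact (tendsto_congr' h1).mpr tendsto_const_nhds
  exact intervalIntegral.integral_hasDerivWithinAt_right (intervalIntegrable_step n hw _ _)
    (stronglyMeasurable_step n w).stronglyMeasurableAtFilter
    (hcont.mono Ioi_subset_Ici_self)

theorem integral_step_eq_sum [CompleteSpace E] (hn : 0 < n) (hw : ∀ k, ‖w k‖ ≤ M) (k : ℕ) :
    ∫ r in (0 : ℝ)..(k / n : ℝ), w ⌊(n : ℝ) * r⌋₊ =
      ∑ j ∈ Finset.range k, (1 / n : ℝ) • w j := by
  have hn' : (0 : ℝ) < n := by exact_mod_cast hn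
  induction k with
  | zero => simp
  | succ k ih =>
    rw [Finset.sum_range_succ, ← ih, ← intervalIntegral.integral_add_adjacent_intervals
      (intervalIntegrable_step n hw 0 (k / n : ℝ)) (intervalIntegrable_step n hw _ _)]
    congr 1
    have hle : (k / n : ℝ) ≤ ((k + 1 : ℕ) / n : ℝ) := by gcongr; simp
    have : ∫ r in (k / n : ℝ)..((k + 1 : ℕ) / n : ℝ), w ⌊(n : ℝ) * r⌋₊ =
        ∫ r in (k / n : ℝ)..((k + 1 : ℕ) / n : ℝ), w k := by
      refine intervalIntegral.integral_congr_ae ?_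
      have hne : ∀ᵐ r : ℝ, r ≠ ((k + 1 : ℕ) / n : ℝ) := by
        simp [MeasureTheory.ae_iff]
      filter_upwards [hne] with r hr hmem
      rw [uIoc_of_le hle] at hmem
      congr 1
      have h1 := hmem.1
      have h2 := lt_of_le_of_ne hmem.2 hr
      rw [div_lt_iff₀ hn'] at h1
      rw [lt_div_iff₀ hn'] at h2
      push_cast at h2
      rw [Nat.floor_eq_iff (by nlinarith [(Nat.cast_nonneg k : (0 : ℝ) ≤ k)])]
      constructor <;> linarith
    rw [this, intervalIntegral.integral_const]
    congr 1
    push_cast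
    field_simp
    ring

end Step

/-- Peano's theorem on `[0,1]` for the sum of a bounded Lipschitz field and of a bounded continuous
field mapping balls into compact sets. -/
theorem exists_solution_of_lipschitz_add_compact [CompleteSpace E] {A C : E → E} {L : ℝ≥0} {M : ℝ}
    (hA : LipschitzWith L A) (hAM : ∀ x, ‖A x‖ ≤ M) (hC : Continuous C) (hCM : ∀ x, ‖C x‖ ≤ M)
    (x : E) (hK : ∀ R : ℝ, ∃ K : Set E, IsCompact K ∧ MapsTo C (Metric.closedBall x R) K) :
    ∃ y : ℝ → E, y 0 = x ∧
      ∀ u ∈ Icc (0 : ℝ) 1, HasDerivWithinAt y (A (y u) + C (y u)) (Icc 0 1) u := by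
  have hM : 0 ≤ M := (norm_nonneg _).trans (hAM 0)
  have hWM : ∀ x, ‖A x + C x‖ ≤ 2 * M := fun x =>
    (norm_add_le _ _).trans (by linarith [hAM x, hCM x])
  obtain ⟨K, hKc, hKm⟩ := hK (2 * M)
  -- Nodes of the Euler scheme of step 1/(n+1). Below, `σ` is the frozen path, and `p` and `z` are
  -- the integrals of the two parts of the field along it, so that `p + z` is the Euler polygon.
  let q : ℕ → ℕ → E := fun n k =>
    Nat.rec x (fun _ z => z + (1 / (n + 1 : ℕ) : ℝ) • (A z + C z)) k
  have hq0 : ∀ n, q n 0 = x := fun n => rfl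
  have hqs : ∀ n k, q n (k + 1) = q n k + (1 / (n + 1 : ℕ) : ℝ) • (A (q n k) + C (q n k)) :=
    fun n k => rfl
  let σ : ℕ → ℝ → E := fun n r => q n ⌊((n + 1 : ℕ) : ℝ) * r⌋₊
  let p : ℕ → ℝ → E := fun n u => x + ∫ r in (0 : ℝ)..u, A (σ n r)
  let z : ℕ → ℝ → E := fun n u => ∫ r in (0 : ℝ)..u, C (σ n r)
  have hAw : ∀ n k, ‖A (q n k)‖ ≤ M := fun n k => hAM _
  have hCw : ∀ n k, ‖C (q n k)‖ ≤ M := fun n k => hCM _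
  have hpz : ∀ n u, p n u + z n u = x + ∫ r in (0 : ℝ)..u, (A (σ n r) + C (σ n r)) := by
    intro n u
    have := intervalIntegral.integral_add
      (intervalIntegrable_step (n + 1) (hAw n) 0 u) (intervalIntegrable_step (n + 1) (hCw n) 0 u)
    change x + _ + _ = _
    rw [this, add_assoc]
  have hgrid : ∀ n k : ℕ, p n ((k : ℝ) / (n + 1 : ℕ)) + z n ((k : ℝ) / (n + 1 : ℕ)) = q n k := by
    intro n k
    rw [hpz, integral_step_eq_sum (n + 1) (w := fun k => A (q n k) + C (q n k)) (by omega)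
      (fun k => hWM _) k]
    induction k with
    | zero => simp [hq0]
    | succ k ih => rw [Finset.sum_range_succ, ← add_assoc, ih, hqs]
  have hclose : ∀ n (u : ℝ), 0 ≤ u → ‖p n u + z n u - σ n u‖ ≤ 2 * M * (1 / ((n : ℝ) + 1)) := by
    intro n u hu
    have hn : (0 : ℝ) < ((n + 1 : ℕ) : ℝ) := by positivity
    change ‖p n u + z n u - q n ⌊((n + 1 : ℕ) : ℝ) * u⌋₊‖ ≤ _
    set k := ⌊((n + 1 : ℕ) : ℝ) * u⌋₊ with hk
    rw [← hgrid n k, hpz, hpz, add_sub_add_left_eq_sub]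
    have h1 := norm_integral_step_sub_le (n + 1) (w := fun k => A (q n k) + C (q n k))
      (fun k => hWM _) ((k : ℝ) / (n + 1 : ℕ)) u
    refine h1.trans ?_
    refine mul_le_mul_of_nonneg_left ?_ (by linarith)
    have h2 : (k : ℝ) ≤ ((n + 1 : ℕ) : ℝ) * u := Nat.floor_le (by positivity)
    have h3 : ((n + 1 : ℕ) : ℝ) * u < k + 1 := Nat.lt_floor_add_one _
    have h4 : (k : ℝ) / (n + 1 : ℕ) ≤ u := by rw [div_le_iff₀ hn]; linarith
    rw [abs_of_nonneg (by linarith)]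
    have h5 : u ≤ ((k : ℝ) + 1) / (n + 1 : ℕ) := by rw [le_div_iff₀ hn]; linarith
    rw [add_div] at h5
    push_cast at h5 ⊢
    linarith
  have hqball : ∀ n k : ℕ, k ≤ n + 1 → q n k ∈ Metric.closedBall x (2 * M) := by
    intro n k hk
    have hn : (0 : ℝ) < ((n + 1 : ℕ) : ℝ) := by positivity
    rw [mem_closedBall_iff_norm, ← hgrid n k, hpz, add_sub_cancel_left]
    have h1 := norm_integral_step_sub_le (n + 1) (w := fun k => A (q n k) + C (q n k))
      (fun k => hWM _) 0 ((k : ℝ) / (n + 1 : ℕ))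
    rw [intervalIntegral.integral_same, sub_zero, sub_zero] at h1
    refine h1.trans ?_
    rw [abs_of_nonneg (by positivity)]
    refine mul_le_of_le_one_right (by linarith) ?_
    rw [div_le_one hn]
    exact_mod_cast hk
  -- compactness of the integrals of the compact part
  set K' : Set E := closure (convexHull ℝ (insert 0 K)) with hK'
  have hK'c : IsCompact K' := by
    have h1 : TotallyBounded (convexHull ℝ (insert (0 : E) K)) := by
      rw [totallyBounded_convexHull]
      exact (hKc.insert 0).totallyBounded
    exact h1.closure.isCompact_of_isClosed isClosed_closure
  have hK'conv : Convex ℝ K' := (convex_convexHull ℝ _).closure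
  have hsub : insert (0 : E) K ⊆ K' := (subset_convexHull ℝ _).trans subset_closure
  -- The integral up to u is the mean over [0,1] of the integrand extended by zero beyond u, hence a
  -- barycentre of points of K and 0. This is why 0 is inserted before taking the hull.
  have hzK : ∀ n, ∀ u ∈ Icc (0 : ℝ) 1, z n u ∈ K' := by
    intro n u hu
    have hprob : MeasureTheory.IsProbabilityMeasure
        (MeasureTheory.volume.restrict (Ioc (0 : ℝ) 1)) := ⟨by simp⟩
    have h1 : z n u = ∫ r, (Ioc (0 : ℝ) u).indicator (fun r => C (σ n r)) r
        ∂(MeasureTheory.volume.restrict (Ioc (0 : ℝ) 1)) := by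
      change ∫ r in (0 : ℝ)..u, C (σ n r) = _
      rw [intervalIntegral.integral_of_le hu.1, MeasureTheory.setIntegral_indicator
        measurableSet_Ioc, inter_eq_right.mpr (Ioc_subset_Ioc_right hu.2)]
    rw [h1]
    refine hK'conv.integral_mem isClosed_closure ?_ ?_
    · rw [MeasureTheory.ae_restrict_iff' measurableSet_Ioc]
      refine MeasureTheory.ae_of_all _ fun r hr => hsub ?_
      by_cases hru : r ∈ Ioc (0 : ℝ) u
      · rw [indicator_of_mem hru]
        refine mem_insert_of_mem _ (hKm (hqball n _ ?_))
        refine Nat.floor_le_of_le ?_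
        exact mul_le_of_le_one_right (by positivity) hr.2
      · rw [indicator_of_notMem hru]
        exact mem_insert _ _
    · have h2 := intervalIntegrable_step (n + 1) (hCw n) 0 1
      rw [intervalIntegrable_iff, uIoc_of_le zero_le_one] at h2
      exact MeasureTheory.Integrable.indicator h2 measurableSet_Ioc
  have hzlip : ∀ n u v, ‖z n u - z n v‖ ≤ M * |u - v| := fun n u v =>
    norm_integral_step_sub_le (n + 1) (hCw n) v u
  have hzcont : ∀ n, Continuous (z n) := fun n =>
    (LipschitzWith.of_dist_le_mul (K := M.toNNReal) fun u v => by
      rw [dist_eq_norm, Real.dist_eq, Real.coe_toNNReal _ hM]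
      exact hzlip n u v).continuous
  let Z : ℕ → BoundedContinuousFunction (Icc (0 : ℝ) 1) E := fun n =>
    BoundedContinuousFunction.mkOfCompact ⟨fun u => z n u, (hzcont n).comp continuous_subtype_val⟩
  have hZ : ∀ n u, Z n u = z n u := fun n u => rfl
  have hcomp : IsCompact (closure (range Z)) := by
    refine BoundedContinuousFunction.arzela_ascoli K' hK'c (range Z) ?_ ?_
    · rintro _ u ⟨n, rfl⟩
      exact hzK n u u.2
    · intro u
      rw [Metric.equicontinuousAt_iff]
      intro ε hε
      refine ⟨ε / (M + 1), by positivity, ?_⟩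
      rintro v hv ⟨_, n, rfl⟩
      change dist (Z n u) (Z n v) < ε
      rw [hZ, hZ, dist_eq_norm]
      refine (hzlip n u v).trans_lt ?_
      rw [Subtype.dist_eq, Real.dist_eq, lt_div_iff₀ (by positivity)] at hv
      rw [abs_sub_comm]
      nlinarith [abs_nonneg ((v : ℝ) - u)]
  obtain ⟨Zl, -, φ, hφ, hlim⟩ := hcomp.tendsto_subseq (fun n => subset_closure (mem_range_self n))
  have hprojc : Continuous (projIcc (0 : ℝ) 1 zero_le_one) := continuous_projIcc
  let zl : ℝ → E := fun t => Zl (projIcc 0 1 zero_le_one t)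
  have hzlc : Continuous zl := Zl.continuous.comp hprojc
  -- The error with which `p (φ n)` solves the equation of the Lipschitz part driven by the limit
  -- `zl`: distance of the compact parts plus discretization error.
  let ε : ℕ → ℝ := fun n => L * (dist (Z (φ n)) Zl + 2 * M * (1 / ((φ n : ℝ) + 1)))
  have hε : Tendsto ε atTop (𝓝 0) := by
    have h1 : Tendsto (fun n => dist (Z (φ n)) Zl) atTop (𝓝 0) := tendsto_iff_dist_tendsto_zero.mp hlim
    have h2 : Tendsto (fun n => 2 * M * (1 / ((φ n : ℝ) + 1))) atTop (𝓝 0) := by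
      have := (tendsto_one_div_add_atTop_nhds_zero_nat (𝕜 := ℝ)).comp hφ.tendsto_atTop
      simpa using this.const_mul (2 * M)
    have h3 := (h1.add h2).const_mul (L : ℝ)
    rwa [add_zero, mul_zero] at h3
  -- the Lipschitz part, driven by the limit
  have hvlip : ∀ t, LipschitzWith L (fun y => A (y + zl t)) := by
    intro t
    have : LipschitzWith 1 (fun y : E => y + zl t) := LipschitzWith.of_dist_le_mul (by simp)
    have h := hA.comp this
    rwa [mul_one] at h
  obtain ⟨pl, hpl0, hpl⟩ := exists_solution_of_bounded_lipschitz (M := M.toNNReal) hvlip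
    (fun y => (hA.continuous.comp (continuous_const.add hzlc)).continuousOn)
    (fun t y => by rw [Real.coe_toNNReal _ hM]; exact hAM _) x
  have hplc := continuousOn_of_hasDerivWithinAt_Icc hpl
  have hzdist : ∀ n, ∀ u ∈ Icc (0 : ℝ) 1, dist (z n u) (zl u) ≤ dist (Z n) Zl := by
    intro n u hu
    have := BoundedContinuousFunction.dist_coe_le_dist (f := Z n) (g := Zl) ⟨u, hu⟩
    have e : zl u = Zl ⟨u, hu⟩ := by
      change Zl (projIcc 0 1 zero_le_one u) = _
      rw [projIcc_of_mem _ hu]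
    rw [e]
    exact this
  have hpdist : ∀ n, ∀ u ∈ Icc (0 : ℝ) 1, dist (p (φ n) u) (pl u) ≤ gronwallBound 0 L (ε n) u := by
    intro n u hu
    have h := dist_le_of_approx_trajectories_ODE (v := fun t y => A (y + zl t)) (K := L)
      (f := p (φ n)) (g := pl) (f' := fun u => A (σ (φ n) u)) (g' := fun u => A (pl u + zl u))
      (a := 0) (b := 1) (εf := ε n) (εg := 0) (δ := 0) hvlip ?_ ?_ ?_ hplc
      (fun t ht => hasDerivWithinAt_Ici_of_Icc ht (hpl t (Ico_subset_Icc_self ht)))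
      (fun t _ => by simp) ?_ u hu
    · simpa using h
    · have : Continuous (p (φ n)) := by
        refine continuous_const.add ?_
        exact (LipschitzWith.of_dist_le_mul (K := M.toNNReal) fun u v => by
          rw [dist_eq_norm, Real.dist_eq, Real.coe_toNNReal _ hM]
          exact norm_integral_step_sub_le (φ n + 1) (hAw (φ n)) v u).continuous
      exact this.continuousOn
    · intro t ht
      exact (hasDerivWithinAt_integral_step (φ n + 1) (hAw (φ n)) ht.1).const_add x
    · intro t ht
      have ht' := Ico_subset_Icc_self ht
      refine (hA.dist_le_mul _ _).trans ?_
      refine mul_le_mul_of_nonneg_left ?_ L.2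
      have h1 := hclose (φ n) t ht.1
      have h2 := hzdist (φ n) t ht'
      rw [dist_eq_norm] at h2 ⊢
      have e : σ (φ n) t - (p (φ n) t + zl t) =
          (z (φ n) t - zl t) - (p (φ n) t + z (φ n) t - σ (φ n) t) := by abel
      rw [e]
      exact (norm_sub_le _ _).trans (add_le_add h2 h1)
    · change dist (x + ∫ r in (0 : ℝ)..0, A (σ (φ n) r)) (pl 0) ≤ 0
      rw [intervalIntegral.integral_same, hpl0]; simp
  have hplim : ∀ u ∈ Icc (0 : ℝ) 1, Tendsto (fun n => p (φ n) u) atTop (𝓝 (pl u)) := by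
    intro u hu
    rw [tendsto_iff_dist_tendsto_zero]
    have h1 : Tendsto (fun n => gronwallBound 0 L (ε n) u) atTop (𝓝 0) := by
      have := ((gronwallBound_continuous_ε 0 L u).tendsto 0).comp hε
      rwa [gronwallBound_ε0_δ0] at this
    exact squeeze_zero (fun _ => dist_nonneg) (fun n => hpdist n u hu) h1
  have hzlim : ∀ u ∈ Icc (0 : ℝ) 1, Tendsto (fun n => z (φ n) u) atTop (𝓝 (zl u)) := by
    intro u hu
    rw [tendsto_iff_dist_tendsto_zero]
    exact squeeze_zero (fun _ => dist_nonneg) (fun n => hzdist (φ n) u hu)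
      (tendsto_iff_dist_tendsto_zero.mp hlim)
  have hσlim : ∀ u ∈ Icc (0 : ℝ) 1, Tendsto (fun n => σ (φ n) u) atTop (𝓝 (pl u + zl u)) := by
    intro u hu
    have h1 : Tendsto (fun n => p (φ n) u + z (φ n) u - σ (φ n) u) atTop (𝓝 0) := by
      have h2 : Tendsto (fun n => 2 * M * (1 / ((φ n : ℝ) + 1))) atTop (𝓝 0) := by
        have := (tendsto_one_div_add_atTop_nhds_zero_nat (𝕜 := ℝ)).comp hφ.tendsto_atTop
        simpa using this.const_mul (2 * M)
      exact squeeze_zero_norm (fun n => hclose (φ n) u hu.1) h2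
    have h3 := ((hplim u hu).add (hzlim u hu)).sub h1
    simpa using h3
  -- Clamping the time to [0,1] makes the limit continuous on the whole line, as needed to
  -- differentiate the integral at the endpoints.
  let yl : ℝ → E := fun t => pl (projIcc (0 : ℝ) 1 zero_le_one t) + zl t
  have hylc : Continuous yl :=
    (hplc.comp_continuous (continuous_subtype_val.comp hprojc) fun t => (projIcc 0 1 _ t).2).add hzlc
  have hyl : ∀ u ∈ Icc (0 : ℝ) 1, yl u = pl u + zl u := by
    intro u hu
    change pl (projIcc 0 1 zero_le_one u) + zl u = _
    rw [projIcc_of_mem _ hu]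
  -- The frozen paths converge pointwise and C is bounded and continuous, so dominated convergence
  -- identifies the compact part of the limit.
  have hzint : ∀ u ∈ Icc (0 : ℝ) 1, zl u = ∫ r in (0 : ℝ)..u, C (yl r) := by
    intro u hu
    refine tendsto_nhds_unique (hzlim u hu) ?_
    refine intervalIntegral.tendsto_integral_filter_of_dominated_convergence (fun _ => M) ?_ ?_ ?_ ?_
    · exact Eventually.of_forall fun n =>
        (stronglyMeasurable_step (φ n + 1) (fun k => C (q (φ n) k))).aestronglyMeasurable
    · exact Eventually.of_forall fun n => MeasureTheory.ae_of_all _ fun r _ => hCM _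
    · simp
    · refine MeasureTheory.ae_of_all _ fun r hr => ?_
      rw [uIoc_of_le hu.1] at hr
      have hr' : r ∈ Icc (0 : ℝ) 1 := ⟨hr.1.le, hr.2.trans hu.2⟩
      rw [hyl r hr']
      exact (hC.tendsto _).comp (hσlim r hr')
  refine ⟨yl, ?_, fun u hu => ?_⟩
  · rw [hyl 0 (by simp), hpl0, hzint 0 (by simp), intervalIntegral.integral_same, add_zero]
  · have h1 : HasDerivWithinAt (fun u => pl u + ∫ r in (0 : ℝ)..u, C (yl r))
        (A (pl u + zl u) + C (yl u)) (Icc 0 1) u := by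
      refine (hpl u hu).add ?_
      exact (intervalIntegral.integral_hasDerivAt_right ((hC.comp hylc).intervalIntegrable _ _)
        ((hC.comp hylc).stronglyMeasurableAtFilter _ _) (hC.comp hylc).continuousAt).hasDerivWithinAt
    rw [← hyl u hu] at h1
    exact h1.congr_of_mem (fun v hv => by rw [hyl v hv, hzint v hv]) hu

end ODE

end RoughFlow

namespace RoughFlow

/-! ### Radial retraction and Gronwall bounds -/

section Retraction

variable {F : Type*} [NormedAddCommGroup F] [NormedSpace ℝ F]

/-- The radial retraction onto the closed ball of radius `R`. -/
def radialRetraction (R : ℝ) (x : F) : F := (R / max R ‖x‖) • x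

theorem radialRetraction_of_norm_le {R : ℝ} (hR : 0 < R) {x : F} (hx : ‖x‖ ≤ R) :
    radialRetraction R x = x := by
  rw [radialRetraction, max_eq_left hx, div_self hR.ne', one_smul]

theorem norm_radialRetraction_le {R : ℝ} (hR : 0 < R) (x : F) :
    ‖radialRetraction R x‖ ≤ R ∧ ‖radialRetraction R x‖ ≤ ‖x‖ := by
  have hm : 0 < max R ‖x‖ := lt_max_of_lt_left hR
  rw [radialRetraction, norm_smul, Real.norm_of_nonneg (by positivity)]
  constructor
  · rw [div_mul_eq_mul_div, div_le_iff₀ hm]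
    exact mul_le_mul_of_nonneg_left (le_max_right _ _) hR.le
  · refine mul_le_of_le_one_left (norm_nonneg _) ?_
    rw [div_le_one hm]
    exact le_max_left _ _

/-- The factor 2 comes from two contributions of at most ‖x - y‖: the displacement at a fixed
scaling, and the change of the scaling. -/
theorem norm_radialRetraction_sub_le {R : ℝ} (hR : 0 < R) (x y : F) :
    ‖radialRetraction R x - radialRetraction R y‖ ≤ 2 * ‖x - y‖ := by
  set a := max R ‖x‖ with ha
  set b := max R ‖y‖ with hb
  have ha0 : 0 < a := lt_max_of_lt_left hR
  have hb0 : 0 < b := lt_max_of_lt_left hR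
  have hyb : ‖y‖ ≤ b := le_max_right _ _
  have hRa : R ≤ a := le_max_left _ _
  have hab : |b - a| ≤ ‖x - y‖ := by
    have h1 : |max R ‖y‖ - max R ‖x‖| ≤ |‖y‖ - ‖x‖| := by
      have := abs_max_sub_max_le_max R ‖y‖ R ‖x‖
      simpa using this
    refine h1.trans ?_
    rw [norm_sub_rev]
    exact abs_norm_sub_norm_le _ _
  have e : radialRetraction R x - radialRetraction R y =
      (R / a) • (x - y) + (R / a * ((b - a) / b)) • y := by
    rw [radialRetraction, radialRetraction, ← ha, ← hb]
    have : R / b = R / a - R / a * ((b - a) / b) := by field_simp; ring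
    rw [this]; module
  rw [e]
  have h1 : ‖(R / a) • (x - y)‖ ≤ ‖x - y‖ := by
    rw [norm_smul, Real.norm_of_nonneg (by positivity)]
    exact mul_le_of_le_one_left (norm_nonneg _) ((div_le_one ha0).mpr hRa)
  have h2 : ‖(R / a * ((b - a) / b)) • y‖ ≤ ‖x - y‖ := by
    rw [norm_smul, norm_mul, norm_div, norm_div, Real.norm_of_nonneg hR.le,
      Real.norm_of_nonneg ha0.le, Real.norm_of_nonneg hb0.le, Real.norm_eq_abs]
    have e1 : R / a ≤ 1 := (div_le_one ha0).mpr hRa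
    have e2 : ‖y‖ / b ≤ 1 := (div_le_one hb0).mpr hyb
    calc R / a * (|b - a| / b) * ‖y‖ = (R / a) * (|b - a| * (‖y‖ / b)) := by ring
      _ ≤ 1 * (‖x - y‖ * 1) := by gcongr
      _ = ‖x - y‖ := by ring
  linarith [norm_add_le ((R / a) • (x - y)) ((R / a * ((b - a) / b)) • y)]

end Retraction

theorem gronwallBound_le {δ K ε u : ℝ} (hδ : 0 ≤ δ) (hK : 0 ≤ K) (hε : 0 ≤ ε)
    (hu : u ∈ Icc (0 : ℝ) 1) : gronwallBound δ K ε u ≤ (δ + ε) * Real.exp K := by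
  refine (gronwallBound_mono hδ hε hK hu.2).trans ?_
  rcases hK.eq_or_lt with rfl | hK0
  · rw [gronwallBound_K0, Real.exp_zero]; linarith
  · rw [gronwallBound_of_K_ne_0 hK0.ne']
    beta_reduce
    rw [mul_one, add_mul]
    have h1 : Real.exp K - 1 ≤ K * Real.exp K := by
      have h2 := Real.add_one_le_exp (-K)
      have h3 : Real.exp (-K) * Real.exp K = 1 := by rw [← Real.exp_add]; simp
      nlinarith [Real.exp_pos K]
    have h4 : ε / K * (Real.exp K - 1) ≤ ε / K * (K * Real.exp K) :=
      mul_le_mul_of_nonneg_left h1 (by positivity)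
    have h5 : ε / K * (K * Real.exp K) = ε * Real.exp K := by field_simp
    linarith

/-! ### Flows of C^1 fields with Hölder derivative -/

section Flow

variable {E : Type*} [NormedAddCommGroup E] [NormedSpace ℝ E]

/-- `y` solves `y' = W(y)` on `[0,1]`. -/
def IsSolution (W : E → E) (y : ℝ → E) : Prop :=
  ∀ u ∈ Icc (0 : ℝ) 1, HasDerivWithinAt y (W (y u)) (Icc 0 1) u

/-- `J` solves `J' = W'(y) J` on `[0,1]` with `J_0 = Id`. -/
def IsLinearization (W' : E → E →L[ℝ] E) (y : ℝ → E) (J : ℝ → E →L[ℝ] E) : Prop :=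
  J 0 = ContinuousLinearMap.id ℝ E ∧
    ∀ u ∈ Icc (0 : ℝ) 1, HasDerivWithinAt J ((W' (y u)).comp (J u)) (Icc 0 1) u

/-- A bounded `C^1` field with bounded and `ρ`-Hölder derivative. -/
structure IsHolderField (M ρ : ℝ) (W : E → E) (W' : E → E →L[ℝ] E) : Prop where
  hasFDerivAt : ∀ x, HasFDerivAt W (W' x) x
  norm_le : ∀ x, ‖W x‖ ≤ M
  norm_deriv_le : ∀ x, ‖W' x‖ ≤ M
  holder : ∀ x y, ‖W' x - W' y‖ ≤ M * ‖x - y‖ ^ ρ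

variable {M ρ : ℝ} {W : E → E} {W' : E → E →L[ℝ] E}

theorem norm_le_of_linear_growth {F : Type*} [NormedAddCommGroup F] [NormedSpace ℝ F]
    {f f' : ℝ → F} {δ K ε : ℝ} (hδ : 0 ≤ δ) (hK : 0 ≤ K) (hε : 0 ≤ ε)
    (hf : ∀ u ∈ Icc (0 : ℝ) 1, HasDerivWithinAt f (f' u) (Icc 0 1) u) (h0 : ‖f 0‖ ≤ δ)
    (hb : ∀ u ∈ Icc (0 : ℝ) 1, ‖f' u‖ ≤ K * ‖f u‖ + ε) :
    ∀ u ∈ Icc (0 : ℝ) 1, ‖f u‖ ≤ (δ + ε) * Real.exp K := by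
  intro u hu
  have h := norm_le_gronwallBound_of_norm_deriv_right_le (continuousOn_of_hasDerivWithinAt_Icc hf)
    (fun x hx => hasDerivWithinAt_Ici_of_Icc hx (hf x (Ico_subset_Icc_self hx))) h0
    (fun x hx => hb x (Ico_subset_Icc_self hx)) u hu
  rw [sub_zero] at h
  exact h.trans (gronwallBound_le hδ hK hε hu)

theorem IsHolderField.norm_sub_le (hW : IsHolderField M ρ W W') (x y : E) :
    ‖W x - W y‖ ≤ M * ‖x - y‖ :=
  Convex.norm_image_sub_le_of_norm_hasFDerivWithin_le
    (fun z _ => (hW.hasFDerivAt z).hasFDerivWithinAt) (fun z _ => hW.norm_deriv_le z)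
    convex_univ (mem_univ y) (mem_univ x)

theorem IsHolderField.nonneg (hW : IsHolderField M ρ W W') : 0 ≤ M :=
  (norm_nonneg _).trans (hW.norm_le 0)

theorem IsHolderField.lipschitzWith (hW : IsHolderField M ρ W W') :
    LipschitzWith M.toNNReal W :=
  LipschitzWith.of_dist_le_mul fun x y => by
    rw [dist_eq_norm, dist_eq_norm, Real.coe_toNNReal _ hW.nonneg]
    exact hW.norm_sub_le x y

theorem IsHolderField.exists_solution [CompleteSpace E] (hW : IsHolderField M ρ W W') (x : E) :
    ∃ y : ℝ → E, y 0 = x ∧ IsSolution W y :=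
  exists_solution_of_bounded_lipschitz (f := fun _ => W) (M := M.toNNReal)
    (fun _ => hW.lipschitzWith) (fun _ => continuousOn_const)
    (fun _ x => by rw [Real.coe_toNNReal _ hW.nonneg]; exact hW.norm_le x) x

theorem IsHolderField.norm_solution_sub_le (hW : IsHolderField M ρ W W') {y y' : ℝ → E}
    (hy : IsSolution W y) (hy' : IsSolution W y') :
    ∀ u ∈ Icc (0 : ℝ) 1, ‖y u - y' u‖ ≤ ‖y 0 - y' 0‖ * Real.exp M := by
  intro u hu
  have := norm_le_of_linear_growth (f := fun u => y u - y' u) (norm_nonneg (y 0 - y' 0))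
    hW.nonneg le_rfl (fun u hu => (hy u hu).sub (hy' u hu)) le_rfl
    (fun u _ => by rw [add_zero]; exact hW.norm_sub_le _ _) u hu
  rwa [add_zero] at this

theorem IsHolderField.existsUnique_timeOneValue [CompleteSpace E] (hW : IsHolderField M ρ W W')
    (x : E) : ∃! z : E, IsTimeOneValue W x z := by
  obtain ⟨y, hy0, hy⟩ := hW.exists_solution x
  refine ⟨y 1, ⟨y, hy0, hy, rfl⟩, ?_⟩
  rintro z ⟨y', hy0', hy', rfl⟩
  have := hW.norm_solution_sub_le hy' hy 1 (by simp)
  rw [hy0, hy0', sub_self, norm_zero, zero_mul] at this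
  exact sub_eq_zero.mp (norm_le_zero_iff.mp this)

/-- The linear equation is unbounded in J, so J is first retracted onto the ball of radius exp(M)
and the bounded Lipschitz theorem applies. The retraction does not increase norms, so Gronwall keeps
the solution in that ball, where the retraction is inactive. -/
theorem IsHolderField.exists_linearization [CompleteSpace E] (hρ : 0 < ρ)
    (hW : IsHolderField M ρ W W') {y : ℝ → E} (hy : IsSolution W y) :
    ∃ J : ℝ → E →L[ℝ] E, IsLinearization W' y J := by
  set R := Real.exp M with hR
  have hR0 : 0 < R := Real.exp_pos _
  have hM := hW.nonneg
  have hW'c : Continuous W' := continuous_of_holder hρ hW.holder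
  have hyc : ContinuousOn y (Icc 0 1) := continuousOn_of_hasDerivWithinAt_Icc hy
  let f : ℝ → (E →L[ℝ] E) → (E →L[ℝ] E) := fun t J => (W' (y t)).comp (radialRetraction R J)
  have hLip : ∀ t, LipschitzWith (M * 2).toNNReal (f t) := by
    intro t
    refine LipschitzWith.of_dist_le_mul fun J J' => ?_
    rw [dist_eq_norm, dist_eq_norm, Real.coe_toNNReal _ (by positivity)]
    change ‖(W' (y t)).comp (radialRetraction R J) - (W' (y t)).comp (radialRetraction R J')‖ ≤ _
    rw [← ContinuousLinearMap.comp_sub, mul_assoc]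
    refine (ContinuousLinearMap.opNorm_comp_le _ _).trans ?_
    exact mul_le_mul (hW.norm_deriv_le _) (norm_radialRetraction_sub_le hR0 _ _)
      (norm_nonneg _) hM
  have hcont : ∀ J, ContinuousOn (fun t => f t J) (Icc 0 1) := by
    intro J
    exact (hW'c.comp_continuousOn hyc).clm_comp continuousOn_const
  have hbound : ∀ t J, ‖f t J‖ ≤ (M * R).toNNReal := by
    intro t J
    rw [Real.coe_toNNReal _ (by positivity)]
    refine (ContinuousLinearMap.opNorm_comp_le _ _).trans ?_
    exact mul_le_mul (hW.norm_deriv_le _) (norm_radialRetraction_le hR0 _).1 (norm_nonneg _) hM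
  obtain ⟨J, hJ0, hJ⟩ := exists_solution_of_bounded_lipschitz hLip hcont hbound
    (ContinuousLinearMap.id ℝ E)
  have hbd : ∀ u ∈ Icc (0 : ℝ) 1, ‖J u‖ ≤ R := by
    intro u hu
    have := norm_le_of_linear_growth (δ := 1) (K := M) (ε := 0) zero_le_one hM le_rfl hJ
      (by rw [hJ0]; exact ContinuousLinearMap.norm_id_le) (fun u _ => by
        rw [add_zero]
        refine (ContinuousLinearMap.opNorm_comp_le _ _).trans ?_
        exact mul_le_mul (hW.norm_deriv_le _) (norm_radialRetraction_le hR0 _).2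
          (norm_nonneg _) hM) u hu
    rwa [add_zero, one_mul] at this
  refine ⟨J, hJ0, fun u hu => ?_⟩
  have := hJ u hu
  change HasDerivWithinAt J ((W' (y u)).comp (radialRetraction R (J u))) _ _ at this
  rwa [radialRetraction_of_norm_le hR0 (hbd u hu)] at this

theorem IsLinearization.norm_le (hW : IsHolderField M ρ W W') {y : ℝ → E}
    {J : ℝ → E →L[ℝ] E} (hJ : IsLinearization W' y J) :
    ∀ u ∈ Icc (0 : ℝ) 1, ‖J u‖ ≤ Real.exp M := by
  intro u hu
  have := norm_le_of_linear_growth (δ := 1) (K := M) (ε := 0) zero_le_one hW.nonneg le_rfl hJ.2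
    (by rw [hJ.1]; exact ContinuousLinearMap.norm_id_le) (fun u _ => by
      rw [add_zero]
      refine (ContinuousLinearMap.opNorm_comp_le _ _).trans ?_
      exact mul_le_mul_of_nonneg_right (hW.norm_deriv_le _) (norm_nonneg _)) u hu
  rwa [add_zero, one_mul] at this

/-- The difference solves the first linear equation with forcing (W'(y) - W'(y'))J', which is Hölder
in the distance of the trajectories and hence in that of the starting points. -/
theorem IsLinearization.norm_sub_le (hρ : 0 ≤ ρ) (hρ1 : ρ ≤ 1) (hW : IsHolderField M ρ W W')
    {y y' : ℝ → E} (hy : IsSolution W y) (hy' : IsSolution W y') {J J' : ℝ → E →L[ℝ] E}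
    (hJ : IsLinearization W' y J) (hJ' : IsLinearization W' y' J') :
    ∀ u ∈ Icc (0 : ℝ) 1, ‖J u - J' u‖ ≤ M * Real.exp M ^ 3 * ‖y 0 - y' 0‖ ^ ρ := by
  intro u hu
  have hM := hW.nonneg
  have hE : 1 ≤ Real.exp M := Real.one_le_exp hM
  have hd : 0 ≤ ‖y 0 - y' 0‖ ^ ρ := Real.rpow_nonneg (norm_nonneg _) _
  have := norm_le_of_linear_growth (f := fun u => J u - J' u) (δ := 0) (K := M)
    (ε := M * Real.exp M ^ 2 * ‖y 0 - y' 0‖ ^ ρ) le_rfl hM (by positivity)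
    (fun u hu => (hJ.2 u hu).sub (hJ'.2 u hu)) (by rw [hJ.1, hJ'.1]; simp) (fun u hu => by
      have e : (W' (y u)).comp (J u) - (W' (y' u)).comp (J' u) =
          (W' (y u)).comp (J u - J' u) + (W' (y u) - W' (y' u)).comp (J' u) := by
        rw [ContinuousLinearMap.comp_sub, ContinuousLinearMap.sub_comp]; abel
      rw [e]
      refine (norm_add_le _ _).trans (add_le_add ?_ ?_)
      · refine (ContinuousLinearMap.opNorm_comp_le _ _).trans ?_
        exact mul_le_mul_of_nonneg_right (hW.norm_deriv_le _) (norm_nonneg _)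
      · refine (ContinuousLinearMap.opNorm_comp_le _ _).trans ?_
        have h1 : ‖W' (y u) - W' (y' u)‖ ≤ M * (‖y 0 - y' 0‖ ^ ρ * Real.exp M) := by
          refine (hW.holder _ _).trans (mul_le_mul_of_nonneg_left ?_ hM)
          calc ‖y u - y' u‖ ^ ρ ≤ (‖y 0 - y' 0‖ * Real.exp M) ^ ρ :=
                Real.rpow_le_rpow (norm_nonneg _) (hW.norm_solution_sub_le hy hy' u hu) hρ
            _ = ‖y 0 - y' 0‖ ^ ρ * Real.exp M ^ ρ :=
                Real.mul_rpow (norm_nonneg _) (Real.exp_pos _).le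
            _ ≤ ‖y 0 - y' 0‖ ^ ρ * Real.exp M := by
                refine mul_le_mul_of_nonneg_left ?_ hd
                calc Real.exp M ^ ρ ≤ Real.exp M ^ (1 : ℝ) :=
                      Real.rpow_le_rpow_of_exponent_le hE hρ1
                  _ = Real.exp M := Real.rpow_one _
        calc ‖W' (y u) - W' (y' u)‖ * ‖J' u‖
            ≤ (M * (‖y 0 - y' 0‖ ^ ρ * Real.exp M)) * Real.exp M :=
              mul_le_mul h1 (hJ'.norm_le hW u hu) (norm_nonneg _) (by positivity)
          _ = M * Real.exp M ^ 2 * ‖y 0 - y' 0‖ ^ ρ := by ring) u hu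
  refine this.trans (le_of_eq ?_)
  ring

theorem IsHolderField.norm_taylor_le (hρ : 0 ≤ ρ) (hW : IsHolderField M ρ W W') (a b : E) :
    ‖W b - W a - W' a (b - a)‖ ≤ M * ‖b - a‖ ^ ρ * ‖b - a‖ := by
  refine Convex.norm_image_sub_le_of_norm_hasFDerivWithin_le' (s := segment ℝ a b)
    (f' := W') (fun z _ => (hW.hasFDerivAt z).hasFDerivWithinAt) (fun z hz => ?_)
    (convex_segment a b) (left_mem_segment ℝ a b) (right_mem_segment ℝ a b)
  refine (hW.holder z a).trans (mul_le_mul_of_nonneg_left ?_ hW.nonneg)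
  refine Real.rpow_le_rpow (norm_nonneg _) ?_ hρ
  obtain ⟨t, ht, rfl⟩ := (segment_eq_image' ℝ a b).subset hz
  rw [add_sub_cancel_left, norm_smul, Real.norm_of_nonneg ht.1]
  exact mul_le_of_le_one_left (norm_nonneg _) ht.2

/-- The defect Y_{x'} - Y_x - J(x' - x) solves the linearized equation with forcing the Taylor
remainder of W, which is O(‖x' - x‖^{1+ρ}). -/
theorem IsHolderField.hasFDerivAt_timeOne (hρ : 0 < ρ) (hW : IsHolderField M ρ W W')
    {Y : E → ℝ → E} (hY0 : ∀ x, Y x 0 = x) (hY : ∀ x, IsSolution W (Y x)) {x : E}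
    {J : ℝ → E →L[ℝ] E} (hJ : IsLinearization W' (Y x) J) :
    HasFDerivAt (fun x => Y x 1) (J 1) x := by
  have hM := hW.nonneg
  set L := Real.exp M with hL
  have hL0 : 0 < L := Real.exp_pos _
  set C := M * L ^ ρ * L * L with hC
  have hC0 : 0 ≤ C := by
    have : 0 ≤ L ^ ρ := Real.rpow_nonneg hL0.le _
    positivity
  have key : ∀ x', ‖Y x' 1 - Y x 1 - J 1 (x' - x)‖ ≤ C * ‖x' - x‖ ^ ρ * ‖x' - x‖ := by
    intro x'
    have hd : 0 ≤ ‖x' - x‖ ^ ρ := Real.rpow_nonneg (norm_nonneg _) _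
    have hLρ : 0 ≤ L ^ ρ := Real.rpow_nonneg hL0.le _
    have hder : ∀ u ∈ Icc (0 : ℝ) 1, HasDerivWithinAt (fun u => Y x' u - Y x u - J u (x' - x))
        (W (Y x' u) - W (Y x u) - W' (Y x u) (J u (x' - x))) (Icc 0 1) u := by
      intro u hu
      have h1 : HasDerivWithinAt (fun u => J u (x' - x)) (W' (Y x u) (J u (x' - x))) (Icc 0 1) u := by
        have := (hJ.2 u hu).clm_apply (hasDerivWithinAt_const u (Icc (0 : ℝ) 1) (x' - x))
        simpa using this
      exact ((hY x' u hu).sub (hY x u hu)).sub h1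
    have := norm_le_of_linear_growth (δ := 0) (K := M) (ε := M * L ^ ρ * L * ‖x' - x‖ ^ ρ * ‖x' - x‖)
      le_rfl hM (by positivity) hder (by rw [hY0, hY0, hJ.1]; simp) (fun u hu => by
        have e : W (Y x' u) - W (Y x u) - W' (Y x u) (J u (x' - x)) =
            W' (Y x u) (Y x' u - Y x u - J u (x' - x)) +
            (W (Y x' u) - W (Y x u) - W' (Y x u) (Y x' u - Y x u)) := by
          rw [map_sub (W' (Y x u)) (Y x' u - Y x u) (J u (x' - x))]; abel
        rw [e]
        refine (norm_add_le _ _).trans (add_le_add ?_ ?_)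
        · exact ((W' (Y x u)).le_opNorm _).trans
            (mul_le_mul_of_nonneg_right (hW.norm_deriv_le _) (norm_nonneg _))
        · refine (hW.norm_taylor_le hρ.le _ _).trans ?_
          have h1 := hW.norm_solution_sub_le (hY x') (hY x) u hu
          rw [hY0, hY0] at h1
          have h2 : ‖Y x' u - Y x u‖ ^ ρ ≤ ‖x' - x‖ ^ ρ * L ^ ρ := by
            rw [← Real.mul_rpow (norm_nonneg _) hL0.le]
            exact Real.rpow_le_rpow (norm_nonneg _) h1 hρ.le
          calc M * ‖Y x' u - Y x u‖ ^ ρ * ‖Y x' u - Y x u‖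
              ≤ M * (‖x' - x‖ ^ ρ * L ^ ρ) * (‖x' - x‖ * L) := by gcongr
            _ = M * L ^ ρ * L * ‖x' - x‖ ^ ρ * ‖x' - x‖ := by ring) 1 (by simp)
    refine this.trans (le_of_eq ?_)
    rw [hC]; ring
  refine HasFDerivAt.of_isLittleO ?_
  rw [Asymptotics.isLittleO_iff]
  intro c hc
  have hlim : Tendsto (fun x' => C * ‖x' - x‖ ^ ρ) (𝓝 x) (𝓝 0) := by
    have h1 : Tendsto (fun x' => ‖x' - x‖) (𝓝 x) (𝓝 0) :=
      tendsto_iff_norm_sub_tendsto_zero.mp tendsto_id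
    have h2 := (h1.rpow_const (Or.inr hρ.le)).const_mul C
    rwa [Real.zero_rpow hρ.ne', mul_zero] at h2
  filter_upwards [hlim.eventually (gt_mem_nhds hc)] with x' hx'
  exact (key x').trans (mul_le_mul_of_nonneg_right hx'.le (norm_nonneg _))

/-- The flow map of a Hölder `C^1` field, with its differential, at time one. -/
theorem IsHolderField.exists_flow [CompleteSpace E] (hρ : 0 < ρ) (hρ1 : ρ ≤ 1)
    (hW : IsHolderField M ρ W W') {μ : E → E} (hμ : ∀ x, IsTimeOneValue W x (μ x)) :
    ∃ (Y : E → ℝ → E) (J : E → ℝ → E →L[ℝ] E),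
      (∀ x, Y x 0 = x ∧ Y x 1 = μ x ∧ IsSolution W (Y x) ∧ IsLinearization W' (Y x) (J x) ∧
        HasFDerivAt μ (J x 1) x ∧ ∀ u ∈ Icc (0 : ℝ) 1, ‖J x u‖ ≤ Real.exp M) ∧
      ∀ x x', ∀ u ∈ Icc (0 : ℝ) 1, ‖Y x u - Y x' u‖ ≤ ‖x - x'‖ * Real.exp M ∧
        ‖J x u - J x' u‖ ≤ M * Real.exp M ^ 3 * ‖x - x'‖ ^ ρ := by
  choose Y hY0 hY hY1 using hμ
  have hY' : ∀ x, IsSolution W (Y x) := hY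
  choose J hJ using fun x => hW.exists_linearization hρ (hY' x)
  have hμY : μ = fun x => Y x 1 := funext fun x => (hY1 x).symm
  refine ⟨Y, J, fun x => ⟨hY0 x, hY1 x, hY' x, hJ x, ?_, (hJ x).norm_le hW⟩,
    fun x x' u hu => ⟨?_, ?_⟩⟩
  · rw [hμY]
    exact hW.hasFDerivAt_timeOne hρ hY0 hY' (hJ x)
  · have := hW.norm_solution_sub_le (hY' x) (hY' x') u hu
    rwa [hY0, hY0] at this
  · have := (hJ x).norm_sub_le hρ.le hρ1 hW (hY' x) (hY' x') (hJ x') u hu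
    rwa [hY0, hY0] at this

end Flow

end RoughFlow

namespace RoughFlow

open TruncTensor

/-! ### Size of the logarithm of a rough path, and exponents -/

section LogTensor

variable {ℓ N : ℕ}

variable (N) in
/-- The logarithm `∑ Λ^I_{ts} e_{[I]}`. -/
def logTensor (Λ : ℝ → ℝ → List (Fin ℓ) → ℝ) (t s : ℝ) : TruncTensor ℓ N :=
  ∑ r ∈ Finset.Icc 1 N, ∑ I : Fin r → Fin ℓ,
    Λ t s (List.ofFn I) • (brk (List.ofFn I) : TruncTensor ℓ N)

theorem logTensor_mem_brkSpan (Λ : ℝ → ℝ → List (Fin ℓ) → ℝ) (t s : ℝ) :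
    logTensor N Λ t s ∈ brkSpan ℓ N :=
  Submodule.sum_mem _ fun _ _ => Submodule.sum_mem _ fun _ _ =>
    Submodule.smul_mem _ _ (brk_mem_brkSpan _)

theorem logTensor_mem_filt (Λ : ℝ → ℝ → List (Fin ℓ) → ℝ) (t s : ℝ) :
    logTensor N Λ t s ∈ filt ℓ N 1 := mem_filt_one_of_mem_brkSpan (logTensor_mem_brkSpan Λ t s)

theorem rpow_le_one_add {x q : ℝ} (hx : 0 ≤ x) (hq : 0 ≤ q) (hq1 : q ≤ 1) : x ^ q ≤ 1 + x := by
  rcases le_total x 1 with h | h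
  · exact (Real.rpow_le_one hx h hq).trans (by linarith)
  · calc x ^ q ≤ x ^ (1 : ℝ) := Real.rpow_le_rpow_of_exponent_le h hq1
      _ = x := Real.rpow_one x
      _ ≤ 1 + x := by linarith

/-- The logarithm of a rough path scales like the path. -/
theorem exists_scaledBound_logTensor {T p : ℝ} (hp : 2 ≤ p) {X : ℝ → TruncTensor ℓ ⌊p⌋₊}
    (hX : IsWeakGeometricRoughPath p T X) {Λ : ℝ → ℝ → List (Fin ℓ) → ℝ}
    (hΛ : IsLogCoordinates T X Λ) :
    ∃ K : ℝ, 0 ≤ K ∧ ∀ s t : ℝ, 0 ≤ s → s ≤ t → t ≤ T → ∀ τ : ℝ, (t - s) ^ (1 / p) ≤ τ →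
      ScaledBound K τ (logTensor ⌊p⌋₊ Λ t s) := by
  obtain ⟨⟨-, C, hC⟩, hG⟩ := hX
  have hN : 1 ≤ ⌊p⌋₊ := Nat.le_floor (by push_cast; linarith)
  -- The scalar component of the increment is 1, so the constant must be at least 1.
  obtain ⟨K', hK'⟩ := exists_scaledBound_log (ℓ := ℓ) hN (max C 1)
  refine ⟨max K' 0, le_max_right _ _, fun s t hs hst ht τ hτ => ?_⟩
  have hτ0 : 0 ≤ τ := (Real.rpow_nonneg (sub_nonneg.mpr hst) _).trans hτ
  refine ScaledBound.mono hτ0 (hK' τ hτ0 _ (logTensor_mem_filt Λ t s) fun w => ?_) (le_max_left _ _)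
  have hC0 : 0 ≤ max C 1 := le_max_of_le_right zero_le_one
  by_cases hw : w.1.length = 0
  · have hw' : w = ⟨[], Nat.zero_le _⟩ := Subtype.ext (List.length_eq_zero_iff.mp hw)
    rw [hw', expo_apply_nil (logTensor_mem_filt Λ t s)]
    simp
  · have e : expo (logTensor ⌊p⌋₊ Λ t s) = incr X t s := hΛ s t hs hst ht
    rw [e]
    -- The Hölder bound is only available for s < t; for s = t the increment is 1.
    rcases hst.eq_or_lt with rfl | hlt
    · rw [incr_self hG hs ht, one_apply, if_neg (fun h => hw (by rw [h]; rfl)), abs_zero]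
      positivity
    · have h0 : 0 ≤ t - s := sub_nonneg.mpr hst
      have h1 : (t - s) ^ ((w.1.length : ℝ) / p) = ((t - s) ^ (1 / p)) ^ w.1.length := by
        rw [← Real.rpow_natCast, ← Real.rpow_mul h0]
        congr 1; ring
      refine (hC s t hs hlt ht w (by omega)).trans ?_
      rw [h1]
      exact mul_le_mul (le_max_left _ _)
        (pow_le_pow_left₀ (Real.rpow_nonneg h0 _) hτ _) (by positivity) hC0

end LogTensor

/-- With τ = δ^{1/p} the two errors are δ^{γ/p} and δ^{1+κ/p}, and the surplus over δ^a is bounded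
by a power of T. The case δ = 0 is separate because of the conventions for powers of zero. -/
theorem exists_rpow_add_le {T p γ κ a : ℝ} (hT : 0 < T) (hp : 0 < p) (ha : 0 ≤ a)
    (haγ : a ≤ γ / p) (haκ : a ≤ 1 + κ / p) :
    ∃ C : ℝ, 0 ≤ C ∧ ∀ δ : ℝ, 0 ≤ δ → δ ≤ T →
      (δ ^ (1 / p)) ^ γ + δ * (δ ^ (1 / p)) ^ κ ≤ C * δ ^ a := by
  have key : ∀ b : ℝ, a ≤ b → ∀ δ : ℝ, 0 ≤ δ → δ ≤ T → δ ^ b ≤ T ^ (b - a) * δ ^ a := by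
    intro b hb δ hδ hδT
    have : δ ^ b = δ ^ (b - a) * δ ^ a := by
      rw [← Real.rpow_add_of_nonneg hδ (by linarith) ha, sub_add_cancel]
    rw [this]
    exact mul_le_mul_of_nonneg_right (Real.rpow_le_rpow hδ hδT (by linarith))
      (Real.rpow_nonneg hδ _)
  refine ⟨T ^ (γ / p - a) + T ^ (1 + κ / p - a) , by positivity, fun δ hδ hδT => ?_⟩
  rcases hδ.eq_or_lt with rfl | h0
  · have hγ : 0 ≤ γ := by
      have := ha.trans haγ
      by_contra h
      exact absurd (div_neg_of_neg_of_pos (not_le.mp h) hp) (not_lt.mpr this)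
    rw [Real.zero_rpow (by positivity), zero_mul, add_zero]
    rcases hγ.eq_or_lt with rfl | hγ0
    · have : a = 0 := le_antisymm (by simpa using haγ) ha
      subst this
      simp only [Real.rpow_zero, zero_div, sub_zero, mul_one]
      have := Real.rpow_pos_of_pos hT (1 + κ / p)
      linarith
    · rw [Real.zero_rpow hγ0.ne']
      exact mul_nonneg (by positivity) (Real.rpow_nonneg le_rfl _)
  · rw [← Real.rpow_mul hδ, ← Real.rpow_mul hδ]
    have e : δ * δ ^ (1 / p * κ) = δ ^ (1 + κ / p) := by
      rw [Real.rpow_add h0, Real.rpow_one]; congr 2; ring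
    have e' : 1 / p * γ = γ / p := by ring
    rw [e, e', add_mul]
    exact add_le_add (key _ haγ δ hδ hδT) (key _ haκ δ hδ hδT)

/-- Properties of words that hold for large constants hold with a common constant. -/
theorem exists_forall_word {ℓ : ℕ} (n : ℕ) {P : List (Fin ℓ) → ℝ → Prop}
    (hP : ∀ w M M', M ≤ M' → P w M → P w M') (h : ∀ w, w.length ≤ n → ∃ M, P w M) :
    ∃ M : ℝ, 0 ≤ M ∧ ∀ w, w.length ≤ n → P w M := by
  choose! f hf using h
  refine ⟨∑ w : {w : List (Fin ℓ) // w.length ≤ n}, |f w.1|,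
    Finset.sum_nonneg fun _ _ => abs_nonneg _, fun w hw => hP w (f w) _ ?_ (hf w hw)⟩
  exact (le_abs_self _).trans (Finset.single_le_sum
    (f := fun w : {w : List (Fin ℓ) // w.length ≤ n} => |f w.1|)
    (fun _ _ => abs_nonneg _) (Finset.mem_univ ⟨w, hw⟩))

/-! ### The approximate flow for a Lipschitz drift -/

section LipschitzCase

universe u
variable {E : Type u} [NormedAddCommGroup E] [NormedSpace ℝ E] {ℓ : ℕ}

theorem exists_isWordSystem {m : ℕ} {θ : ℝ} (hθ : 0 < θ) (hθ1 : θ ≤ 1) {Vs : Fin ℓ → E → E}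
    (hV : ∀ i, Regular θ m (Vs i)) {V : E → E} (hVb : ∃ M : ℝ, ∀ x, ‖V x‖ ≤ M)
    (hVl : ∃ K : ℝ≥0, LipschitzWith K V) :
    ∃ M : ℝ, 0 ≤ M ∧ IsWordSystem (m + 1) M θ 1 univ (fun w => wordDeriv Vs w (id : E → E))
      (fun w => fderiv ℝ (wordDeriv Vs w (id : E → E))) V := by
  obtain ⟨M₀, hM₀⟩ := hVb
  obtain ⟨K₀, hK₀⟩ := hVl
  obtain ⟨M, hM, hw⟩ := exists_forall_word (ℓ := ℓ) (m + 1) (P := fun w M => w ≠ [] →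
      (∀ x, ‖wordDeriv Vs w (id : E → E) x‖ ≤ M) ∧
      (w.length < m + 1 → Differentiable ℝ (wordDeriv Vs w (id : E → E)) ∧
        ∀ x, ‖fderiv ℝ (wordDeriv Vs w (id : E → E)) x‖ ≤ M) ∧
      (w.length = m + 1 → ∀ x y, ‖wordDeriv Vs w (id : E → E) x - wordDeriv Vs w (id : E → E) y‖ ≤
        M * ‖x - y‖ ^ θ))
    (fun w M M' hMM h hne => by
      obtain ⟨h1, h2, h3⟩ := h hne
      refine ⟨fun x => (h1 x).trans hMM, fun hl => ⟨(h2 hl).1, fun x => ((h2 hl).2 x).trans hMM⟩,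
        fun hl x y => (h3 hl x y).trans ?_⟩
      exact mul_le_mul_of_nonneg_right hMM (Real.rpow_nonneg (norm_nonneg _) _))
    (fun w hwl => by
      by_cases hne : w = []
      · exact ⟨0, fun h => absurd hne h⟩
      have hr := regular_wordDeriv hθ.le hθ1 hV w (m + 1 - w.length) hne (by omega)
      rcases hwl.eq_or_lt with hl | hl
      · rw [hl, Nat.sub_self] at hr
        obtain ⟨M, h1, h2⟩ := hr
        exact ⟨M, fun _ => ⟨h1, fun h => absurd hl (by omega), fun _ => h2⟩⟩
      · obtain ⟨k, hk⟩ : ∃ k, m + 1 - w.length = k + 1 := ⟨m - w.length, by omega⟩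
        rw [hk] at hr
        obtain ⟨⟨M, h1⟩, h2, h3⟩ := hr
        obtain ⟨M', -, h4⟩ := h3.exists_bound
        exact ⟨max M M', fun _ => ⟨fun x => (h1 x).trans (le_max_left _ _),
          fun _ => ⟨h2, fun x => (h4 x).trans (le_max_right _ _)⟩, fun h => absurd h (by omega)⟩⟩)
  have hpow : ∀ x y : E, 0 ≤ ‖x - y‖ ^ θ := fun x y => Real.rpow_nonneg (norm_nonneg _) _
  have hM₀' : 0 ≤ M₀ := (norm_nonneg _).trans (hM₀ 0)
  refine ⟨M + M₀ + K₀, by positivity, ?_⟩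
  have hle : M ≤ M + M₀ + K₀ := by have := K₀.2; change 0 ≤ (K₀ : ℝ) at this; linarith
  exact
    { nil := fun x => rfl
      hasFDerivAt := fun w hne hl x _ => (((hw w hl.le hne).2.1 hl).1 x).hasFDerivAt
      norm_le := fun w hne hl x _ => ((hw w hl hne).1 x).trans hle
      norm_deriv_le := fun w hne hl x _ => (((hw w hl.le hne).2.1 hl).2 x).trans hle
      holder := fun w hl x _ y _ => by
        have hne : w ≠ [] := by rintro rfl; simp at hl
        exact ((hw w hl.le hne).2.2 hl x y).trans (mul_le_mul_of_nonneg_right hle (hpow x y))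
      drift_norm_le := fun x _ => (hM₀ x).trans (by have := K₀.2; change 0 ≤ (K₀ : ℝ) at this; linarith)
      drift_holder := fun x _ y _ => by
        rw [Real.rpow_one]
        have := hK₀.dist_le_mul x y
        rw [dist_eq_norm, dist_eq_norm] at this
        exact this.trans (mul_le_mul_of_nonneg_right (by linarith) (norm_nonneg _)) }

theorem actsAsDerivation_univ {N : ℕ} {Vs : Fin ℓ → E → E} {n : ℕ} (hV : ∀ i, ContDiff ℝ n (Vs i))
    (hN : N ≤ n + 1) {a : TruncTensor ℓ N} (ha : a ∈ brkSpan ℓ N) :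
    ActsAsDerivation N univ (fun w => wordDeriv Vs w (id : E → E))
      (fun w => fderiv ℝ (wordDeriv Vs w (id : E → E))) a :=
  fun w _ _ x _ => ev_wordDeriv_eq hV le_rfl hN ha w x

/-- The time-one maps of the logarithmic equation form an approximate flow as soon as the word
fields and the drift satisfy the bounds of a word system. -/
theorem exists_approxFlow_bound {T p γ : ℝ} (hT : 0 < T) (hp : 2 ≤ p) (hpγ : p < γ)
    (hγ : γ < (⌊p⌋₊ : ℝ) + 1) {X : ℝ → TruncTensor ℓ ⌊p⌋₊} (hX : IsWeakGeometricRoughPath p T X)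
    {Λ : ℝ → ℝ → List (Fin ℓ) → ℝ} (hΛ : IsLogCoordinates T X Λ) {M κ a : ℝ} (hM : 0 ≤ M)
    (hκ : 0 ≤ κ) (hκ1 : κ ≤ 1) (ha : 0 ≤ a) (haγ : a ≤ γ / p) (haκ : a ≤ 1 + κ / p)
    {S : Set E} {F : List (Fin ℓ) → E → E} {DF : List (Fin ℓ) → E → E →L[ℝ] E} {V : E → E}
    (hF : IsWordSystem ⌊p⌋₊ M (γ - ⌊p⌋₊) κ S F DF V)
    (hD : ∀ b ∈ brkSpan ℓ ⌊p⌋₊, ActsAsDerivation ⌊p⌋₊ S F DF b) :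
    ∃ c : ℝ, 0 < c ∧ ∀ s u t : ℝ, 0 ≤ s → s ≤ u → u ≤ t → t ≤ T → ∀ y z y' : ℝ → E,
      IsPath S F V (u - s) (logTensor ⌊p⌋₊ Λ u s) y →
      IsPath S F V (t - u) (logTensor ⌊p⌋₊ Λ t u) z →
      IsPath S F V (t - s) (logTensor ⌊p⌋₊ Λ t s) y' → z 0 = y 1 → y' 0 = y 0 →
      ‖z 1 - y' 1‖ ≤ c * (t - s) ^ a := by
  have hp0 : 0 < p := by linarith
  have hN : 1 ≤ ⌊p⌋₊ := Nat.le_floor (by push_cast; linarith)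
  have hfl : (⌊p⌋₊ : ℝ) ≤ p := Nat.floor_le hp0.le
  obtain ⟨K, hK, hKL⟩ := exists_scaledBound_logTensor hp hX hΛ
  -- The choice of θ makes N + θ equal to γ. The constant R = 1 + T dominates τ and satisfies t - s
  -- ≤ Rτ.
  obtain ⟨C, hC, hcomp⟩ := exists_composition_bound ℓ ⌊p⌋₊ (M := M) (θ := γ - ⌊p⌋₊) (κ := κ)
    (K := K) (R := 1 + T) hN hM (by linarith) (by linarith) hκ hκ1 hK (by linarith)
  obtain ⟨C', hC', hpow⟩ := exists_rpow_add_le hT hp0 ha haγ haκ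
  refine ⟨C * C' + 1, by positivity, fun s u t hs hsu hut ht y z y' hy hz hy' hz0 hy0 => ?_⟩
  have hδ : 0 ≤ t - s := by linarith
  have hq0 : 0 ≤ 1 / p := by positivity
  have hq1 : 1 / p ≤ 1 := by rw [div_le_one hp0]; linarith
  have hτ : 0 ≤ (t - s) ^ (1 / p) := Real.rpow_nonneg hδ _
  have e : (u - s) + (t - u) = t - s := by ring
  have h1 : (t - s) ^ (1 / p) ≤ 1 + T := (rpow_le_one_add hδ hq0 hq1).trans (by linarith)
  have h2 : t - s ≤ (1 + T) * (t - s) ^ (1 / p) := by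
    have h3 : t - s = (t - s) ^ (1 - 1 / p) * (t - s) ^ (1 / p) := by
      rw [← Real.rpow_add_of_nonneg hδ (by linarith) hq0, sub_add_cancel, Real.rpow_one]
    have h4 := rpow_le_one_add hδ (q := 1 - 1 / p) (by linarith) (by linarith)
    calc t - s = (t - s) ^ (1 - 1 / p) * (t - s) ^ (1 / p) := h3
      _ ≤ (1 + T) * (t - s) ^ (1 / p) := mul_le_mul_of_nonneg_right (by linarith) hτ
  -- All three logarithms are measured with the scale τ of the whole interval.
  have hmono : ∀ s' t', s ≤ s' → s' ≤ t' → t' ≤ t → (t' - s') ^ (1 / p) ≤ (t - s) ^ (1 / p) :=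
    fun s' t' _ _ _ => Real.rpow_le_rpow (by linarith) (by linarith) hq0
  have hmul : expo (logTensor ⌊p⌋₊ Λ u s) * expo (logTensor ⌊p⌋₊ Λ t u) =
      expo (logTensor ⌊p⌋₊ Λ t s) := by
    have e1 : expo (logTensor ⌊p⌋₊ Λ u s) = incr X u s := hΛ s u hs hsu (hut.trans ht)
    have e2 : expo (logTensor ⌊p⌋₊ Λ t u) = incr X t u := hΛ u t (hs.trans hsu) hut ht
    have e3 : expo (logTensor ⌊p⌋₊ Λ t s) = incr X t s := hΛ s t hs (hsu.trans hut) ht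
    rw [e1, e2, e3, incr_mul_incr hX.2 (hs.trans hsu) (hut.trans ht)]
  rw [← e] at hy'
  have := hcomp hF hτ h1 (sub_nonneg.mpr hsu) (sub_nonneg.mpr hut) (by rw [e]; exact h2)
    (logTensor_mem_filt Λ u s) (logTensor_mem_filt Λ t u) (logTensor_mem_filt Λ t s)
    (hKL s u hs hsu (hut.trans ht) _ (hmono s u le_rfl hsu hut))
    (hKL u t (hs.trans hsu) hut ht _ (hmono u t hsu hut le_rfl))
    (hKL s t hs (hsu.trans hut) ht _ le_rfl)
    (hD _ (logTensor_mem_brkSpan Λ u s)) (hD _ (logTensor_mem_brkSpan Λ t u))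
    (hD _ (logTensor_mem_brkSpan Λ t s)) hmul hy hz hy' hz0 hy0
  rw [e, add_sub_cancel] at this
  have h5 := hpow (t - s) hδ (by linarith)
  calc ‖z 1 - y' 1‖ ≤ C * (C' * (t - s) ^ a) :=
        this.trans (mul_le_mul_of_nonneg_left h5 hC)
    _ ≤ (C * C' + 1) * (t - s) ^ a := by
        have := Real.rpow_nonneg hδ a
        nlinarith

theorem isPath_univ_of_isSolution {N : ℕ} {Vs : Fin ℓ → E → E} {n : ℕ}
    (hV : ∀ i, ContDiff ℝ n (Vs i)) (hN : N ≤ n + 1) {V : E → E}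
    {Λ : ℝ → ℝ → List (Fin ℓ) → ℝ} {t s : ℝ} {y : ℝ → E}
    (hy : IsSolution (logField N V Vs Λ t s) y) :
    IsPath univ (fun w => wordDeriv Vs w (id : E → E)) V (t - s) (logTensor N Λ t s) y := by
  intro u hu
  refine ⟨mem_univ _, ?_⟩
  have := hy u hu
  rwa [logField_eq hV hN] at this

/-- The composition bound with κ = 1. It compares arbitrary solutions with matching endpoints, so
any selection of time-one values is admissible. -/
theorem isApproxFlow_of_lipschitz {T p γ : ℝ} (hT : 0 < T) (hp : 2 ≤ p) (hpγ : p < γ)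
    (hγ : γ < (⌊p⌋₊ : ℝ) + 1) {X : ℝ → TruncTensor ℓ ⌊p⌋₊} (hX : IsWeakGeometricRoughPath p T X)
    {Λ : ℝ → ℝ → List (Fin ℓ) → ℝ} (hΛ : IsLogCoordinates T X Λ) {V : E → E}
    {Vs : Fin ℓ → E → E} (hVb : ∃ M : ℝ, ∀ x, ‖V x‖ ≤ M) (hVl : ∃ K : ℝ≥0, LipschitzWith K V)
    (hVs : ∀ i, IsGLipschitz (γ - 1) (Vs i)) {μ : ℝ → ℝ → E → E}
    (hμ : ∀ s t : ℝ, 0 ≤ s → s ≤ t → t ≤ T → ∀ x : E,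
      IsTimeOneValue (logField ⌊p⌋₊ V Vs Λ t s) x (μ t s x)) :
    IsApproxFlow T (min (1 + 1 / p) (γ / p)) μ := by
  have hp0 : 0 < p := by linarith
  have hfl : (⌊p⌋₊ : ℝ) ≤ p := Nat.floor_le hp0.le
  have hN : 1 ≤ ⌊p⌋₊ := Nat.le_floor (by push_cast; linarith)
  obtain ⟨m, hm⟩ : ∃ m, ⌊p⌋₊ = m + 1 := ⟨⌊p⌋₊ - 1, by omega⟩
  have hm' : (⌊p⌋₊ : ℝ) = m + 1 := by rw [hm]; push_cast; ring
  have hflo : ⌊γ - 1⌋₊ = m := by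
    rw [Nat.floor_eq_iff (by linarith)]; constructor <;> linarith
  have hfr : Int.fract (γ - 1) = γ - ⌊p⌋₊ := by
    rw [Int.fract_eq_iff]
    exact ⟨by linarith, by linarith, m, by rw [hm']; push_cast; ring⟩
  have hC : ∀ i, ContDiff ℝ m (Vs i) := fun i => by have := (hVs i).1; rwa [hflo] at this
  have hreg : ∀ i, Regular (γ - ⌊p⌋₊) m (Vs i) := fun i => by
    have := (hVs i).regular; rwa [hflo, hfr] at this
  obtain ⟨M, hM, hF⟩ := exists_isWordSystem (by linarith) (by linarith) hreg hVb hVl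
  rw [← hm] at hF
  have h1p : 0 < 1 / p := by positivity
  have hγp : 1 < γ / p := by rwa [one_lt_div hp0]
  refine ⟨lt_min (by linarith) hγp, ?_⟩
  obtain ⟨c, hc, hb⟩ := exists_approxFlow_bound hT hp hpγ hγ hX hΛ hM zero_le_one le_rfl
    (a := min (1 + 1 / p) (γ / p)) (le_min (by positivity) (by positivity)) (min_le_right _ _)
    (min_le_left _ _) hF (fun b hb => actsAsDerivation_univ hC (by omega) hb)
  refine ⟨c, hc, fun s u t hs hsu hut ht x => ?_⟩
  obtain ⟨y, hy0, hy, hy1⟩ := hμ s u hs hsu (hut.trans ht) x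
  obtain ⟨z, hz0, hz, hz1⟩ := hμ u t (hs.trans hsu) hut ht (μ u s x)
  obtain ⟨y', hy0', hy', hy1'⟩ := hμ s t hs (hsu.trans hut) ht x
  rw [← hz1, ← hy1']
  exact hb s u t hs hsu hut ht y z y' (isPath_univ_of_isSolution hC (by omega) hy)
    (isPath_univ_of_isSolution hC (by omega) hz) (isPath_univ_of_isSolution hC (by omega) hy')
    (by rw [hz0, hy1]) (by rw [hy0, hy0'])

/-- The drift is the Lipschitz part and the combination of brackets the compact part in Peano's
theorem. Continuity and bounds of the latter are read on its expression by words, compactness on its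
expression by brackets. -/
theorem exists_isTimeOneValue_of_compactness [CompleteSpace E] {N m : ℕ} {θ : ℝ} (hθ : 0 < θ)
    (hθ1 : θ ≤ 1) (hm : N = m + 1) {V : E → E} {Vs : Fin ℓ → E → E}
    (hVb : ∃ M : ℝ, ∀ x, ‖V x‖ ≤ M) (hVl : ∃ K : ℝ≥0, LipschitzWith K V)
    (hVs : ∀ i, ContDiff ℝ m (Vs i)) (hreg : ∀ i, Regular θ m (Vs i))
    (hcomp : CompactnessCondition N Vs) (Λ : ℝ → ℝ → List (Fin ℓ) → ℝ) {s t : ℝ} (hst : s ≤ t)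
    (x : E) : ∃ z, IsTimeOneValue (logField N V Vs Λ t s) x z := by
  obtain ⟨M, hM, hF⟩ := exists_isWordSystem hθ hθ1 hreg hVb hVl
  rw [← hm] at hF
  obtain ⟨K, hK⟩ := hVl
  set Cf : E → E := fun y => ∑ r ∈ Finset.Icc 1 N, ∑ I : Fin r → Fin ℓ,
    Λ t s (List.ofFn I) • vbrk Vs (List.ofFn I) y with hCf
  have hev : ∀ y, Cf y = ev (fun v => wordDeriv Vs v (id : E → E) y) (logTensor N Λ t s) := by
    intro y
    have := logField_eq hVs (N := N) (by omega) V Λ t s y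
    unfold logField at this
    exact add_left_cancel this
  have hL := logTensor_mem_filt (N := N) Λ t s
  have hne : ∀ w : {w : List (Fin ℓ) // w.length ≤ N}, logTensor N Λ t s w ≠ 0 → w.1 ≠ [] :=
    fun w hw h => hw (hL w (by rw [h]; simp))
  have hCc : Continuous Cf := by
    have : Cf = fun y => ∑ w : {w : List (Fin ℓ) // w.length ≤ N},
        logTensor N Λ t s w • wordDeriv Vs w.1 (id : E → E) y := by
      funext y; rw [hev, ev_apply]
    rw [this]
    refine continuous_finsetSum _ fun w _ => ?_
    by_cases hw : logTensor N Λ t s w = 0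
    · simp only [hw, zero_smul]; exact continuous_const
    refine Continuous.const_smul ?_ _
    exact (contDiff_wordDeriv hVs contDiff_id (n := N) w.1 0 (by have := w.2; omega)
      (by have := w.2; omega)).continuous
  have hCb : ∀ y, ‖Cf y‖ ≤ ∑ w : {w : List (Fin ℓ) // w.length ≤ N}, |logTensor N Λ t s w| * M := by
    intro y
    rw [hev, ev_apply]
    refine (norm_sum_le _ _).trans (Finset.sum_le_sum fun w _ => ?_)
    rw [norm_smul, Real.norm_eq_abs]
    by_cases hw : logTensor N Λ t s w = 0
    · rw [hw]; simp
    exact mul_le_mul_of_nonneg_left (hF.norm_le w.1 (hne w hw) w.2 y (mem_univ _)) (abs_nonneg _)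
  set B := ∑ w : {w : List (Fin ℓ) // w.length ≤ N}, |logTensor N Λ t s w| * M
  have hB : 0 ≤ B := Finset.sum_nonneg fun _ _ => by positivity
  have hAl : LipschitzWith ((t - s).toNNReal * K) fun y => (t - s) • V y := by
    refine LipschitzWith.of_dist_le_mul fun a b => ?_
    have := hK.dist_le_mul a b
    rw [dist_smul₀, NNReal.coe_mul, Real.coe_toNNReal _ (sub_nonneg.mpr hst),
      Real.norm_of_nonneg (sub_nonneg.mpr hst), mul_assoc]
    exact mul_le_mul_of_nonneg_left this (sub_nonneg.mpr hst)
  obtain ⟨y, hy0, hy⟩ := exists_solution_of_lipschitz_add_compact (A := fun y => (t - s) • V y)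
    (C := Cf) (M := (t - s) * M + B) hAl (fun y => by
      rw [norm_smul, Real.norm_of_nonneg (sub_nonneg.mpr hst)]
      have := mul_le_mul_of_nonneg_left (hF.drift_norm_le y (mem_univ _)) (sub_nonneg.mpr hst)
      linarith) hCc (fun y => (hCb y).trans (by
        have := mul_nonneg (sub_nonneg.mpr hst) hM
        linarith)) x (fun R => by
      have h1 : ∀ I : List (Fin ℓ), ∃ Kc : Set E, IsCompact Kc ∧ (1 ≤ I.length → I.length ≤ N →
          MapsTo (vbrk Vs I) (Metric.closedBall x R) Kc) := by
        intro I
        by_cases hI : 1 ≤ I.length ∧ I.length ≤ N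
        · obtain ⟨Kc, h, h'⟩ := hcomp I hI.1 hI.2 x R
          exact ⟨Kc, h, fun _ _ => h'⟩
        · exact ⟨∅, isCompact_empty, fun a b => absurd ⟨a, b⟩ hI⟩
      choose Kc hKc hKm using h1
      -- The compact set is the image of the product of the compact sets of the brackets under the
      -- linear combination with coefficients Λ.
      refine ⟨(fun f : (Σ r : Finset.Icc 1 N, (Fin r → Fin ℓ)) → E =>
        ∑ q, Λ t s (List.ofFn q.2) • f q) '' (pi univ fun q => Kc (List.ofFn q.2)),
        (isCompact_univ_pi fun q => hKc _).image (by fun_prop), fun y hy => ?_⟩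
      refine ⟨fun q => vbrk Vs (List.ofFn q.2) y, fun q _ => ?_, ?_⟩
      · have := Finset.mem_Icc.mp q.1.2
        exact hKm _ (by simpa using this.1) (by simpa using this.2) hy
      · rw [hCf]
        beta_reduce
        rw [Fintype.sum_sigma, ← Finset.sum_coe_sort (Finset.Icc 1 N)])
  exact ⟨y 1, y, hy0, hy, rfl⟩

end LipschitzCase

end RoughFlow

namespace RoughFlow

open TruncTensor

theorem TruncTensor.hasFDerivAt_ev {ℓ N : ℕ} {E G : Type*} [NormedAddCommGroup E]
    [NormedSpace ℝ E] [NormedAddCommGroup G] [NormedSpace ℝ G] {a : TruncTensor ℓ N}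
    {c : List (Fin ℓ) → E → G} {c' : List (Fin ℓ) → E →L[ℝ] G} {x : E}
    (h : ∀ w, a w ≠ 0 → HasFDerivAt (c w.1) (c' w.1) x) :
    HasFDerivAt (fun x => ev (fun w => c w x) a) (ev c' a) x := by
  simp only [ev_apply]
  refine HasFDerivAt.fun_sum fun w _ => ?_
  by_cases hw : a w = 0
  · simp only [hw, zero_smul]
    exact hasFDerivAt_const _ _
  · exact (h w hw).const_smul _

/-! ### Word fields with one extra derivative -/

section WordFields

universe u
variable {E : Type u} [NormedAddCommGroup E] [NormedSpace ℝ E] {ℓ N : ℕ}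

/-- The field `V_{i_1} ⋯ V_{i_r} Id`. -/
abbrev wordField (Vs : Fin ℓ → E → E) (w : List (Fin ℓ)) : E → E := wordDeriv Vs w (id : E → E)

theorem regular_const {θ : ℝ} {F : Type u} [NormedAddCommGroup F] [NormedSpace ℝ F] (k : ℕ)
    (c : F) : Regular θ k (fun _ : E => c) := by
  induction k generalizing F with
  | zero =>
    refine ⟨‖c‖, fun _ => le_rfl, fun x y => ?_⟩
    rw [sub_self, norm_zero]
    exact mul_nonneg (norm_nonneg _) (Real.rpow_nonneg (norm_nonneg _) _)
  | succ k ih =>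
    refine ⟨⟨‖c‖, fun _ => le_rfl⟩, differentiable_const c, ?_⟩
    have : fderiv ℝ (fun _ : E => c) = fun _ => 0 := by funext x; exact fderiv_const_apply c
    rw [this]
    exact ih 0

variable {Vs : Fin ℓ → E → E}

theorem contDiff_wordField (hV : ∀ i, ContDiff ℝ N (Vs i)) (w : List (Fin ℓ)) (k : ℕ)
    (h : k + w.length ≤ N + 1) : ContDiff ℝ k (wordField Vs w) :=
  contDiff_wordDeriv hV contDiff_id (n := N + 1) w k h h

theorem differentiable_wordField (hV : ∀ i, ContDiff ℝ N (Vs i)) {w : List (Fin ℓ)}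
    (h : w.length ≤ N) : Differentiable ℝ (wordField Vs w) :=
  (contDiff_wordField hV w 1 (by omega)).differentiable (by simp)

theorem differentiable_fderiv_wordField (hV : ∀ i, ContDiff ℝ N (Vs i)) {w : List (Fin ℓ)}
    (h : w.length < N) : Differentiable ℝ (fderiv ℝ (wordField Vs w)) :=
  ((contDiff_wordField hV w 2 (by omega)).fderiv_right (m := 1) (by norm_num)).differentiable
    (by simp)

theorem fderiv_fderiv_wordField_symm (hV : ∀ i, ContDiff ℝ N (Vs i)) {w : List (Fin ℓ)}
    (h : w.length < N) (x : E) :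
    (fderiv ℝ (fderiv ℝ (wordField Vs w)) x).flip = fderiv ℝ (fderiv ℝ (wordField Vs w)) x := by
  have h2 := (contDiff_wordField hV w 2 (by omega)).contDiffAt (x := x)
  have := h2.isSymmSndFDerivAt (by simp)
  ext a b
  exact this b a

theorem regular_fderiv_wordField {θ : ℝ} (hθ : 0 ≤ θ) (hθ1 : θ ≤ 1)
    (hV : ∀ i, Regular θ N (Vs i)) (w : List (Fin ℓ)) (k : ℕ) (h : k + w.length ≤ N) :
    Regular θ k (fderiv ℝ (wordField Vs w)) := by
  by_cases hw : w = []
  · subst hw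
    have : fderiv ℝ (wordField Vs []) = fun _ => ContinuousLinearMap.id ℝ E := by
      funext x; exact fderiv_id
    rw [this]
    exact regular_const k _
  · have := regular_wordDeriv hθ hθ1 hV w (N - w.length + 1) hw (by omega)
    exact this.2.2.of_le hθ hθ1 (by omega)

/-- With N derivatives on the V_i, even words of length N have a Hölder derivative, and shorter ones
a bounded second derivative. The empty word, which gives the unbounded identity, is excluded only
from the bounds on the field itself. -/
theorem exists_wordField_bound {θ : ℝ} (hθ : 0 ≤ θ) (hθ1 : θ ≤ 1)
    (hV : ∀ i, Regular θ N (Vs i)) :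
    ∃ M : ℝ, 0 ≤ M ∧ ∀ w : List (Fin ℓ), w.length ≤ N →
      (w ≠ [] → (∀ x, ‖wordField Vs w x‖ ≤ M) ∧
        ∀ x y, ‖wordField Vs w x - wordField Vs w y‖ ≤ M * ‖x - y‖ ^ θ) ∧
      (∀ x, ‖fderiv ℝ (wordField Vs w) x‖ ≤ M) ∧
      (∀ x y, ‖fderiv ℝ (wordField Vs w) x - fderiv ℝ (wordField Vs w) y‖ ≤ M * ‖x - y‖ ^ θ) ∧
      (w.length < N → ∀ x, ‖fderiv ℝ (fderiv ℝ (wordField Vs w)) x‖ ≤ M) := by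
  refine exists_forall_word N (fun w M M' hMM h => ?_) fun w hw => ?_
  · have hp : ∀ x y : E, M * ‖x - y‖ ^ θ ≤ M' * ‖x - y‖ ^ θ := fun x y =>
      mul_le_mul_of_nonneg_right hMM (Real.rpow_nonneg (norm_nonneg _) _)
    exact ⟨fun hne => ⟨fun x => ((h.1 hne).1 x).trans hMM,
      fun x y => ((h.1 hne).2 x y).trans (hp x y)⟩, fun x => (h.2.1 x).trans hMM,
      fun x y => (h.2.2.1 x y).trans (hp x y), fun hl x => (h.2.2.2 hl x).trans hMM⟩
  · have h1 : ∃ M, w ≠ [] → (∀ x, ‖wordField Vs w x‖ ≤ M) ∧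
        ∀ x y, ‖wordField Vs w x - wordField Vs w y‖ ≤ M * ‖x - y‖ ^ θ := by
      by_cases hne : w = []
      · exact ⟨0, fun h => absurd hne h⟩
      · obtain ⟨M, h⟩ := (regular_wordDeriv hθ hθ1 hV w (N + 1 - w.length) hne (by omega)).of_le
          hθ hθ1 (Nat.zero_le _)
        exact ⟨M, fun _ => h⟩
    obtain ⟨M₁, h1⟩ := h1
    obtain ⟨M₂, h2, h2'⟩ := regular_fderiv_wordField hθ hθ1 hV w 0 (by omega)
    have h3 : ∃ M, w.length < N → ∀ x, ‖fderiv ℝ (fderiv ℝ (wordField Vs w)) x‖ ≤ M := by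
      by_cases hl : w.length < N
      · obtain ⟨M, -, h⟩ := (regular_fderiv_wordField hθ hθ1 hV w 1 (by omega)).2.2.exists_bound
        exact ⟨M, fun _ => h⟩
      · exact ⟨0, fun h => absurd h hl⟩
    obtain ⟨M₃, h3⟩ := h3
    have l1 : M₁ ≤ max (max M₁ M₂) M₃ := (le_max_left _ _).trans (le_max_left _ _)
    have l2 : M₂ ≤ max (max M₁ M₂) M₃ := (le_max_right _ _).trans (le_max_left _ _)
    have hp : ∀ {M} (_ : M ≤ max (max M₁ M₂) M₃) (x y : E),
        M * ‖x - y‖ ^ θ ≤ max (max M₁ M₂) M₃ * ‖x - y‖ ^ θ := fun h x y =>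
      mul_le_mul_of_nonneg_right h (Real.rpow_nonneg (norm_nonneg _) _)
    exact ⟨max (max M₁ M₂) M₃, fun hne => ⟨fun x => ((h1 hne).1 x).trans l1,
      fun x y => ((h1 hne).2 x y).trans (hp l1 x y)⟩, fun x => (h2 x).trans l2,
      fun x y => (h2' x y).trans (hp l2 x y), fun hl x => (h3 hl x).trans (le_max_right _ _)⟩

/-- The derivation property of Lie elements, differentiated once. -/
theorem ev_fderiv_wordField_eq (hV : ∀ i, ContDiff ℝ N (Vs i)) {m : ℕ} (hm : m ≤ N)
    {a : TruncTensor ℓ N} (ha : a ∈ brkSpan ℓ N) {w : List (Fin ℓ)} (hw : w.length < N) (x : E) :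
    ev (fun v => if v.length + w.length ≤ m then fderiv ℝ (wordField Vs (v ++ w)) x else 0) a =
      fderiv ℝ (fderiv ℝ (wordField Vs w)) x
        (ev (fun v => if v.length + w.length ≤ m then wordField Vs v x else 0) a) +
      (fderiv ℝ (wordField Vs w) x).comp
        (ev (fun v => if v.length + w.length ≤ m then fderiv ℝ (wordField Vs v) x else 0) a) := by
  have h1 : HasFDerivAt (fun x => ev (fun v => if v.length + w.length ≤ m then
      wordField Vs (v ++ w) x else 0) a) (ev (fun v => if v.length + w.length ≤ m then
      fderiv ℝ (wordField Vs (v ++ w)) x else 0) a) x := by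
    refine hasFDerivAt_ev fun v _ => ?_
    by_cases hc : v.1.length + w.length ≤ m
    · simp only [hc, if_true]
      exact (differentiable_wordField hV (by simp; omega) x).hasFDerivAt
    · simp only [hc, if_false]
      exact hasFDerivAt_const _ _
  have h2 : HasFDerivAt (fun x => ev (fun v => if v.length + w.length ≤ m then
      wordField Vs v x else 0) a) (ev (fun v => if v.length + w.length ≤ m then
      fderiv ℝ (wordField Vs v) x else 0) a) x := by
    refine hasFDerivAt_ev fun v _ => ?_
    by_cases hc : v.1.length + w.length ≤ m
    · simp only [hc, if_true]
      exact (differentiable_wordField hV (by omega) x).hasFDerivAt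
    · simp only [hc, if_false]
      exact hasFDerivAt_const _ _
  have h3 := ((differentiable_fderiv_wordField hV hw x).hasFDerivAt).clm_apply h2
  have h4 : (fun x => ev (fun v => if v.length + w.length ≤ m then
      wordField Vs (v ++ w) x else 0) a) = fun x => fderiv ℝ (wordField Vs w) x
        (ev (fun v => if v.length + w.length ≤ m then wordField Vs v x else 0) a) := by
    funext x
    exact ev_wordDeriv_eq hV hm (by omega) ha w x
  -- The two sides of the undifferentiated identity are the same function, so their derivatives `h1`
  -- and `h3` coincide; symmetry of the second derivative puts the result in the stated form.
  rw [h4] at h1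
  rw [h1.unique h3, fderiv_fderiv_wordField_symm hV hw, add_comm]

end WordFields

/-! ### Tangent lifts -/

section Tangent

universe u
variable {E : Type u} [NormedAddCommGroup E] [NormedSpace ℝ E] {ℓ N : ℕ}

/-- The tangent lift of a field. -/
def tangentMap (f : E → E) (z : E × E) : E × E := (f z.1, fderiv ℝ f z.1 z.2)

/-- The differential of the tangent lift of a `C^2` field. -/
def tangentDeriv (f : E → E) (z : E × E) : E × E →L[ℝ] E × E :=
  ((fderiv ℝ f z.1).comp (ContinuousLinearMap.fst ℝ E E)).prod
    (((fderiv ℝ (fderiv ℝ f) z.1).flip z.2).comp (ContinuousLinearMap.fst ℝ E E) +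
      (fderiv ℝ f z.1).comp (ContinuousLinearMap.snd ℝ E E))

theorem hasFDerivAt_tangentMap {f : E → E} (hf : Differentiable ℝ f)
    (hf' : Differentiable ℝ (fderiv ℝ f)) (z : E × E) :
    HasFDerivAt (tangentMap f) (tangentDeriv f z) z := by
  have h1 : HasFDerivAt (fun z : E × E => f z.1) _ z := (hf z.1).hasFDerivAt.comp z hasFDerivAt_fst
  have h2 : HasFDerivAt (fun z : E × E => fderiv ℝ f z.1) _ z :=
    (hf' z.1).hasFDerivAt.comp z hasFDerivAt_fst
  have h3 := h1.prodMk (h2.clm_apply hasFDerivAt_snd)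
  refine h3.congr_fderiv ?_
  ext v <;> simp [tangentDeriv]

variable {M R θ : ℝ} {f : E → E}

theorem norm_tangentMap_le (hM : 0 ≤ M) (hR : 0 ≤ R) (h : ∀ x, ‖f x‖ ≤ M)
    (h' : ∀ x, ‖fderiv ℝ f x‖ ≤ M) {z : E × E} (hz : ‖z.2‖ ≤ R) :
    ‖tangentMap f z‖ ≤ M * (1 + 3 * R) := by
  refine norm_prod_le_iff.mpr ⟨(h z.1).trans (by nlinarith), ?_⟩
  calc ‖fderiv ℝ f z.1 z.2‖ ≤ M * R :=
        (ContinuousLinearMap.le_opNorm _ _).trans (mul_le_mul (h' _) hz (norm_nonneg _) hM)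
    _ ≤ M * (1 + 3 * R) := by nlinarith

theorem norm_tangentDeriv_le (hM : 0 ≤ M) (hR : 0 ≤ R) (h' : ∀ x, ‖fderiv ℝ f x‖ ≤ M)
    (h'' : ∀ x, ‖fderiv ℝ (fderiv ℝ f) x‖ ≤ M) {z : E × E} (hz : ‖z.2‖ ≤ R) :
    ‖tangentDeriv f z‖ ≤ M * (1 + 3 * R) := by
  refine ContinuousLinearMap.opNorm_le_bound _ (by positivity) fun k => ?_
  have hk1 : ‖k.1‖ ≤ ‖k‖ := norm_fst_le k
  have hk2 : ‖k.2‖ ≤ ‖k‖ := norm_snd_le k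
  have e1 : ∀ v : E, ‖v‖ ≤ ‖k‖ → ‖fderiv ℝ f z.1 v‖ ≤ M * ‖k‖ := fun v hv =>
    (ContinuousLinearMap.le_opNorm _ _).trans (mul_le_mul (h' _) hv (norm_nonneg _) hM)
  have hMk : 0 ≤ M * ‖k‖ := by positivity
  have hMRk : 0 ≤ M * R * ‖k‖ := by positivity
  refine norm_prod_le_iff.mpr ⟨(e1 _ hk1).trans (by nlinarith), ?_⟩
  change ‖fderiv ℝ (fderiv ℝ f) z.1 k.1 z.2 + fderiv ℝ f z.1 k.2‖ ≤ _
  have e2 : ‖fderiv ℝ (fderiv ℝ f) z.1 k.1 z.2‖ ≤ M * ‖k‖ * R := by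
    refine (ContinuousLinearMap.le_opNorm₂ _ _ _).trans ?_
    exact mul_le_mul (mul_le_mul (h'' _) hk1 (norm_nonneg _) hM) hz (norm_nonneg _) hMk
  linarith [norm_add_le (fderiv ℝ (fderiv ℝ f) z.1 k.1 z.2) (fderiv ℝ f z.1 k.2), e1 _ hk2]

theorem norm_tangentMap_sub_le (hM : 0 ≤ M) (hR : 0 ≤ R) (hθ : 0 ≤ θ) (hθ1 : θ ≤ 1)
    (hh : ∀ x y, ‖f x - f y‖ ≤ M * ‖x - y‖ ^ θ) (h' : ∀ x, ‖fderiv ℝ f x‖ ≤ M)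
    (hh' : ∀ x y, ‖fderiv ℝ f x - fderiv ℝ f y‖ ≤ M * ‖x - y‖ ^ θ) {z z' : E × E}
    (hz : ‖z.2‖ ≤ R) (hz' : ‖z'.2‖ ≤ R) :
    ‖tangentMap f z - tangentMap f z'‖ ≤ M * (1 + 3 * R) * ‖z - z'‖ ^ θ := by
  have hd := Real.rpow_nonneg (norm_nonneg (z - z')) θ
  have h1 : ‖z.1 - z'.1‖ ^ θ ≤ ‖z - z'‖ ^ θ :=
    Real.rpow_le_rpow (norm_nonneg _) (norm_fst_le (z - z')) hθ
  -- The linear dependence on the second component is made θ-Hölder by bounding the factor ‖z.2 -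
  -- z'.2‖^{1-θ} on the ball of radius R.
  have h2 : ‖z.2 - z'.2‖ ≤ (1 + 2 * R) * ‖z - z'‖ ^ θ := by
    have e : ‖z.2 - z'.2‖ = ‖z.2 - z'.2‖ ^ (1 - θ) * ‖z.2 - z'.2‖ ^ θ := by
      rw [← Real.rpow_add_of_nonneg (norm_nonneg _) (by linarith) hθ, sub_add_cancel, Real.rpow_one]
    rw [e]
    refine mul_le_mul ?_ (Real.rpow_le_rpow (norm_nonneg _) (norm_snd_le (z - z')) hθ)
      (Real.rpow_nonneg (norm_nonneg _) _) (by positivity)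
    refine (rpow_le_one_add (norm_nonneg _) (by linarith) (by linarith)).trans ?_
    linarith [norm_sub_le z.2 z'.2]
  refine norm_prod_le_iff.mpr ⟨?_, ?_⟩
  · calc ‖f z.1 - f z'.1‖ ≤ M * ‖z.1 - z'.1‖ ^ θ := hh _ _
      _ ≤ M * ‖z - z'‖ ^ θ := mul_le_mul_of_nonneg_left h1 hM
      _ ≤ M * (1 + 3 * R) * ‖z - z'‖ ^ θ := by
        refine mul_le_mul_of_nonneg_right ?_ hd
        nlinarith
  · change ‖fderiv ℝ f z.1 z.2 - fderiv ℝ f z'.1 z'.2‖ ≤ _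
    have e : fderiv ℝ f z.1 z.2 - fderiv ℝ f z'.1 z'.2 =
        (fderiv ℝ f z.1 - fderiv ℝ f z'.1) z.2 + fderiv ℝ f z'.1 (z.2 - z'.2) := by
      rw [_root_.sub_apply, map_sub]; abel
    rw [e]
    have e1 : ‖(fderiv ℝ f z.1 - fderiv ℝ f z'.1) z.2‖ ≤ M * ‖z - z'‖ ^ θ * R :=
      (ContinuousLinearMap.le_opNorm _ _).trans (mul_le_mul
        ((hh' _ _).trans (mul_le_mul_of_nonneg_left h1 hM)) hz (norm_nonneg _) (by positivity))
    have e2 : ‖fderiv ℝ f z'.1 (z.2 - z'.2)‖ ≤ M * ((1 + 2 * R) * ‖z - z'‖ ^ θ) :=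
      (ContinuousLinearMap.le_opNorm _ _).trans (mul_le_mul (h' _) h2 (norm_nonneg _) hM)
    refine (norm_add_le _ _).trans ((add_le_add e1 e2).trans (le_of_eq ?_))
    ring

variable {Vs : Fin ℓ → E → E} {κ : ℝ} {V : E → E}

/-- Tangent lifts grow linearly in the second variable, hence the restriction to ‖z.2‖ ≤ R. The lift
uses up the additional derivative of the fields and leaves the exponents θ and κ unchanged. -/
theorem exists_isWordSystem_tangent (hN : 1 ≤ N) (hθ : 0 ≤ θ) (hθ1 : θ ≤ 1) (hκ : 0 ≤ κ)
    (hκ1 : κ ≤ 1) (hC : ∀ i, ContDiff ℝ N (Vs i)) (hVs : ∀ i, Regular θ N (Vs i))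
    (hV : Regular κ 1 V) (hR : 0 ≤ R) :
    ∃ M : ℝ, 0 ≤ M ∧ IsWordSystem N M θ κ {z : E × E | ‖z.2‖ ≤ R}
      (fun w => tangentMap (wordField Vs w)) (fun w => tangentDeriv (wordField Vs w))
      (tangentMap V) := by
  obtain ⟨M₁, hM₁, hw⟩ := exists_wordField_bound hθ hθ1 hVs
  obtain ⟨M₂, h2, h2'⟩ := hV.of_le hκ hκ1 (Nat.zero_le 1)
  obtain ⟨M₃, h3, h3'⟩ := hV.2.2
  have hM₂ : 0 ≤ M₂ := (norm_nonneg _).trans (h2 0)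
  have hM₃ : 0 ≤ M₃ := (norm_nonneg _).trans (h3 0)
  set M₀ := M₁ + M₂ + M₃ with hM₀
  have hM₀0 : 0 ≤ M₀ := by positivity
  have hR3 : 0 ≤ 1 + 3 * R := by positivity
  have l1 : M₁ ≤ M₀ := by linarith
  have l2 : M₂ ≤ M₀ := by linarith
  have l3 : M₃ ≤ M₀ := by linarith
  have hp : ∀ {M q : ℝ} (_ : M ≤ M₀) (x y : E), M * ‖x - y‖ ^ q ≤ M₀ * ‖x - y‖ ^ q :=
    fun h x y => mul_le_mul_of_nonneg_right h (Real.rpow_nonneg (norm_nonneg _) _)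
  refine ⟨M₀ * (1 + 3 * R), by positivity, ?_⟩
  exact
    { nil := fun z => by
        change (z.1, fderiv ℝ id z.1 z.2) = z
        rw [fderiv_id]; rfl
      hasFDerivAt := fun w _ hl z _ => hasFDerivAt_tangentMap (differentiable_wordField hC hl.le)
        (differentiable_fderiv_wordField hC hl) z
      norm_le := fun w hne hl z hz => norm_tangentMap_le hM₀0 hR
        (fun x => (((hw w hl).1 hne).1 x).trans l1) (fun x => ((hw w hl).2.1 x).trans l1) hz
      norm_deriv_le := fun w hne hl z hz => norm_tangentDeriv_le hM₀0 hR
        (fun x => ((hw w hl.le).2.1 x).trans l1) (fun x => ((hw w hl.le).2.2.2 hl x).trans l1) hz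
      holder := fun w hl z hz z' hz' => by
        have hne : w ≠ [] := by rintro rfl; simp at hl; omega
        exact norm_tangentMap_sub_le hM₀0 hR hθ hθ1
          (fun x y => (((hw w hl.le).1 hne).2 x y).trans (hp l1 x y))
          (fun x => ((hw w hl.le).2.1 x).trans l1)
          (fun x y => ((hw w hl.le).2.2.1 x y).trans (hp l1 x y)) hz hz'
      drift_norm_le := fun z hz => norm_tangentMap_le hM₀0 hR (fun x => (h2 x).trans l2)
        (fun x => (h3 x).trans l3) hz
      drift_holder := fun z hz z' hz' => norm_tangentMap_sub_le hM₀0 hR hκ hκ1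
        (fun x y => (h2' x y).trans (hp l2 x y)) (fun x => (h3 x).trans l3)
        (fun x y => (h3' x y).trans (hp l3 x y)) hz hz' }

theorem TruncTensor.ev_fst (c : List (Fin ℓ) → E × E) (a : TruncTensor ℓ N) :
    (ev c a).1 = ev (fun v => (c v).1) a := (ev_comp (LinearMap.fst ℝ E E) c a).symm

theorem TruncTensor.ev_snd (c : List (Fin ℓ) → E × E) (a : TruncTensor ℓ N) :
    (ev c a).2 = ev (fun v => (c v).2) a := (ev_comp (LinearMap.snd ℝ E E) c a).symm

theorem TruncTensor.ev_clm_apply {G : Type*} [NormedAddCommGroup G] [NormedSpace ℝ G]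
    (c : List (Fin ℓ) → E →L[ℝ] G) (a : TruncTensor ℓ N) (h : E) :
    ev c a h = ev (fun v => c v h) a :=
  (ev_comp (ContinuousLinearMap.apply ℝ G h).toLinearMap c a).symm

theorem TruncTensor.ev_clm_comp (c : List (Fin ℓ) → E →L[ℝ] E) (a : TruncTensor ℓ N)
    (J : E →L[ℝ] E) : (ev c a).comp J = ev (fun v => (c v).comp J) a :=
  (ev_comp ((ContinuousLinearMap.compL ℝ E E E).flip J).toLinearMap c a).symm

/-- The first component is the derivation property at z.1, the second its differential in the
direction z.2. -/
theorem actsAsDerivation_tangent (hC : ∀ i, ContDiff ℝ N (Vs i)) (S : Set (E × E))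
    {a : TruncTensor ℓ N} (ha : a ∈ brkSpan ℓ N) :
    ActsAsDerivation N S (fun w => tangentMap (wordField Vs w))
      (fun w => tangentDeriv (wordField Vs w)) a := by
  intro w _ hw z _
  have h1 := ev_wordDeriv_eq hC le_rfl (Nat.le_succ N) ha w z.1
  have h2 := congrArg (fun L : E →L[ℝ] E => L z.2) (ev_fderiv_wordField_eq hC le_rfl ha hw z.1)
  simp only [_root_.add_apply, ContinuousLinearMap.comp_apply, ev_clm_apply] at h2
  have e1 : ∀ g : List (Fin ℓ) → List (Fin ℓ),
      (ev (fun v => if v.length + w.length ≤ N then tangentMap (wordField Vs (g v)) z else 0) a).1 =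
      ev (fun v => if v.length + w.length ≤ N then wordField Vs (g v) z.1 else 0) a := by
    intro g
    rw [ev_fst]
    congr 2; funext v; split_ifs <;> rfl
  have e2 : ∀ g : List (Fin ℓ) → List (Fin ℓ),
      (ev (fun v => if v.length + w.length ≤ N then tangentMap (wordField Vs (g v)) z else 0) a).2 =
      ev (fun v => (if v.length + w.length ≤ N then fderiv ℝ (wordField Vs (g v)) z.1 else 0) z.2)
        a := by
    intro g
    rw [ev_snd]
    congr 2; funext v; split_ifs <;> rfl
  have hd : ∀ k : E × E, tangentDeriv (wordField Vs w) z k =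
      (fderiv ℝ (wordField Vs w) z.1 k.1,
        fderiv ℝ (fderiv ℝ (wordField Vs w)) z.1 k.1 z.2 + fderiv ℝ (wordField Vs w) z.1 k.2) :=
    fun k => rfl
  rw [hd]
  refine Prod.ext ?_ ?_
  · rw [e1 (fun v => v ++ w)]
    change _ = fderiv ℝ (wordField Vs w) z.1 _
    rw [e1 (fun v => v)]
    exact h1
  · rw [e2 (fun v => v ++ w)]
    change _ = fderiv ℝ (fderiv ℝ (wordField Vs w)) z.1 _ z.2 + fderiv ℝ (wordField Vs w) z.1 _
    rw [e1 (fun v => v), e2 (fun v => v)]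
    exact h2

end Tangent

end RoughFlow

namespace RoughFlow

open TruncTensor

/-! ### The logarithmic field, its linearization and the derivatives of word fields along it -/

section Smooth

universe u
variable {E : Type u} [NormedAddCommGroup E] [NormedSpace ℝ E] {ℓ N : ℕ}

theorem norm_drift_add_ev_le {G : Type*} [NormedAddCommGroup G] [NormedSpace ℝ G]
    {K R M T δ : ℝ} (hR : 1 ≤ R) (hM : 0 ≤ M) (hδ : 0 ≤ δ) (hδT : δ ≤ T)
    {a : TruncTensor ℓ N} (ha : a ∈ filt ℓ N 1) (haK : ScaledBound K R a) {v : G}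
    {c : List (Fin ℓ) → G} (hv : ‖v‖ ≤ M) (hc : ∀ w, w ≠ [] → w.length ≤ N → ‖c w‖ ≤ M) :
    ‖δ • v + ev c a‖ ≤
      (T + Fintype.card {w : List (Fin ℓ) // w.length ≤ N} * (K * R ^ N)) * M := by
  have h1 : ‖δ • v‖ ≤ T * M := by
    rw [norm_smul, Real.norm_of_nonneg hδ]
    exact mul_le_mul hδT hv (norm_nonneg _) (hδ.trans hδT)
  have h2 := norm_ev_le haK (c := c) (C := R ^ N * M) (fun w hw => by
    have hne : w.1 ≠ [] := fun h => hw (ha w (by rw [h]; simp))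
    exact mul_le_mul (pow_le_pow_right₀ hR w.2) (hc w.1 hne w.2) (norm_nonneg _) (by positivity))
    (by positivity)
  refine (norm_add_le _ _).trans ((add_le_add h1 h2).trans (le_of_eq ?_))
  ring

/-- A surviving word has |w| + k ≥ m + 1 ≥ N, so its weight contains τ^N; the drift has this order
by the assumption on δ. -/
theorem pow_mul_norm_drift_add_ev_le {G : Type*} [NormedAddCommGroup G] [NormedSpace ℝ G]
    {K R M τ δ : ℝ} (hR : 1 ≤ R) (hM : 0 ≤ M) (hτ : 0 ≤ τ) (hτR : τ ≤ R) (hδ : 0 ≤ δ)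
    (hδτ : δ ≤ R * τ ^ N) {a : TruncTensor ℓ N} (ha : a ∈ filt ℓ N 1) (haK : ScaledBound K τ a)
    {k m : ℕ} (hk : k ≤ N) (hm : N ≤ m + 1) {v : G} {c : List (Fin ℓ) → G} (hv : ‖v‖ ≤ M)
    (hc : ∀ w, w ≠ [] → w.length ≤ N → ‖c w‖ ≤ M) :
    τ ^ k * ‖δ • v + ev (fun w => if w.length + k ≤ m then 0 else c w) a‖ ≤
      (R ^ N * R + Fintype.card {w : List (Fin ℓ) // w.length ≤ N} * (K * R ^ N)) * M * τ ^ N := by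
  have hK := haK.nonneg
  have hτk : τ ^ k ≤ R ^ N := (pow_le_pow_left₀ hτ hτR k).trans (pow_le_pow_right₀ hR hk)
  have h1 : τ ^ k * ‖δ • v‖ ≤ R ^ N * (R * τ ^ N * M) := by
    rw [norm_smul, Real.norm_of_nonneg hδ]
    exact mul_le_mul hτk (mul_le_mul hδτ hv (norm_nonneg _) (by positivity)) (by positivity)
      (by positivity)
  set d : List (Fin ℓ) → G := fun w => if w.length + k ≤ m then 0 else c w with hd
  have h2 : τ ^ k * ‖ev d a‖ = ‖ev (fun w => τ ^ k • d w) a‖ := by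
    have : ev (fun w => τ ^ k • d w) a = τ ^ k • ev d a := by
      simp only [ev_apply, Finset.smul_sum]
      exact Finset.sum_congr rfl fun w _ => smul_comm _ _ _
    rw [this, norm_smul, Real.norm_of_nonneg (by positivity)]
  have h3 := norm_ev_le haK (c := fun w => τ ^ k • d w) (C := R ^ N * M * τ ^ N) (fun w hw => by
    have hne : w.1 ≠ [] := fun h => hw (ha w (by rw [h]; simp))
    rw [norm_smul, Real.norm_of_nonneg (by positivity), hd]
    by_cases hwk : w.1.length + k ≤ m
    · simp only [hwk, if_true, norm_zero, mul_zero]; positivity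
    · simp only [hwk, if_false]
      have e : τ ^ w.1.length * τ ^ k = τ ^ (w.1.length + k - N) * τ ^ N := by
        rw [← pow_add, ← pow_add]; congr 1; omega
      have e1 : τ ^ (w.1.length + k - N) ≤ R ^ N := (pow_le_pow_left₀ hτ hτR _).trans
        (pow_le_pow_right₀ hR (by have := w.2; omega))
      calc τ ^ w.1.length * (τ ^ k * ‖c w.1‖) = τ ^ (w.1.length + k - N) * τ ^ N * ‖c w.1‖ := by
            rw [← mul_assoc, e]
        _ ≤ R ^ N * τ ^ N * M := mul_le_mul (mul_le_mul_of_nonneg_right e1 (by positivity))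
            (hc w.1 hne w.2) (norm_nonneg _) (by positivity)
        _ = R ^ N * M * τ ^ N := by ring) (by positivity)
  rw [← h2] at h3
  have h4 : τ ^ k * ‖δ • v + ev d a‖ ≤ τ ^ k * ‖δ • v‖ + τ ^ k * ‖ev d a‖ := by
    rw [← mul_add]
    exact mul_le_mul_of_nonneg_left (norm_add_le _ _) (by positivity)
  refine h4.trans ((add_le_add h1 h3).trans (le_of_eq ?_))
  ring

/-- The differential of the logarithmic vector field. -/
def logDeriv (V : E → E) (Vs : Fin ℓ → E → E) (δ : ℝ) (a : TruncTensor ℓ N) (x : E) : E →L[ℝ] E :=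
  δ • fderiv ℝ V x + ev (fun v => fderiv ℝ (wordField Vs v) x) a

variable {V : E → E} {Vs : Fin ℓ → E → E}

/-- The point is that M is the same for all s and t: the coordinates of the logarithm and the time
step are bounded uniformly. -/
theorem exists_isHolderField_logField {ρ T R K : ℝ} (hρ : 0 ≤ ρ) (hρ1 : ρ ≤ 1) (hR : 1 ≤ R)
    (hC : ∀ i, ContDiff ℝ N (Vs i)) (hVs : ∀ i, Regular ρ N (Vs i))
    (hV : Regular ρ 1 V) (Λ : ℝ → ℝ → List (Fin ℓ) → ℝ) :
    ∃ M : ℝ, ∀ s t : ℝ, s ≤ t → t - s ≤ T → ScaledBound K R (logTensor N Λ t s) →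
      IsHolderField M ρ (logField N V Vs Λ t s) (logDeriv V Vs (t - s) (logTensor N Λ t s)) := by
  obtain ⟨M₁, hM₁, hw⟩ := exists_wordField_bound hρ hρ1 hVs
  obtain ⟨⟨M₂, h2⟩, hVd, M₃, h3, h3'⟩ := hV
  have hM₂ : 0 ≤ M₂ := (norm_nonneg _).trans (h2 0)
  have hM₃ : 0 ≤ M₃ := (norm_nonneg _).trans (h3 0)
  set M₀ := M₁ + M₂ + M₃ with hM₀
  have hM₀0 : 0 ≤ M₀ := by positivity
  have l1 : M₁ ≤ M₀ := by linarith
  have l2 : M₂ ≤ M₀ := by linarith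
  have l3 : M₃ ≤ M₀ := by linarith
  refine ⟨(T + Fintype.card {w : List (Fin ℓ) // w.length ≤ N} * (K * R ^ N)) * M₀,
    fun s t hst hδT hL => ?_⟩
  have hδ : 0 ≤ t - s := sub_nonneg.mpr hst
  have ha := logTensor_mem_filt (N := N) Λ t s
  have hW : ∀ x, logField N V Vs Λ t s x = (t - s) • V x +
      ev (fun v => wordField Vs v x) (logTensor N Λ t s) := fun x =>
    logField_eq hC (Nat.le_succ N) V Λ t s x
  refine ⟨fun x => ?_, fun x => ?_, fun x => ?_, fun x y => ?_⟩
  · rw [funext hW]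
    exact ((hVd x).hasFDerivAt.const_smul (t - s)).add (hasFDerivAt_ev fun w _ =>
      (differentiable_wordField hC w.2 x).hasFDerivAt)
  · rw [hW]
    exact norm_drift_add_ev_le hR hM₀0 hδ hδT ha hL ((h2 x).trans l2)
      fun w hne hl => (((hw w hl).1 hne).1 x).trans l1
  · exact norm_drift_add_ev_le hR hM₀0 hδ hδT ha hL ((h3 x).trans l3)
      fun w _ hl => ((hw w hl).2.1 x).trans l1
  · have hp : 0 ≤ ‖x - y‖ ^ ρ := Real.rpow_nonneg (norm_nonneg _) _
    have e : logDeriv V Vs (t - s) (logTensor N Λ t s) x -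
        logDeriv V Vs (t - s) (logTensor N Λ t s) y =
        (t - s) • (fderiv ℝ V x - fderiv ℝ V y) + ev (fun v => fderiv ℝ (wordField Vs v) x -
          fderiv ℝ (wordField Vs v) y) (logTensor N Λ t s) := by
      rw [ev_sub, smul_sub, logDeriv, logDeriv]; abel
    rw [e, mul_assoc]
    exact norm_drift_add_ev_le hR (by positivity) hδ hδT ha hL
      ((h3' x y).trans (mul_le_mul_of_nonneg_right l3 hp))
      fun w _ hl => ((hw w hl).2.2.1 x y).trans (mul_le_mul_of_nonneg_right l1 hp)

/-- A solution together with a transported tangent vector solves the equation of the tangent lifts,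
so the composition estimate on E × E applies to differentials. -/
theorem isPath_tangent (hC : ∀ i, ContDiff ℝ N (Vs i)) {Λ : ℝ → ℝ → List (Fin ℓ) → ℝ} {s t R : ℝ}
    {y : ℝ → E} {J : ℝ → E →L[ℝ] E} (hy : IsSolution (logField N V Vs Λ t s) y)
    (hJ : IsLinearization (logDeriv V Vs (t - s) (logTensor N Λ t s)) y J) (h : E)
    (hR : ∀ u ∈ Icc (0 : ℝ) 1, ‖J u h‖ ≤ R) :
    IsPath {z : E × E | ‖z.2‖ ≤ R} (fun w => tangentMap (wordField Vs w)) (tangentMap V) (t - s)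
      (logTensor N Λ t s) (fun u => (y u, J u h)) := by
  intro u hu
  refine ⟨hR u hu, ?_⟩
  have h1 := hy u hu
  rw [logField_eq hC (Nat.le_succ N)] at h1
  have h2 : HasDerivWithinAt (fun u => J u h)
      (logDeriv V Vs (t - s) (logTensor N Λ t s) (y u) (J u h)) (Icc 0 1) u := by
    have := (hJ.2 u hu).clm_apply (hasDerivWithinAt_const u (Icc (0 : ℝ) 1) h)
    simpa using this
  refine (h1.prodMk h2).congr_deriv (Prod.ext ?_ ?_)
  · change _ = (t - s) • V (y u) + (ev _ _ : E × E).1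
    rw [ev_fst]; rfl
  · change logDeriv V Vs (t - s) (logTensor N Λ t s) (y u) (J u h) =
      (t - s) • fderiv ℝ V (y u) (J u h) + (ev _ _ : E × E).2
    rw [ev_snd, logDeriv, _root_.add_apply, ev_clm_apply]; rfl

/-- `D(DF_w · f)` for the field `F_w` of the word `w`. -/
def fieldDeriv (Vs : Fin ℓ → E → E) (w : List (Fin ℓ)) (f : E → E) (x : E) : E →L[ℝ] E :=
  fderiv ℝ (fderiv ℝ (wordField Vs w)) x (f x) +
    (fderiv ℝ (wordField Vs w) x).comp (fderiv ℝ f x)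

/-- The part of `D(DF_w · W)`, `W = δ V + ∑ a^v F_v`, which has degree larger than `m`. -/
def highDeriv (m : ℕ) (V : E → E) (Vs : Fin ℓ → E → E) (δ : ℝ) (a : TruncTensor ℓ N)
    (w : List (Fin ℓ)) (x : E) : E →L[ℝ] E :=
  δ • fieldDeriv Vs w V x +
    ev (fun v => if v.length + w.length ≤ m then 0 else fieldDeriv Vs w (wordField Vs v) x) a

theorem TruncTensor.ev_bilin (A : E →L[ℝ] E →L[ℝ] E) (B : E →L[ℝ] E) (c : List (Fin ℓ) → E)
    (c' : List (Fin ℓ) → E →L[ℝ] E) (a : TruncTensor ℓ N) :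
    A (ev c a) + B.comp (ev c' a) = ev (fun v => A (c v) + B.comp (c' v)) a := by
  rw [ev_add]
  congr 1
  · exact (ev_comp A.toLinearMap c a).symm
  · exact (ev_comp (ContinuousLinearMap.compL ℝ E E E B).toLinearMap c' a).symm

/-- With W the logarithmic field, the derivative of DF_w(y)J is D(DF_w·W)(y)J. The differentiated
derivation property turns the part of degree at most m into the members of the longer words;
`highDeriv` is the rest. -/
theorem hasDerivWithinAt_fderiv_wordField_comp (hC : ∀ i, ContDiff ℝ N (Vs i)) {m : ℕ}
    (hm : m ≤ N) {Λ : ℝ → ℝ → List (Fin ℓ) → ℝ} {s t : ℝ} {y : ℝ → E}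
    {J : ℝ → E →L[ℝ] E} (hy : IsSolution (logField N V Vs Λ t s) y)
    (hJ : IsLinearization (logDeriv V Vs (t - s) (logTensor N Λ t s)) y J)
    {w : List (Fin ℓ)} (hw : w.length < N) {u : ℝ} (hu : u ∈ Icc (0 : ℝ) 1) :
    HasDerivWithinAt (fun u => (fderiv ℝ (wordField Vs w) (y u)).comp (J u))
      (ev (fun v => if v.length + w.length ≤ m then
        (fderiv ℝ (wordField Vs (v ++ w)) (y u)).comp (J u) else 0) (logTensor N Λ t s) +
      (highDeriv m V Vs (t - s) (logTensor N Λ t s) w (y u)).comp (J u)) (Icc 0 1) u := by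
  set a := logTensor N Λ t s with ha
  have h1 := hy u hu
  rw [logField_eq hC (Nat.le_succ N)] at h1
  have h2 := ((differentiable_fderiv_wordField hC hw (y u)).hasFDerivAt).comp_hasDerivWithinAt u h1
  refine (h2.clm_comp (hJ.2 u hu)).congr_deriv ?_
  have e1 : ev (fun v => if v.length + w.length ≤ m then
      (fderiv ℝ (wordField Vs (v ++ w)) (y u)).comp (J u) else 0) a =
      (ev (fun v => if v.length + w.length ≤ m then
        fderiv ℝ (wordField Vs (v ++ w)) (y u) else 0) a).comp (J u) := by
    rw [ev_clm_comp]
    congr 2; funext v; split_ifs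
    · rfl
    · exact (ContinuousLinearMap.zero_comp _).symm
  rw [e1, ev_fderiv_wordField_eq hC hm (logTensor_mem_brkSpan Λ t s) hw, ← ha,
    ← ContinuousLinearMap.add_comp, ev_bilin, highDeriv]
  change (fderiv ℝ (fderiv ℝ (wordField Vs w)) (y u) ((t - s) • V (y u) +
    ev (fun v => wordField Vs v (y u)) a)).comp (J u) +
    (fderiv ℝ (wordField Vs w) (y u)).comp ((logDeriv V Vs (t - s) a (y u)).comp (J u)) = _
  rw [← ContinuousLinearMap.comp_assoc, ← ContinuousLinearMap.add_comp, logDeriv]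
  congr 1
  rw [map_add, ContinuousLinearMap.comp_add, map_smul, ContinuousLinearMap.comp_smul,
    add_add_add_comm, ev_bilin, ← smul_add, add_left_comm, ← ev_add]
  congr 2
  refine congrArg ev (funext fun v => ?_)
  split_ifs
  · rw [add_zero]
  · rw [map_zero, ContinuousLinearMap.comp_zero, add_zero, zero_add]; rfl

/-- For |w| < N the second derivative of F_w is bounded and Hölder, and `fieldDeriv` is a sum of two
bilinear pairings of such functions. -/
theorem exists_fieldDeriv_bound {ρ : ℝ} (hρ : 0 ≤ ρ) (hρ1 : ρ ≤ 1)
    (hVs : ∀ i, Regular ρ N (Vs i)) (hV : Regular ρ 1 V) :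
    ∃ M : ℝ, 0 ≤ M ∧ ∀ w : List (Fin ℓ), w.length < N →
      ((∀ x, ‖fieldDeriv Vs w V x‖ ≤ M) ∧
        ∀ x y, ‖fieldDeriv Vs w V x - fieldDeriv Vs w V y‖ ≤ M * ‖x - y‖ ^ ρ) ∧
      ∀ v : List (Fin ℓ), v ≠ [] → v.length ≤ N →
        (∀ x, ‖fieldDeriv Vs w (wordField Vs v) x‖ ≤ M) ∧
        ∀ x y, ‖fieldDeriv Vs w (wordField Vs v) x - fieldDeriv Vs w (wordField Vs v) y‖ ≤
          M * ‖x - y‖ ^ ρ := by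
  have hp : ∀ {M M' : ℝ} (_ : M ≤ M') (x y : E), M * ‖x - y‖ ^ ρ ≤ M' * ‖x - y‖ ^ ρ :=
    fun h x y => mul_le_mul_of_nonneg_right h (Real.rpow_nonneg (norm_nonneg _) _)
  have key : ∀ w : List (Fin ℓ), w.length < N → ∀ f : E → E, Regular ρ 1 f →
      Regular ρ 0 (fieldDeriv Vs w f) := by
    intro w hw f hf
    have h1 := regular_fderiv_wordField hρ hρ1 hVs w 1 (by omega)
    exact (h1.2.2.clm_apply hρ hρ1 (hf.of_le hρ hρ1 (Nat.zero_le 1))).add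
      (Regular.bilin hρ hρ1 (ContinuousLinearMap.compL ℝ E E E)
        (h1.of_le hρ hρ1 (Nat.zero_le 1)) hf.2.2)
  have h := exists_forall_word (ℓ := ℓ) N (P := fun w M => w.length < N →
      ((∀ x, ‖fieldDeriv Vs w V x‖ ≤ M) ∧
        ∀ x y, ‖fieldDeriv Vs w V x - fieldDeriv Vs w V y‖ ≤ M * ‖x - y‖ ^ ρ) ∧
      ∀ v : List (Fin ℓ), v ≠ [] → v.length ≤ N →
        (∀ x, ‖fieldDeriv Vs w (wordField Vs v) x‖ ≤ M) ∧
        ∀ x y, ‖fieldDeriv Vs w (wordField Vs v) x - fieldDeriv Vs w (wordField Vs v) y‖ ≤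
          M * ‖x - y‖ ^ ρ)
    (fun w M M' hMM h hl => ⟨⟨fun x => ((h hl).1.1 x).trans hMM,
        fun x y => ((h hl).1.2 x y).trans (hp hMM x y)⟩, fun v hv hvl =>
        ⟨fun x => (((h hl).2 v hv hvl).1 x).trans hMM,
          fun x y => (((h hl).2 v hv hvl).2 x y).trans (hp hMM x y)⟩⟩) (fun w _ => by
      by_cases hl : w.length < N
      · obtain ⟨M₁, h1, h1'⟩ := key w hl V hV
        obtain ⟨M₂, -, h2⟩ := exists_forall_word (ℓ := ℓ) N (P := fun v M => v ≠ [] →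
          (∀ x, ‖fieldDeriv Vs w (wordField Vs v) x‖ ≤ M) ∧
          ∀ x y, ‖fieldDeriv Vs w (wordField Vs v) x - fieldDeriv Vs w (wordField Vs v) y‖ ≤
            M * ‖x - y‖ ^ ρ) (fun v M M' hMM h hv => ⟨fun x => ((h hv).1 x).trans hMM,
              fun x y => ((h hv).2 x y).trans (hp hMM x y)⟩) (fun v hvl => by
            by_cases hv : v = []
            · exact ⟨0, fun h => absurd hv h⟩
            · obtain ⟨M, h⟩ := key w hl _ ((regular_wordDeriv hρ hρ1 hVs v (N + 1 - v.length) hv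
                (by omega)).of_le hρ hρ1 (by omega))
              exact ⟨M, fun _ => h⟩)
        have l1 := le_max_left M₁ M₂
        have l2 := le_max_right M₁ M₂
        exact ⟨max M₁ M₂, fun _ => ⟨⟨fun x => (h1 x).trans l1,
          fun x y => (h1' x y).trans (hp l1 x y)⟩, fun v hv hvl =>
          ⟨fun x => ((h2 v hvl hv).1 x).trans l2,
            fun x y => ((h2 v hvl hv).2 x y).trans (hp l2 x y)⟩⟩⟩
      · exact ⟨0, fun h => absurd h hl⟩)
  obtain ⟨M, hM, h⟩ := h
  exact ⟨M, hM, fun w hw => h w hw.le hw⟩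

theorem highDeriv_sub (m : ℕ) (δ : ℝ) (a : TruncTensor ℓ N) (w : List (Fin ℓ)) (x y : E) :
    highDeriv m V Vs δ a w x - highDeriv m V Vs δ a w y =
      δ • (fieldDeriv Vs w V x - fieldDeriv Vs w V y) +
      ev (fun v => if v.length + w.length ≤ m then 0 else
        fieldDeriv Vs w (wordField Vs v) x - fieldDeriv Vs w (wordField Vs v) y) a := by
  have e : ∀ v : List (Fin ℓ), (if v.length + w.length ≤ m then 0 else
      fieldDeriv Vs w (wordField Vs v) x - fieldDeriv Vs w (wordField Vs v) y) =
      (if v.length + w.length ≤ m then 0 else fieldDeriv Vs w (wordField Vs v) x) -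
      (if v.length + w.length ≤ m then 0 else fieldDeriv Vs w (wordField Vs v) y) := by
    intro v; split_ifs <;> simp
  simp only [e]
  rw [ev_sub, smul_sub, highDeriv, highDeriv]
  abel

/-- `word_expansion` for a family all of whose members are differentiable. -/
theorem word_expansion_nil {B : Type*} [NormedAddCommGroup B] [NormedSpace ℝ B] {m : ℕ}
    (hm : m ≤ N) {K τ η : ℝ} (hτ : 0 ≤ τ) (hη : 0 ≤ η) {a : TruncTensor ℓ N}
    (ha : a ∈ filt ℓ N 1) (haK : ScaledBound K τ a) (c r : List (Fin ℓ) → ℝ → B)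
    (hderiv : ∀ w : List (Fin ℓ), w.length ≤ m → ∀ u ∈ Icc (0 : ℝ) 1,
      HasDerivWithinAt (c w) (ev (fun v => if v.length + w.length ≤ m then c (v ++ w) u else 0) a +
        r w u) (Icc 0 1) u)
    (hr : ∀ w : List (Fin ℓ), w.length ≤ m → ∀ u ∈ Icc (0 : ℝ) 1, τ ^ w.length * ‖r w u‖ ≤ η) :
    ‖c [] 1 - ev (fun v => if v.length ≤ m then c v 0 else 0) (expo a)‖ ≤
      (Fintype.card {w : List (Fin ℓ) // w.length ≤ N} * K + 1) ^ m * η := by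
  have htop : ∀ w : List (Fin ℓ), w.length = m → ∀ u ∈ Icc (0 : ℝ) 1,
      τ ^ w.length * ‖c w u - c w 0‖ ≤ η := by
    intro w hw u hu
    -- Words of length m have no longer word below the cut, so they move only through the error
    -- term.
    have hz : ∀ u, ev (fun v => if v.length + w.length ≤ m then c (v ++ w) u else 0) a = 0 := by
      intro u
      rw [ev_apply]
      refine Finset.sum_eq_zero fun v _ => ?_
      by_cases hv : v.1.length = 0
      · rw [ha v (by omega), zero_smul]
      · rw [if_neg (by omega), smul_zero]
    have h1 : ∀ u ∈ Icc (0 : ℝ) 1, HasDerivWithinAt (fun u => τ ^ w.length • c w u)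
        (τ ^ w.length • r w u) (Icc 0 1) u := by
      intro u hu
      have := hderiv w hw.le u hu
      rw [hz, zero_add] at this
      exact this.const_smul _
    have hn : ∀ v : B, ‖τ ^ w.length • v‖ = τ ^ w.length * ‖v‖ := fun v => by
      rw [norm_smul, Real.norm_of_nonneg (by positivity)]
    have h2 := norm_image_sub_le_of_norm_deriv_le_segment' h1 (C := η) (fun u hu => by
      rw [hn]; exact hr w hw.le u (Ico_subset_Icc_self hu)) u hu
    rw [← smul_sub, hn, sub_zero] at h2
    exact h2.trans (mul_le_of_le_one_right hη hu.2)
  have := word_expansion hm hτ hη ha haK c r htop (fun w hw => hderiv w hw.le)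
    (fun w hw => hr w hw.le) [] (Nat.zero_le _) 1 (by simp)
  simpa using this

end Smooth

end RoughFlow

namespace RoughFlow

open TruncTensor

/-! ### Splitting the differential into a C^1 part and a small Hölder part -/

section SmoothPart

universe u
variable {E : Type u} [NormedAddCommGroup E] [NormedSpace ℝ E] {ℓ N : ℕ} {Vs : Fin ℓ → E → E}

/-- The part of `D μ_{ts} - Id` which is of class `C^1`. -/
def smoothPart (m : ℕ) (Vs : Fin ℓ → E → E) (a : TruncTensor ℓ N) (x : E) : E →L[ℝ] E :=
  ev (fun v => if v ≠ [] ∧ v.length ≤ m then fderiv ℝ (wordField Vs v) x else 0) (expo a)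

/-- The empty word has coefficient 1 in exp(a) and derivative Id; the other words form the smooth
part. -/
theorem ev_fderiv_wordField_expo (m : ℕ) {a : TruncTensor ℓ N} (ha : a ∈ filt ℓ N 1)
    (x : E) : ev (fun v => if v.length ≤ m then fderiv ℝ (wordField Vs v) x else 0) (expo a) =
      ContinuousLinearMap.id ℝ E + smoothPart m Vs a x := by
  have e : ∀ v : List (Fin ℓ), (if v.length ≤ m then fderiv ℝ (wordField Vs v) x else 0) =
      (if v = [] then ContinuousLinearMap.id ℝ E else 0) +
        (if v ≠ [] ∧ v.length ≤ m then fderiv ℝ (wordField Vs v) x else 0) := by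
    intro v
    by_cases hv : v = []
    · subst hv
      simp only [List.length_nil, Nat.zero_le, if_true, ne_eq, not_true_eq_false, false_and,
        if_false, add_zero]
      exact fderiv_id
    · simp [hv]
  simp only [e]
  rw [ev_add, smoothPart]
  congr 1
  rw [ev_apply, Finset.sum_eq_single ⟨[], Nat.zero_le _⟩]
  · rw [expo_apply_nil ha, one_smul, if_pos rfl]
  · intro v _ hv
    rw [if_neg (fun h => hv (Subtype.ext h)), smul_zero]
  · simp

theorem TruncTensor.norm_ev_le_mul {G : Type*} [NormedAddCommGroup G] [NormedSpace ℝ G]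
    {K R M τ : ℝ} (hM : 0 ≤ M) (hR : 1 ≤ R) (hτ : 0 ≤ τ) (hτR : τ ≤ R)
    {b : TruncTensor ℓ N} (hb : ScaledBound K τ b) {c : List (Fin ℓ) → G} (h0 : c [] = 0)
    (hc : ∀ v : List (Fin ℓ), v ≠ [] → v.length ≤ N → ‖c v‖ ≤ M) :
    ‖ev c b‖ ≤ Fintype.card {w : List (Fin ℓ) // w.length ≤ N} * (K * (R ^ N * M)) * τ := by
  have h := norm_ev_le hb (c := c) (C := R ^ N * τ * M) (fun w _ => by
    by_cases hw : w.1 = []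
    · rw [hw, h0, norm_zero, mul_zero]; positivity
    · obtain ⟨k, hk⟩ : ∃ k, w.1.length = k + 1 :=
        Nat.exists_eq_succ_of_ne_zero fun h => hw (List.length_eq_zero_iff.mp h)
      have h1 : τ ^ w.1.length ≤ R ^ N * τ := by
        rw [hk, pow_succ]
        exact mul_le_mul_of_nonneg_right ((pow_le_pow_left₀ hτ hτR k).trans
          (pow_le_pow_right₀ hR (by have := w.2; omega))) hτ
      exact mul_le_mul h1 (hc w.1 hw w.2) (norm_nonneg _) (by positivity)) (by positivity)
  refine h.trans (le_of_eq ?_)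
  ring

theorem hasFDerivAt_smoothPart (hC : ∀ i, ContDiff ℝ N (Vs i)) {m : ℕ} (hm : m < N)
    (a : TruncTensor ℓ N) (x : E) : HasFDerivAt (smoothPart m Vs a)
      (ev (fun v => if v ≠ [] ∧ v.length ≤ m then fderiv ℝ (fderiv ℝ (wordField Vs v)) x else 0)
        (expo a)) x := by
  refine hasFDerivAt_ev fun v _ => ?_
  by_cases hv : v.1 ≠ [] ∧ v.1.length ≤ m
  · simp only [if_pos hv]
    exact (differentiable_fderiv_wordField hC (hv.2.trans_lt hm) x).hasFDerivAt
  · simp only [if_neg hv]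
    exact hasFDerivAt_const _ _

theorem contDiff_smoothPart (hC : ∀ i, ContDiff ℝ N (Vs i)) {m : ℕ} (hm : m < N)
    (a : TruncTensor ℓ N) : ContDiff ℝ 1 (smoothPart m Vs a) := by
  have : smoothPart m Vs a = fun x => ∑ v : {w : List (Fin ℓ) // w.length ≤ N}, expo a v •
      (if v.1 ≠ [] ∧ v.1.length ≤ m then fderiv ℝ (wordField Vs v.1) x else 0) := by
    funext x; rfl
  rw [this]
  refine ContDiff.sum fun v _ => ContDiff.const_smul _ ?_
  by_cases hv : v.1 ≠ [] ∧ v.1.length ≤ m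
  · simp only [if_pos hv]
    exact (contDiff_wordField hC v.1 2 (by have := hv.2; omega)).fderiv_right (by norm_num)
  · simp only [if_neg hv]
    exact contDiff_const

/-- The smooth part and its derivative are small with the length of the time interval. -/
theorem exists_smoothPart_bound {θ K R : ℝ} (hθ : 0 ≤ θ) (hθ1 : θ ≤ 1) (hK : 0 ≤ K)
    (hR : 1 ≤ R) (hC : ∀ i, ContDiff ℝ N (Vs i)) (hVs : ∀ i, Regular θ N (Vs i)) {m : ℕ}
    (hm : m < N) : ∃ C : ℝ, 0 ≤ C ∧ ∀ τ : ℝ, 0 ≤ τ → τ ≤ R → ∀ a : TruncTensor ℓ N,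
      ScaledBound K τ a → ∀ x, ‖smoothPart m Vs a x‖ ≤ C * τ ∧
        ‖fderiv ℝ (smoothPart m Vs a) x‖ ≤ C * τ := by
  obtain ⟨M, hM, hw⟩ := exists_wordField_bound hθ hθ1 hVs
  set K' : ℝ := ∑ n ∈ Finset.range (N + 1), (n.factorial : ℝ)⁻¹ * ((N + 1) * K) ^ n with hK'
  have hK'0 : 0 ≤ K' := Finset.sum_nonneg fun _ _ => by positivity
  refine ⟨Fintype.card {w : List (Fin ℓ) // w.length ≤ N} * (K' * (R ^ N * M)), by positivity,
    fun τ hτ hτR a ha x => ?_⟩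
  have hb : ScaledBound K' τ (expo a) := ha.expo hτ
  constructor
  · have h : ∀ v : List (Fin ℓ), v ≠ [] → v.length ≤ N →
        ‖if v ≠ [] ∧ v.length ≤ m then fderiv ℝ (wordField Vs v) x else 0‖ ≤ M := by
      intro v _ hvl
      split_ifs
      · exact (hw v hvl).2.1 x
      · rw [norm_zero]; exact hM
    exact norm_ev_le_mul hM hR hτ hτR hb
      (c := fun v => if v ≠ [] ∧ v.length ≤ m then fderiv ℝ (wordField Vs v) x else 0)
      (if_neg fun h => h.1 rfl) h
  · rw [(hasFDerivAt_smoothPart hC hm a x).fderiv]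
    have h : ∀ v : List (Fin ℓ), v ≠ [] → v.length ≤ N →
        ‖if v ≠ [] ∧ v.length ≤ m then fderiv ℝ (fderiv ℝ (wordField Vs v)) x else 0‖ ≤ M := by
      intro v _ hvl
      split_ifs with hv
      · exact (hw v hvl).2.2.2 (hv.2.trans_lt hm) x
      · rw [norm_zero]; exact hM
    exact norm_ev_le_mul hM hR hτ hτR hb
      (c := fun v => if v ≠ [] ∧ v.length ≤ m then fderiv ℝ (fderiv ℝ (wordField Vs v)) x else 0)
      (if_neg fun h => h.1 rfl) h

/-- What remains of the differential of the flow beyond the smooth part has the order of the top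
degree, uniformly and in Hölder norm. -/
theorem exists_remainder_bound [CompleteSpace E] {V : E → E} {m : ℕ} (hm : N = m + 1)
    {K R M ρ : ℝ} (hK : 0 ≤ K) (hR : 1 ≤ R) (hM : 0 ≤ M) (hρ : 0 < ρ) (hρ1 : ρ ≤ 1)
    (hC : ∀ i, ContDiff ℝ N (Vs i)) (hVs : ∀ i, Regular ρ N (Vs i)) (hV : Regular ρ 1 V)
    (Λ : ℝ → ℝ → List (Fin ℓ) → ℝ) :
    ∃ C : ℝ, 0 ≤ C ∧ ∀ s t τ : ℝ, s ≤ t → 0 ≤ τ → τ ≤ R → t - s ≤ R * τ ^ N →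
      ScaledBound K τ (logTensor N Λ t s) →
      IsHolderField M ρ (logField N V Vs Λ t s) (logDeriv V Vs (t - s) (logTensor N Λ t s)) →
      ∀ ν : E → E, (∀ x, IsTimeOneValue (logField N V Vs Λ t s) x (ν x)) → ∀ A : E → E →L[ℝ] E,
      (∀ x, fderiv ℝ ν x = ContinuousLinearMap.id ℝ E + A x +
        smoothPart m Vs (logTensor N Λ t s) x) →
      (∀ x, ‖A x‖ ≤ C * τ ^ N) ∧ ∀ x x', ‖A x - A x'‖ ≤ C * τ ^ N * ‖x - x'‖ ^ ρ := by
  obtain ⟨M₀, hM₀, hfd⟩ := exists_fieldDeriv_bound hρ.le hρ1 hVs hV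
  -- The constant in the O(τ^N) bound on the weighted terms of high degree.
  set C₁ : ℝ := (R ^ N * R + Fintype.card {w : List (Fin ℓ) // w.length ≤ N} * (K * R ^ N)) * M₀
    with hC₁
  have hC₁0 : 0 ≤ C₁ := by positivity
  set L := Real.exp M with hL
  have hL0 : 0 < L := Real.exp_pos _
  have hLρ : 0 ≤ L ^ ρ := Real.rpow_nonneg hL0.le _
  set W : ℝ := (Fintype.card {w : List (Fin ℓ) // w.length ≤ N} * K + 1) ^ m with hW
  have hW0 : 0 ≤ W := by positivity
  -- The first term serves the uniform bound. The other two serve the Hölder bound: variation of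
  -- `highDeriv` along two trajectories, and variation of the linearization.
  set D : ℝ := C₁ * L + C₁ * L ^ ρ * L + C₁ * (M * L ^ 3) with hD
  refine ⟨W * D, by positivity, ?_⟩
  intro s t τ hst hτ hτR hδ haK hH ν hν A hA
  have hδ0 : 0 ≤ t - s := sub_nonneg.mpr hst
  set a := logTensor N Λ t s with ha_def
  have ha : a ∈ filt ℓ N 1 := logTensor_mem_filt Λ t s
  obtain ⟨Y, J, h1, h2⟩ := hH.exists_flow hρ hρ1 hν
  have hτN : 0 ≤ τ ^ N := by positivity
  have hhigh : ∀ w : List (Fin ℓ), w.length ≤ m → ∀ x,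
      τ ^ w.length * ‖highDeriv m V Vs (t - s) a w x‖ ≤ C₁ * τ ^ N := fun w hw x =>
    pow_mul_norm_drift_add_ev_le hR hM₀ hτ hτR hδ0 hδ ha haK (by omega) (by omega)
      ((hfd w (by omega)).1.1 x) fun v hv hvl => ((hfd w (by omega)).2 v hv hvl).1 x
  have hhighd : ∀ w : List (Fin ℓ), w.length ≤ m → ∀ x y,
      τ ^ w.length * ‖highDeriv m V Vs (t - s) a w x - highDeriv m V Vs (t - s) a w y‖ ≤
        C₁ * ‖x - y‖ ^ ρ * τ ^ N := fun w hw x y => by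
    rw [highDeriv_sub, hC₁, mul_assoc _ M₀]
    exact pow_mul_norm_drift_add_ev_le hR
      (mul_nonneg hM₀ (Real.rpow_nonneg (norm_nonneg _) _)) hτ hτR hδ0 hδ ha haK (by omega)
      (by omega) ((hfd w (by omega)).1.2 x y) fun v hv hvl => ((hfd w (by omega)).2 v hv hvl).2 x y
  set c : E → List (Fin ℓ) → ℝ → (E →L[ℝ] E) :=
    fun x w u => (fderiv ℝ (wordField Vs w) (Y x u)).comp (J x u) with hc
  set r : E → List (Fin ℓ) → ℝ → (E →L[ℝ] E) :=
    fun x w u => (highDeriv m V Vs (t - s) a w (Y x u)).comp (J x u) with hr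
  have hder : ∀ x, ∀ w : List (Fin ℓ), w.length ≤ m → ∀ u ∈ Icc (0 : ℝ) 1,
      HasDerivWithinAt (c x w)
        (ev (fun v => if v.length + w.length ≤ m then c x (v ++ w) u else 0) a + r x w u)
        (Icc 0 1) u := fun x w hw u hu =>
    hasDerivWithinAt_fderiv_wordField_comp hC (by omega) (h1 x).2.2.1 (h1 x).2.2.2.1 (by omega) hu
  have hc1 : ∀ x, c x [] 1 = fderiv ℝ ν x := fun x => by
    rw [(h1 x).2.2.2.2.1.fderiv]
    change (fderiv ℝ id (Y x 1)).comp (J x 1) = _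
    rw [fderiv_id, ContinuousLinearMap.id_comp]
  have hc0 : ∀ x v, c x v 0 = fderiv ℝ (wordField Vs v) x := fun x v => by
    change (fderiv ℝ (wordField Vs v) (Y x 0)).comp (J x 0) = _
    rw [(h1 x).1, (h1 x).2.2.2.1.1, ContinuousLinearMap.comp_id]
  -- A is exactly the error of the expansion of J_1 = Dν along words of length at most m.
  have hAx : ∀ x, A x = c x [] 1 -
      ev (fun v => if v.length ≤ m then c x v 0 else 0) (expo a) := fun x => by
    simp only [hc0]
    rw [hc1, hA, ev_fderiv_wordField_expo m ha]
    abel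
  have hcomp : ∀ {P Q : E →L[ℝ] E} {q k b : ℝ} (_ : 0 ≤ q) (_ : 0 ≤ b) (_ : q * ‖P‖ ≤ b)
      (_ : ‖Q‖ ≤ k), q * ‖P.comp Q‖ ≤ b * k := by
    intro P Q q k b hq hb h h'
    calc q * ‖P.comp Q‖ ≤ q * (‖P‖ * ‖Q‖) :=
          mul_le_mul_of_nonneg_left (ContinuousLinearMap.opNorm_comp_le _ _) hq
      _ = q * ‖P‖ * ‖Q‖ := by ring
      _ ≤ b * k := mul_le_mul h h' (norm_nonneg _) hb
  constructor
  · intro x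
    rw [hAx]
    refine (word_expansion_nil (by omega) hτ (η := C₁ * τ ^ N * L) (by positivity) ha haK (c x)
      (r x) (hder x) (fun w hw u hu => hcomp (by positivity) (by positivity) (hhigh w hw _)
        ((h1 x).2.2.2.2.2 u hu))).trans ?_
    rw [← hW, mul_assoc W]
    refine mul_le_mul_of_nonneg_left ?_ hW0
    have : C₁ * τ ^ N * L = C₁ * L * τ ^ N := by ring
    rw [this]
    refine mul_le_mul_of_nonneg_right ?_ hτN
    have e1 : 0 ≤ C₁ * L ^ ρ * L := by positivity
    have e2 : 0 ≤ C₁ * (M * L ^ 3) := by positivity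
    linarith
  · intro x x'
    have hd : 0 ≤ ‖x - x'‖ ^ ρ := Real.rpow_nonneg (norm_nonneg _) _
    have hsub : ∀ (g g' : List (Fin ℓ) → E →L[ℝ] E) (k : ℕ) (b : TruncTensor ℓ N),
        ev (fun v => if v.length + k ≤ m then g v - g' v else 0) b =
        ev (fun v => if v.length + k ≤ m then g v else 0) b -
          ev (fun v => if v.length + k ≤ m then g' v else 0) b := by
      intro g g' k b
      rw [← ev_sub]
      refine congrArg (fun h => ev h b) (funext fun v => ?_)
      split_ifs
      · rfl
      · rw [sub_zero]
    have hAA : A x - A x' = (c x [] 1 - c x' [] 1) -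
        ev (fun v => if v.length ≤ m then c x v 0 - c x' v 0 else 0) (expo a) := by
      have := hsub (fun v => c x v 0) (fun v => c x' v 0) 0 (expo a)
      simp only [add_zero] at this
      rw [this, hAx, hAx]; abel
    rw [hAA]
    have hη : 0 ≤ (C₁ * L ^ ρ * L + C₁ * (M * L ^ 3)) * ‖x - x'‖ ^ ρ * τ ^ N := by positivity
    -- The system is linear in the family, so the difference of the families of two starting points
    -- satisfies it with the difference of the error terms.
    refine (word_expansion_nil (by omega) hτ hη ha haK (fun w u => c x w u - c x' w u)
      (fun w u => r x w u - r x' w u) (fun w hw u hu => ?_) (fun w hw u hu => ?_)).trans ?_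
    · refine ((hder x w hw u hu).sub (hder x' w hw u hu)).congr_deriv ?_
      rw [hsub (fun v => c x (v ++ w) u) (fun v => c x' (v ++ w) u)]
      abel
    · obtain ⟨hY, hJ⟩ := h2 x x' u hu
      have e : r x w u - r x' w u =
          (highDeriv m V Vs (t - s) a w (Y x u) - highDeriv m V Vs (t - s) a w (Y x' u)).comp
            (J x u) + (highDeriv m V Vs (t - s) a w (Y x' u)).comp (J x u - J x' u) := by
        rw [ContinuousLinearMap.sub_comp, ContinuousLinearMap.comp_sub]
        change (highDeriv m V Vs (t - s) a w (Y x u)).comp (J x u) -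
          (highDeriv m V Vs (t - s) a w (Y x' u)).comp (J x' u) = _
        abel
      have hYρ : ‖Y x u - Y x' u‖ ^ ρ ≤ ‖x - x'‖ ^ ρ * L ^ ρ := by
        rw [← Real.mul_rpow (norm_nonneg _) hL0.le]
        exact Real.rpow_le_rpow (norm_nonneg _) hY hρ.le
      have b1 := hcomp (q := τ ^ w.length) (by positivity) (by positivity)
        ((hhighd w hw (Y x u) (Y x' u)).trans (mul_le_mul_of_nonneg_right
          (mul_le_mul_of_nonneg_left hYρ hC₁0) hτN)) ((h1 x).2.2.2.2.2 u hu)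
      have b2 := hcomp (q := τ ^ w.length) (by positivity) (by positivity)
        (hhigh w hw (Y x' u)) hJ
      rw [e]
      calc _ ≤ τ ^ w.length * (_ + _) :=
            mul_le_mul_of_nonneg_left (norm_add_le _ _) (by positivity)
        _ ≤ C₁ * (‖x - x'‖ ^ ρ * L ^ ρ) * τ ^ N * L +
            C₁ * τ ^ N * (M * L ^ 3 * ‖x - x'‖ ^ ρ) := by rw [mul_add]; exact add_le_add b1 b2
        _ = _ := by ring
    · rw [← hW, mul_assoc (W * D), mul_assoc W]
      refine mul_le_mul_of_nonneg_left ?_ hW0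
      have e1 : 0 ≤ C₁ * L * (τ ^ N * ‖x - x'‖ ^ ρ) := by positivity
      have e2 : D * (τ ^ N * ‖x - x'‖ ^ ρ) = C₁ * L * (τ ^ N * ‖x - x'‖ ^ ρ) +
        (C₁ * L ^ ρ * L + C₁ * (M * L ^ 3)) * ‖x - x'‖ ^ ρ * τ ^ N := by rw [hD]; ring
      linarith

end SmoothPart

/-! ### Composition estimate for the differentials -/

section SmoothFlow

universe u
variable {E : Type u} [NormedAddCommGroup E] [NormedSpace ℝ E] [CompleteSpace E] {ℓ : ℕ}
  {T p γ M ρ κ : ℝ} {X : ℝ → TruncTensor ℓ ⌊p⌋₊} {Λ : ℝ → ℝ → List (Fin ℓ) → ℝ} {V : E → E}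
  {Vs : Fin ℓ → E → E} {μ : ℝ → ℝ → E → E}

/-- The time-one maps of the logarithmic equation compose well, and so do their differentials. -/
theorem exists_differential_composition_bound (hT : 0 < T) (hp : 2 ≤ p) (hpγ : p < γ)
    (hγ : γ < (⌊p⌋₊ : ℝ) + 1) (hX : IsWeakGeometricRoughPath p T X) (hΛ : IsLogCoordinates T X Λ)
    {a : ℝ} (hκ : 0 ≤ κ) (hκ1 : κ ≤ 1) (ha : 0 ≤ a) (haγ : a ≤ γ / p) (haκ : a ≤ 1 + κ / p)
    (hC : ∀ i, ContDiff ℝ ⌊p⌋₊ (Vs i)) (hVs : ∀ i, Regular (γ - ⌊p⌋₊) ⌊p⌋₊ (Vs i))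
    (hV : Regular κ 1 V) (hρ : 0 < ρ) (hρ1 : ρ ≤ 1)
    (hH : ∀ s t : ℝ, 0 ≤ s → s ≤ t → t ≤ T → IsHolderField M ρ (logField ⌊p⌋₊ V Vs Λ t s)
      (logDeriv V Vs (t - s) (logTensor ⌊p⌋₊ Λ t s)))
    (hμ : ∀ s t : ℝ, 0 ≤ s → s ≤ t → t ≤ T → ∀ x : E,
      IsTimeOneValue (logField ⌊p⌋₊ V Vs Λ t s) x (μ t s x)) :
    ∃ c : ℝ, 0 < c ∧ ∀ s u t : ℝ, 0 ≤ s → s ≤ u → u ≤ t → t ≤ T → ∀ x : E,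
      ‖μ t u (μ u s x) - μ t s x‖ ≤ c * (t - s) ^ a ∧
      ‖fderiv ℝ (μ t u ∘ μ u s) x - fderiv ℝ (μ t s) x‖ ≤ c * (t - s) ^ a := by
  have hfl : (⌊p⌋₊ : ℝ) ≤ p := Nat.floor_le (by linarith)
  have hN : 1 ≤ ⌊p⌋₊ := Nat.le_floor (by push_cast; linarith)
  have hM : 0 ≤ M := (hH 0 0 le_rfl le_rfl hT.le).nonneg
  set L := Real.exp M with hL
  have hL1 : 1 ≤ L := Real.one_le_exp hM
  -- The radius L² accommodates unit vectors transported by two successive linearized flows, each of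
  -- norm at most L.
  obtain ⟨M', hM', hF⟩ := exists_isWordSystem_tangent hN (by linarith) (by linarith) hκ hκ1 hC hVs hV
    (R := L * L) (by positivity)
  obtain ⟨c, hc, hb⟩ := exists_approxFlow_bound hT hp hpγ hγ hX hΛ hM' hκ hκ1 ha haγ haκ hF
    (fun b hb => actsAsDerivation_tangent hC _ hb)
  refine ⟨c, hc, fun s u t hs hsu hut ht x => ?_⟩
  obtain ⟨Y₁, J₁, h1, -⟩ := (hH s u hs hsu (hut.trans ht)).exists_flow hρ hρ1
    (hμ s u hs hsu (hut.trans ht))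
  obtain ⟨Y₂, J₂, h2, -⟩ := (hH u t (hs.trans hsu) hut ht).exists_flow hρ hρ1
    (hμ u t (hs.trans hsu) hut ht)
  obtain ⟨Y₃, J₃, h3, -⟩ := (hH s t hs (hsu.trans hut) ht).exists_flow hρ hρ1
    (hμ s t hs (hsu.trans hut) ht)
  obtain ⟨y10, y11, y1, j1, d1, b1⟩ := h1 x
  obtain ⟨y20, y21, y2, j2, d2, b2⟩ := h2 (μ u s x)
  obtain ⟨y30, y31, y3, j3, d3, b3⟩ := h3 x
  have hlin : ∀ {J : E →L[ℝ] E} (_ : ‖J‖ ≤ L) {h : E} {r : ℝ} (_ : ‖h‖ ≤ r), ‖J h‖ ≤ L * r :=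
    fun hJ _ _ hh => (ContinuousLinearMap.le_opNorm _ _).trans
      (mul_le_mul hJ hh (norm_nonneg _) (by positivity))
  have key : ∀ h : E, ‖h‖ ≤ 1 → ‖(μ t u (μ u s x), J₂ (μ u s x) 1 (J₁ x 1 h)) -
      (μ t s x, J₃ x 1 h)‖ ≤ c * (t - s) ^ a := by
    intro h hh
    have hL2 : L * 1 ≤ L * L := mul_le_mul_of_nonneg_left hL1 (by positivity)
    have := hb s u t hs hsu hut ht (fun r => (Y₁ x r, J₁ x r h))
      (fun r => (Y₂ (μ u s x) r, J₂ (μ u s x) r (J₁ x 1 h))) (fun r => (Y₃ x r, J₃ x r h))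
      (isPath_tangent hC y1 j1 h fun r hr => (hlin (b1 r hr) hh).trans hL2)
      (isPath_tangent hC y2 j2 (J₁ x 1 h) fun r hr =>
        hlin (b2 r hr) ((hlin (b1 1 (by simp)) hh).trans (le_of_eq (mul_one L))))
      (isPath_tangent hC y3 j3 h fun r hr => (hlin (b3 r hr) hh).trans hL2)
      (by simp [y20, y11, j2.1]) (by simp [y30, y10, j3.1, j1.1])
    simpa only [y21, y31] using this
  have hb0 : 0 ≤ c * (t - s) ^ a := mul_nonneg hc.le (Real.rpow_nonneg (by linarith) _)
  constructor
  -- The tangent vector 0 gives the estimate for the maps; unit vectors give it for the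
  -- differentials.
  · exact (norm_fst_le _).trans (key 0 (by simp))
  · rw [(d2.comp x d1).fderiv, d3.fderiv]
    refine ContinuousLinearMap.opNorm_le_of_unit_norm hb0 fun h hh => ?_
    exact (norm_snd_le _).trans (key h hh.le)

end SmoothFlow

end RoughFlow

namespace RoughFlow

open TruncTensor

/-! ### The C^1-approximate flow and existence in the Lipschitz case -/

section Main

universe u
variable {E : Type u} [NormedAddCommGroup E] [NormedSpace ℝ E] {ℓ : ℕ}
  {T p γ ρ : ℝ} {X : ℝ → TruncTensor ℓ ⌊p⌋₊} {Λ : ℝ → ℝ → List (Fin ℓ) → ℝ} {V : E → E}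
  {Vs : Fin ℓ → E → E}

theorem exists_isHolderField_of_roughPath (hp : 2 ≤ p) (hT : 0 < T)
    (hX : IsWeakGeometricRoughPath p T X) (hΛ : IsLogCoordinates T X Λ) (hρ : 0 ≤ ρ) (hρ1 : ρ ≤ 1)
    (hC : ∀ i, ContDiff ℝ ⌊p⌋₊ (Vs i)) (hVs : ∀ i, Regular ρ ⌊p⌋₊ (Vs i)) (hV : Regular ρ 1 V) :
    ∃ M : ℝ, ∀ s t : ℝ, 0 ≤ s → s ≤ t → t ≤ T → IsHolderField M ρ (logField ⌊p⌋₊ V Vs Λ t s)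
      (logDeriv V Vs (t - s) (logTensor ⌊p⌋₊ Λ t s)) := by
  obtain ⟨K, hK, hKL⟩ := exists_scaledBound_logTensor hp hX hΛ
  obtain ⟨M, hM⟩ := exists_isHolderField_logField (R := 1 + T) (T := T) (K := K) hρ hρ1
    (by linarith) hC hVs hV Λ
  have hp0 : 0 < p := by linarith
  have hp1 : 1 / p ≤ 1 := by rw [div_le_one hp0]; linarith
  refine ⟨M, fun s t hs hst ht => hM s t hst (by linarith) (hKL s t hs hst ht _ ?_)⟩
  exact (rpow_le_one_add (sub_nonneg.mpr hst) (by positivity) hp1).trans (by linarith)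

/-- The displacement of the time-one map of a Hölder `C^1` field is `(1+ρ)`-Lipschitz. -/
theorem IsHolderField.isGLipschitz_sub_id [CompleteSpace E] {M : ℝ} {W : E → E} {W' : E → E →L[ℝ] E}
    (hρ : 0 < ρ) (hρ1 : ρ < 1) (hW : IsHolderField M ρ W W') {ν : E → E}
    (hν : ∀ x, IsTimeOneValue W x (ν x)) :
    IsGLipschitz (1 + ρ) (fun x => ν x - x) := by
  obtain ⟨Y, J, h1, h2⟩ := hW.exists_flow hρ hρ1.le hν
  have hM := hW.nonneg
  have hd : ∀ x, HasFDerivAt (fun x => ν x - x) (J x 1 - ContinuousLinearMap.id ℝ E) x :=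
    fun x => (h1 x).2.2.2.2.1.sub (hasFDerivAt_id x)
  have h01 : (1 : ℝ) ∈ Icc (0 : ℝ) 1 := by simp
  set L := Real.exp M with hL
  have hL0 : 0 < L := Real.exp_pos _
  have hML : 0 ≤ M * L ^ 3 := by positivity
  refine isGLipschitz_one_add_of_bounds (K := M + (L + 1) + M * L ^ 3) hρ hρ1
    (fun x => (hd x).differentiableAt) (fun x => ?_) (fun x => ?_) (fun x y => ?_)
  · have := norm_image_sub_le_of_norm_deriv_le_segment' (h1 x).2.2.1
      (fun u _ => hW.norm_le _) 1 h01
    rw [(h1 x).1, (h1 x).2.1] at this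
    linarith
  · rw [(hd x).fderiv]
    have e1 := (h1 x).2.2.2.2.2 1 h01
    have e2 : ‖ContinuousLinearMap.id ℝ E‖ ≤ 1 := ContinuousLinearMap.norm_id_le
    have := _root_.norm_sub_le (J x 1) (ContinuousLinearMap.id ℝ E)
    linarith
  · rw [(hd x).fderiv, (hd y).fderiv, sub_sub_sub_cancel_right]
    refine ((h2 x y 1 h01).2).trans (mul_le_mul_of_nonneg_right (by linarith)
      (Real.rpow_nonneg (norm_nonneg _) _))

/-- The composition estimates come from the tangent lift, the splitting from the expansion of the
linearized flow. The exponents of V and of the V_i are kept separate in the former, to reach the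
stated a, and merged into one exponent r in the latter. -/
theorem isC1ApproxFlow_of_smooth [CompleteSpace E] (hT : 0 < T) (hp : 2 ≤ p) (hpγ : p < γ)
    (hγ : γ < (⌊p⌋₊ : ℝ) + 1) (hX : IsWeakGeometricRoughPath p T X) (hΛ : IsLogCoordinates T X Λ)
    (hρ : (p - (⌊p⌋₊ : ℝ)) / p < ρ) (hV : IsGLipschitz (1 + ρ) V)
    (hVs : ∀ i, IsGLipschitz γ (Vs i)) :
    (∀ s t : ℝ, 0 ≤ s → s ≤ t → t ≤ T → ∀ x : E,
      ∃! z : E, IsTimeOneValue (logField ⌊p⌋₊ V Vs Λ t s) x z) ∧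
    ∀ μ : ℝ → ℝ → E → E, (∀ s t : ℝ, 0 ≤ s → s ≤ t → t ≤ T → ∀ x : E,
      IsTimeOneValue (logField ⌊p⌋₊ V Vs Λ t s) x (μ t s x)) →
      IsC1ApproxFlow T (min (1 + ρ / p) (γ / p)) μ := by
  have hp0 : 0 < p := by linarith
  have hfl : (⌊p⌋₊ : ℝ) ≤ p := Nat.floor_le hp0.le
  have hN : 1 ≤ ⌊p⌋₊ := Nat.le_floor (by push_cast; linarith)
  obtain ⟨m, hm⟩ : ∃ m, ⌊p⌋₊ = m + 1 := ⟨⌊p⌋₊ - 1, by omega⟩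
  have hpN : 0 ≤ (p - (⌊p⌋₊ : ℝ)) / p := div_nonneg (by linarith) hp0.le
  have hρ0 : 0 < ρ := hpN.trans_lt hρ
  have hflo : ⌊γ⌋₊ = ⌊p⌋₊ := by
    rw [Nat.floor_eq_iff (by linarith)]; constructor <;> linarith
  have hfr : Int.fract γ = γ - ⌊p⌋₊ := by
    rw [Int.fract_eq_iff]
    exact ⟨by linarith, by linarith, ⌊p⌋₊, by push_cast; ring⟩
  have hC : ∀ i, ContDiff ℝ ⌊p⌋₊ (Vs i) := fun i => by have := (hVs i).1; rwa [hflo] at this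
  have hreg : ∀ i, Regular (γ - ⌊p⌋₊) ⌊p⌋₊ (Vs i) := fun i => by
    have := (hVs i).regular; rwa [hflo, hfr] at this
  have hVr : Regular (min ρ 1) 1 V := hV.regular_one hρ0
  set r : ℝ := min ρ (γ - ⌊p⌋₊) with hr
  have hr0 : 0 < r := lt_min hρ0 (by linarith)
  have hr1 : r < 1 := (min_le_right _ _).trans_lt (by linarith)
  have hregr : ∀ i, Regular r ⌊p⌋₊ (Vs i) := fun i =>
    (hreg i).of_exponent_le hr0.le (min_le_right _ _)
  have hVrr : Regular r 1 V := hVr.of_exponent_le hr0.le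
    (le_min (min_le_left _ _) hr1.le)
  obtain ⟨M, hH⟩ := exists_isHolderField_of_roughPath hp hT hX hΛ hr0.le hr1.le hC hregr hVrr
  have hM : 0 ≤ M := (hH 0 0 le_rfl le_rfl hT.le).nonneg
  refine ⟨fun s t hs hst ht x => (hH s t hs hst ht).existsUnique_timeOneValue x, fun μ hμ => ?_⟩
  have h1a : 1 < min (1 + ρ / p) (γ / p) :=
    lt_min (by have : 0 < ρ / p := by positivity
               linarith) (by rwa [one_lt_div hp0])
  -- Saturating ρ at 1 loses nothing, because γ < [p] + 1 ≤ p + 1 gives γ/p ≤ 1 + 1/p.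
  have haκ : min (1 + ρ / p) (γ / p) ≤ 1 + min ρ 1 / p := by
    rcases le_total ρ 1 with h | h
    · rw [min_eq_left h]; exact min_le_left _ _
    · rw [min_eq_right h]
      refine (min_le_right _ _).trans ?_
      rw [div_le_iff₀ hp0, add_mul, div_mul_cancel₀ _ hp0.ne']
      linarith
  obtain ⟨c, hc, hcomp⟩ := exists_differential_composition_bound hT hp hpγ hγ hX hΛ
    (le_min hρ0.le zero_le_one) (min_le_right _ _) (by linarith) (min_le_right _ _) haκ hC hreg hVr
    hr0 hr1.le hH hμ
  obtain ⟨K, hK, hKL⟩ := exists_scaledBound_logTensor hp hX hΛ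
  obtain ⟨C, hC0, hsm⟩ := exists_smoothPart_bound (R := 1 + T) hr0.le hr1.le hK (by linarith) hC
    hregr (by omega : m < ⌊p⌋₊)
  obtain ⟨D, hD0, hrem⟩ := exists_remainder_bound (R := 1 + T) hm hK (by linarith) hM hr0 hr1.le hC
    hregr hVrr Λ
  set q : ℝ := (⌊p⌋₊ : ℝ) / p with hq
  have hq1 : q ≤ 1 := (div_le_one hp0).mpr hfl
  have hq0 : 0 ≤ q := by positivity
  -- Here the lower bound on ρ is used: 1 - q = (p - [p])/p. For the exponent γ - [p] the inequality
  -- follows from γ > p ≥ 2.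
  have hrq : 1 - r < q := by
    have e : 1 - q = (p - (⌊p⌋₊ : ℝ)) / p := by rw [hq, sub_div, div_self hp0.ne']
    have : 1 - q < r := by
      rw [e]
      refine lt_min hρ ?_
      rw [div_lt_iff₀ hp0]
      nlinarith
    linarith
  have hτ : ∀ {s t : ℝ}, 0 ≤ s → s ≤ t → t ≤ T → 0 ≤ (t - s) ^ (1 / p) ∧
      (t - s) ^ (1 / p) ≤ 1 + T ∧ ((t - s) ^ (1 / p)) ^ ⌊p⌋₊ = (t - s) ^ q ∧
      t - s ≤ (1 + T) * ((t - s) ^ (1 / p)) ^ ⌊p⌋₊ := by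
    intro s t hs hst ht
    have hδ : 0 ≤ t - s := sub_nonneg.mpr hst
    have e1 : ((t - s) ^ (1 / p)) ^ ⌊p⌋₊ = (t - s) ^ q := by
      rw [← Real.rpow_natCast, ← Real.rpow_mul hδ, hq]
      congr 1; ring
    refine ⟨Real.rpow_nonneg hδ _, (rpow_le_one_add hδ (by positivity) (by
      rw [div_le_one hp0]; linarith)).trans (by linarith), e1, ?_⟩
    rw [e1]
    calc t - s = (t - s) ^ (1 - q) * (t - s) ^ q := by
          rw [← Real.rpow_add_of_nonneg hδ (by linarith) hq0, sub_add_cancel, Real.rpow_one]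
      _ ≤ (1 + T) * (t - s) ^ q := mul_le_mul_of_nonneg_right
          ((rpow_le_one_add hδ (by linarith) (by linarith)).trans (by linarith))
          (Real.rpow_nonneg hδ _)
  -- The midpoint, and not q itself, because q = 1 when p is an integer while α < 1 is required. The
  -- surplus (t-s)^{q-α} is absorbed in T^{q-α}.
  set α : ℝ := (1 - r + q) / 2 with hα
  refine ⟨⟨h1a, c, hc, fun s u t hs hsu hut ht x => (hcomp s u t hs hsu hut ht x).1⟩, α, r,
    by linarith, by rw [hα]; linarith, by rw [hα]; linarith,
    fun s t hs hst ht => (hH s t hs hst ht).isGLipschitz_sub_id hr0 hr1 (hμ s t hs hst ht),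
    ⟨fun t s x => fderiv ℝ (μ t s) x - ContinuousLinearMap.id ℝ E -
      smoothPart m Vs (logTensor ⌊p⌋₊ Λ t s) x,
      fun t s => smoothPart m Vs (logTensor ⌊p⌋₊ Λ t s), 2 * D * T ^ (q - α),
      fun δ => 2 * (C * |δ| ^ (1 / p)), ?_, fun s t hs hst ht => ?_⟩,
    c, hc, fun s u t hs hsu hut ht x => (hcomp s u t hs hsu hut ht x).2⟩
  -- The absolute value lets the bound tend to 0 from both sides, as a limit in the full
  -- neighbourhood filter of 0 requires.
  · have hcont : Continuous fun δ : ℝ => 2 * (C * |δ| ^ (1 / p)) :=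
      ((continuous_abs.rpow_const fun _ => Or.inr (by positivity)).const_mul C).const_mul 2
    have := hcont.tendsto 0
    simpa [Real.zero_rpow (inv_ne_zero hp0.ne')] using this
  · obtain ⟨hτ0, hτR, hτN, hδR⟩ := hτ hs hst ht
    have hδ : 0 ≤ t - s := sub_nonneg.mpr hst
    have hsb := hKL s t hs hst ht _ le_rfl
    obtain ⟨hA, hA'⟩ := hrem s t _ hst hτ0 hτR hδR hsb (hH s t hs hst ht) (μ t s)
      (hμ s t hs hst ht) (fun x => fderiv ℝ (μ t s) x - ContinuousLinearMap.id ℝ E -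
        smoothPart m Vs (logTensor ⌊p⌋₊ Λ t s) x) (fun x => by abel)
    obtain ⟨g1, g2⟩ := isGLipschitz_of_bounds hr0 hr1 hA hA'
    refine ⟨fun x => by beta_reduce; abel, g1, g2.trans (ENNReal.ofReal_le_ofReal ?_),
      contDiff_smoothPart hC (by omega) _, ?_⟩
    · have e : (t - s) ^ q = (t - s) ^ (q - α) * (t - s) ^ α := by
        rw [← Real.rpow_add_of_nonneg hδ (by rw [hα]; linarith) (by rw [hα]; linarith),
          sub_add_cancel]
      have e1 : (t - s) ^ (q - α) ≤ T ^ (q - α) :=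
        Real.rpow_le_rpow hδ (by linarith) (by rw [hα]; linarith)
      rw [hτN, e]
      calc 2 * (D * ((t - s) ^ (q - α) * (t - s) ^ α))
          = 2 * D * (t - s) ^ (q - α) * (t - s) ^ α := by ring
        _ ≤ 2 * D * T ^ (q - α) * (t - s) ^ α := mul_le_mul_of_nonneg_right
          (mul_le_mul_of_nonneg_left e1 (by positivity)) (Real.rpow_nonneg hδ _)
    · beta_reduce
      rw [abs_of_nonneg hδ]
      exact eCkNorm_one_le (fun x => (hsm _ hτ0 hτR _ hsb x).1) fun x => (hsm _ hτ0 hτR _ hsb x).2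

theorem exists_isTimeOneValue_of_lipschitz [CompleteSpace E] (hp : 2 ≤ p) (hpγ : p < γ) (hγ : γ < (⌊p⌋₊ : ℝ) + 1)
    (hVb : ∃ M : ℝ, ∀ x, ‖V x‖ ≤ M) (hVl : ∃ K : ℝ≥0, LipschitzWith K V)
    (hVs : ∀ i, IsGLipschitz (γ - 1) (Vs i)) (hcomp : CompactnessCondition ⌊γ⌋₊ Vs)
    (Λ : ℝ → ℝ → List (Fin ℓ) → ℝ) {s t : ℝ} (hst : s ≤ t) (x : E) :
    ∃ z, IsTimeOneValue (logField ⌊p⌋₊ V Vs Λ t s) x z := by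
  have hp0 : 0 < p := by linarith
  have hfl : (⌊p⌋₊ : ℝ) ≤ p := Nat.floor_le hp0.le
  have hN : 1 ≤ ⌊p⌋₊ := Nat.le_floor (by push_cast; linarith)
  obtain ⟨m, hm⟩ : ∃ m, ⌊p⌋₊ = m + 1 := ⟨⌊p⌋₊ - 1, by omega⟩
  have hm' : (⌊p⌋₊ : ℝ) = m + 1 := by rw [hm]; push_cast; ring
  have hflo : ⌊γ - 1⌋₊ = m := by
    rw [Nat.floor_eq_iff (by linarith)]; constructor <;> linarith
  have hfloγ : ⌊γ⌋₊ = ⌊p⌋₊ := by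
    rw [Nat.floor_eq_iff (by linarith)]; constructor <;> linarith
  have hfr : Int.fract (γ - 1) = γ - ⌊p⌋₊ := by
    rw [Int.fract_eq_iff]
    exact ⟨by linarith, by linarith, m, by rw [hm']; push_cast; ring⟩
  rw [hfloγ] at hcomp
  exact exists_isTimeOneValue_of_compactness (θ := γ - ⌊p⌋₊) (by linarith) (by linarith) hm hVb hVl
    (fun i => by have := (hVs i).1; rwa [hflo] at this)
    (fun i => by have := (hVs i).regular; rwa [hflo, hfr] at this) hcomp Λ hst x

end Main

end RoughFlow

end

theorem mainTheorem9 {E : Type*} [NormedAddCommGroup E] [NormedSpace ℝ E] [CompleteSpace E]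
    (ℓ : ℕ) (T p γ : ℝ) (hT : 0 < T) (hp : 2 ≤ p) (hpγ : p < γ) (hγ : γ < (⌊p⌋₊ : ℝ) + 1)
    (X : ℝ → RoughFlow.TruncTensor ℓ ⌊p⌋₊) (hX : RoughFlow.IsWeakGeometricRoughPath p T X) :
    -- the logarithm of `𝐗_{ts}` has coordinates on the brackets `e_{[I]}`,
    (∃ Λ : ℝ → ℝ → List (Fin ℓ) → ℝ, RoughFlow.IsLogCoordinates T X Λ) ∧
    -- and for any choice of them the following holds.
    ∀ Λ : ℝ → ℝ → List (Fin ℓ) → ℝ, RoughFlow.IsLogCoordinates T X Λ →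
    ∀ (V : E → E) (Vs : Fin ℓ → E → E),
      -- (1) `V` bounded and Lipschitz, the `V_i` are `(γ-1)`-Lipschitz
      ((∃ M : ℝ, ∀ x : E, ‖V x‖ ≤ M) → (∃ K : NNReal, LipschitzWith K V) →
        (∀ i : Fin ℓ, RoughFlow.IsGLipschitz (γ - 1) (Vs i)) →
        (RoughFlow.CompactnessCondition ⌊γ⌋₊ Vs →
          ∀ s t : ℝ, 0 ≤ s → s ≤ t → t ≤ T → ∀ x : E,
            ∃ z : E, RoughFlow.IsTimeOneValue (RoughFlow.logField ⌊p⌋₊ V Vs Λ t s) x z) ∧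
        ∀ μ : ℝ → ℝ → E → E,
          (∀ s t : ℝ, 0 ≤ s → s ≤ t → t ≤ T → ∀ x : E,
            RoughFlow.IsTimeOneValue (RoughFlow.logField ⌊p⌋₊ V Vs Λ t s) x (μ t s x)) →
          ∃ a : ℝ, RoughFlow.IsApproxFlow T a μ) ∧
      -- (2) `V` is `(1+ρ)`-Lipschitz, the `V_i` are `γ`-Lipschitz
      (∀ ρ : ℝ, (p - (⌊p⌋₊ : ℝ)) / p < ρ → RoughFlow.IsGLipschitz (1 + ρ) V →
        (∀ i : Fin ℓ, RoughFlow.IsGLipschitz γ (Vs i)) →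
        (∀ s t : ℝ, 0 ≤ s → s ≤ t → t ≤ T → ∀ x : E,
          ∃! z : E, RoughFlow.IsTimeOneValue (RoughFlow.logField ⌊p⌋₊ V Vs Λ t s) x z) ∧
        ∀ μ : ℝ → ℝ → E → E,
          (∀ s t : ℝ, 0 ≤ s → s ≤ t → t ≤ T → ∀ x : E,
            RoughFlow.IsTimeOneValue (RoughFlow.logField ⌊p⌋₊ V Vs Λ t s) x (μ t s x)) →
          RoughFlow.IsC1ApproxFlow T (min (1 + ρ / p) (γ / p)) μ) := by
  have hN : 1 ≤ ⌊p⌋₊ := Nat.le_floor (by push_cast; linarith)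
  refine ⟨RoughFlow.exists_isLogCoordinates hN hX.2, fun Λ hΛ V Vs => ⟨fun hVb hVl hVs =>
    ⟨fun hcomp s t _ hst _ x => RoughFlow.exists_isTimeOneValue_of_lipschitz hp hpγ hγ hVb hVl hVs
      hcomp Λ hst x, fun μ hμ => ⟨_, RoughFlow.isApproxFlow_of_lipschitz hT hp hpγ hγ hX hΛ hVb hVl
      hVs hμ⟩⟩, fun ρ hρ hV hVs => RoughFlow.isC1ApproxFlow_of_smooth hT hp hpγ hγ hX hΛ hρ hV hVs⟩⟩
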